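/- Let $n\ge 3$, $b>0$, $\nu>0$, $\gamma\in(1,5/3]$, $\kappa>0$ (in particular $0<\kappa\ll1$), and put $\delta:=b\nu+(\gamma-1)\kappa$. Consider the linear Blackstock model on $\mathbb{R}^n$, $$(\partial_t-\kappa\Delta)(\psi_{tt}-\Delta\psi-\delta\Delta\psi_t)+\kappa(\gamma-1)(b\nu-\kappa)\Delta^2\psi_t=0\quad (t>0),\qquad \psi(0)=\psi_0,\ \psi_t(0)=\psi_1,\ \psi_{tt}(0)=\psi_2 .$$ A solution is a function $\psi\in C([0,\infty),L^2(\mathbb{R}^n))$ that satisfies the equation and the initial conditions in the sense of tempered distributions: there are $u(t)=\psi_t(t)$ and $w(t)=\psi_{tt}(t)$ in $\mathcal{S}'(\mathbb{R}^n)$ such that, for every Schwartz function $\varphi$, the maps $t\mapsto\langle u(t),\varphi\rangle$ and $t\mapsto\langle w(t),\varphi\rangle$ are continuous on $[0,\infty)$, for $t>0$ the derivatives of $\langle\psi,\varphi\rangle$ and $\langle u,\varphi\rangle$ are $\langle u,\varphi\rangle$ and $\langle w,\varphi\rangle$, the function $\langle w-\Delta\psi-\delta\Delta u,\varphi\rangle$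 is differentiable and the equation tested with $\varphi$ holds, and $\psi(0)=\psi_0$, $u(0)=\psi_1$, $w(0)=\psi_2$. Functions may be complex-valued (in particular real-valued). Let $\|f\|_{L^{1,1}}:=\int_{\mathbb{R}^n}(1+|x|)|f(x)|\,\mathrm{d}x$ and $\|f\|_{L^2\cap L^{1,1}}:=\|f\|_{L^2}+\|f\|_{L^{1,1}}$. For $t\ge0$ define the operators on $L^2(\mathbb{R}^n)$ (as Fourier multipliers, $\sqrt{-\Delta}$ having the symbol $|\xi|$) $$J_0=e^{\kappa t\Delta},\qquad J_1=\frac{\sin(\sqrt{-\Delta}\,t)}{\sqrt{-\Delta}}\,e^{\frac{\delta}{2}t\Delta},\qquad J_2=-\frac{\cos(\sqrt{-\Delta}\,t)}{-\Delta}\,e^{\frac{\delta}{2}t\Delta}+\frac{1}{-\Delta}\,e^{\kappa t\Delta}.$$ Then there is a constant $C>0$ depending only on $n,b,\nu,\gamma,\kappa$ such that for all $\psi_0,\psi_1,\psi_2\in L^2\cap L^{1,1}$ the solution $\psi$ satisfies, for all $t\ge0$, $$\|(\psi-J_0\psi_0-J_1\psi_1-J_2\psi_2)(t,\cdot)\|_{L^2}\le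 C\Big((1+t)^{-\frac12-\frac n4}\|\psi_0\|_{L^2\cap L^{1,1}}+(1+t)^{-\frac n4}\|\psi_1\|_{L^2\cap L^{1,1}}+(1+t)^{\frac12-\frac n4}\|\psi_2\|_{L^2\cap L^{1,1}}\Big).$$ -/

import Mathlib

open MeasureTheory Set
open scoped SchwartzMap FourierTransform Laplacian

noncomputable section

namespace Blackstock

/-- The physical space `ℝⁿ` with its Euclidean norm. -/
abbrev Space (n : ℕ) : Type := EuclideanSpace ℝ (Fin n)

/-- The Hilbert space `L²(ℝⁿ)` (complex-valued functions). -/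
abbrev L2 (n : ℕ) : Type := Lp (α := Space n) ℂ 2 volume

/-- The modified diffusivity of sound `δ = bν + (γ - 1)κ`. -/
def soundDiffusivity (b ν γ κ : ℝ) : ℝ := b * ν + (γ - 1) * κ

/-- Membership of an `L²` function in the weighted space `L^{1,1}`. -/
def MemL11 {n : ℕ} (f : L2 n) : Prop :=
  Integrable (fun x : Space n => (1 + ‖x‖) * ‖f x‖) volume

/-- The norm of `L^{1,1}`: the integral of `(1 + |x|) |f(x)|`. -/
def normL11 {n : ℕ} (f : L2 n) : ℝ := ∫ x : Space n, (1 + ‖x‖) * ‖f x‖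

/-- The norm of `L² ∩ L^{1,1}`. -/
def normL2L11 {n : ℕ} (f : L2 n) : ℝ := ‖f‖ + normL11 f

/-- `ψ` is a solution in `C([0,∞), L²)` of the linear Cauchy problem
`(∂ₜ - κΔ)(ψₜₜ - Δψ - δΔψₜ) + κ(γ-1)(bν-κ)Δ²ψₜ = 0` for `t > 0`,
`ψ(0) = ψ₀`, `ψₜ(0) = ψ₁`, `ψₜₜ(0) = ψ₂`,
where all derivatives are taken in the space of tempered distributions on `ℝⁿ`:
`u` and `w` are `ψₜ` and `ψₜₜ`, continuous on `[0,∞)` and differentiable for `t > 0` after pairing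
with an arbitrary Schwartz function, and `Δ` is the distributional Laplacian. -/
def IsSolution {n : ℕ} (b ν γ κ : ℝ) (ψ₀ ψ₁ ψ₂ : L2 n) (ψ : ℝ → L2 n) : Prop :=
  ContinuousOn ψ (Ici 0) ∧
  ∃ u w : ℝ → 𝓢'(Space n, ℂ),
    (∀ φ : 𝓢(Space n, ℂ), ContinuousOn (fun t => u t φ) (Ici 0)) ∧
    (∀ φ : 𝓢(Space n, ℂ), ContinuousOn (fun t => w t φ) (Ici 0)) ∧
    (∀ φ : 𝓢(Space n, ℂ), ∀ t > 0,
      HasDerivAt (fun s => (ψ s : 𝓢'(Space n, ℂ)) φ) (u t φ) t) ∧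
    (∀ φ : 𝓢(Space n, ℂ), ∀ t > 0, HasDerivAt (fun s => u s φ) (w t φ) t) ∧
    (let δ : ℂ := (soundDiffusivity b ν γ κ : ℂ)
     let q : ℝ → 𝓢'(Space n, ℂ) := fun s => w s - Δ (ψ s : 𝓢'(Space n, ℂ)) - δ • Δ (u s)
     ∀ φ : 𝓢(Space n, ℂ), ∀ t > 0,
      ∃ q' : ℂ, HasDerivAt (fun s => q s φ) q' t ∧
        q' - (κ : ℂ) * Δ (q t) φ
          + ((κ * (γ - 1) * (b * ν - κ) : ℝ) : ℂ) * Δ (Δ (u t)) φ = 0) ∧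
    ψ 0 = ψ₀ ∧ u 0 = (ψ₁ : 𝓢'(Space n, ℂ)) ∧ w 0 = (ψ₂ : 𝓢'(Space n, ℂ))

open Classical in
/-- The operator on `L²(ℝⁿ)` with radial symbol `m(|ξ|)`, that is `m(√(-Δ))`. Mathlib's Fourier
transform has the kernel `exp(-2πi x·ξ)`, for which `√(-Δ)` has the symbol `2π|ξ|`. Outside its
natural domain the operator is set to `0`; the symbols below are bounded for `t ≥ 0`, so that
this case does not occur for them (see `fourier_radialMultiplier`). -/
def radialMultiplier {n : ℕ} (m : ℝ → ℝ) (f : L2 n) : L2 n :=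
  if h : MemLp (fun ξ : Space n => (m (2 * Real.pi * ‖ξ‖) : ℂ) * (𝓕 f : L2 n) ξ) 2 volume
  then 𝓕⁻ (h.toLp : L2 n) else 0

/-- The symbol `exp(-κ r² t)`. -/
def symbolJ0 (κ t r : ℝ) : ℝ := Real.exp (-κ * r ^ 2 * t)

/-- The symbol `sin(r t) / r * exp(-(δ/2) r² t)`. -/
def symbolJ1 (δ t r : ℝ) : ℝ := Real.sin (r * t) / r * Real.exp (-(δ / 2) * r ^ 2 * t)

/-- The symbol `-cos(r t) / r² * exp(-(δ/2) r² t) + 1 / r² * exp(-κ r² t)`. -/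
def symbolJ2 (δ κ t r : ℝ) : ℝ :=
  -(Real.cos (r * t) / r ^ 2) * Real.exp (-(δ / 2) * r ^ 2 * t)
    + 1 / r ^ 2 * Real.exp (-κ * r ^ 2 * t)

/-- `J₀(t) = exp(κtΔ)`. -/
def J0 {n : ℕ} (κ t : ℝ) (f : L2 n) : L2 n := radialMultiplier (symbolJ0 κ t) f

/-- `J₁(t) = sin(√(-Δ) t) / √(-Δ) exp((δ/2)tΔ)`. -/
def J1 {n : ℕ} (δ t : ℝ) (f : L2 n) : L2 n := radialMultiplier (symbolJ1 δ t) f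

/-- `J₂(t) = -cos(√(-Δ) t) (-Δ)⁻¹ exp((δ/2)tΔ) + (-Δ)⁻¹ exp(κtΔ)`. -/
def J2 {n : ℕ} (δ κ t : ℝ) (f : L2 n) : L2 n := radialMultiplier (symbolJ2 δ κ t) f

/-- For a bounded measurable symbol the operator is the genuine Fourier multiplier. -/
theorem fourier_radialMultiplier {n : ℕ} {m : ℝ → ℝ} (hm : Measurable m) {C : ℝ}
    (hC : ∀ r, 0 ≤ r → |m r| ≤ C) (f : L2 n) :
    ((𝓕 (radialMultiplier m f) : L2 n) : Space n → ℂ) =ᵐ[volume]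
      fun ξ => (m (2 * Real.pi * ‖ξ‖) : ℂ) * (𝓕 f : L2 n) ξ := by
  have hb : MemLp (fun ξ : Space n => (m (2 * Real.pi * ‖ξ‖) : ℂ)) ⊤ volume := by
    refine memLp_top_of_bound ?_ C (Filter.Eventually.of_forall fun ξ => ?_)
    · exact (by fun_prop : Measurable fun ξ : Space n =>
        (m (2 * Real.pi * ‖ξ‖) : ℂ)).aestronglyMeasurable
    · rw [Complex.norm_real]
      exact hC _ (by positivity)
  have h : MemLp (fun ξ : Space n => (m (2 * Real.pi * ‖ξ‖) : ℂ) * (𝓕 f : L2 n) ξ) 2 volume :=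
    (Lp.memLp (𝓕 f : L2 n)).mul hb
  have e : radialMultiplier m f = 𝓕⁻ (h.toLp : L2 n) := dif_pos h
  rw [e, FourierTransform.fourier_fourierInv_eq]
  exact h.coeFn_toLp

theorem measurable_symbolJ0 (κ t : ℝ) : Measurable (symbolJ0 κ t) := by
  unfold symbolJ0; fun_prop

theorem measurable_symbolJ1 (δ t : ℝ) : Measurable (symbolJ1 δ t) := by
  unfold symbolJ1; fun_prop

theorem measurable_symbolJ2 (δ κ t : ℝ) : Measurable (symbolJ2 δ κ t) := by
  unfold symbolJ2; fun_prop

theorem exp_aux {a r t : ℝ} (ha : 0 ≤ a) (ht : 0 ≤ t) :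
    0 ≤ 1 - Real.exp (-a * r ^ 2 * t) ∧ 1 - Real.exp (-a * r ^ 2 * t) ≤ a * r ^ 2 * t := by
  have h1 := Real.add_one_le_exp (-a * r ^ 2 * t)
  have h2 : 0 ≤ a * r ^ 2 * t := by positivity
  have h3 : Real.exp (-a * r ^ 2 * t) ≤ 1 := Real.exp_le_one_iff.2 (by linarith)
  exact ⟨by linarith, by linarith⟩

theorem abs_symbolJ0_le {κ t : ℝ} (hκ : 0 ≤ κ) (ht : 0 ≤ t) (r : ℝ) : |symbolJ0 κ t r| ≤ 1 := by
  unfold symbolJ0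
  rw [abs_of_pos (Real.exp_pos _)]
  linarith [(exp_aux (r := r) hκ ht).1]

theorem abs_symbolJ1_le {δ t : ℝ} (hδ : 0 ≤ δ) (ht : 0 ≤ t) (r : ℝ) : |symbolJ1 δ t r| ≤ t := by
  unfold symbolJ1
  have h := (exp_aux (a := δ / 2) (r := r) (by linarith) ht).1
  have hs : |Real.sin (r * t) / r| ≤ t := by
    rw [abs_div]
    refine div_le_of_le_mul₀ (abs_nonneg _) ht ?_
    calc |Real.sin (r * t)| ≤ |r * t| := Real.abs_sin_le_abs
      _ = t * |r| := by rw [abs_mul, abs_of_nonneg ht, mul_comm]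
  rw [abs_mul, abs_of_pos (Real.exp_pos _)]
  calc _ ≤ t * 1 := mul_le_mul hs (by linarith) (Real.exp_pos _).le ht
    _ = t := mul_one t

theorem abs_symbolJ2_le {δ κ t : ℝ} (hδ : 0 ≤ δ) (hκ : 0 ≤ κ) (ht : 0 ≤ t) (r : ℝ) :
    |symbolJ2 δ κ t r| ≤ t ^ 2 / 2 + (δ / 2 + κ) * t := by
  have hpos : 0 ≤ t ^ 2 / 2 + (δ / 2 + κ) * t := by positivity
  obtain ⟨h1, h2⟩ := exp_aux (a := δ / 2) (r := r) (by linarith) ht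
  obtain ⟨h3, h4⟩ := exp_aux (a := κ) (r := r) hκ ht
  have hc := Real.one_sub_sq_div_two_le_cos (x := r * t)
  have hc1 := Real.cos_le_one (r * t)
  have he := Real.exp_pos (-(δ / 2) * r ^ 2 * t)
  have e : symbolJ2 δ κ t r = (((1 - Real.cos (r * t)) * Real.exp (-(δ / 2) * r ^ 2 * t)
      + (1 - Real.exp (-(δ / 2) * r ^ 2 * t))) - (1 - Real.exp (-κ * r ^ 2 * t))) / r ^ 2 := by
    unfold symbolJ2; ring
  have h5 : (1 - Real.cos (r * t)) * Real.exp (-(δ / 2) * r ^ 2 * t) ≤ (r * t) ^ 2 / 2 * 1 :=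
    mul_le_mul (by linarith) (by linarith) he.le (by positivity)
  have h6 : 0 ≤ (1 - Real.cos (r * t)) * Real.exp (-(δ / 2) * r ^ 2 * t) :=
    mul_nonneg (by linarith) he.le
  have h7 : 0 ≤ δ / 2 * r ^ 2 * t := by positivity
  have h8 : 0 ≤ (r * t) ^ 2 / 2 := by positivity
  have h9 : 0 ≤ κ * r ^ 2 * t := by positivity
  rw [e, abs_div, abs_of_nonneg (sq_nonneg r)]
  refine div_le_of_le_mul₀ (sq_nonneg r) hpos ?_
  rw [abs_le]
  constructor <;> nlinarith

end Blackstock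

end

noncomputable section

namespace Blackstock

/-! On the Fourier side, with `r` the angular frequency (so that `-Δ` has symbol `r²`), the equation
decouples into `y''' + (δ+κ) r² y'' + (r² + e r⁴) y' + κ r⁴ y = 0`, where `e = κδ + κ(γ-1)(bν-κ) =
γκbν > 0`. The theorem is an estimate of the difference between `y(t)` and the three symbols applied
to its initial data.

For small `r` the characteristic roots are `-σ` and `-p/2 ± iω` with `σ = κr² + O(r⁴)`, `p = δr² +
O(r⁴)`, `ω = r + O(r³)`. The coefficients of the three modes are `y₀ + y₂/r²`, `-y₂/r²` and `y₁/r`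
to leading order, and these leading terms are the symbols of `J₀`, `J₁`, `J₂`. Errors in the
exponents grow with `t`, but half of the Gaussian decay absorbs this growth. What remains is `exp(-c
r² t) (r|y₀| + |y₁| + |y₂|/r)`, one power of `r` better than the leading terms
(`exists_low_frequency_bound`). For `r` bounded away from zero the Routh–Hurwitz condition holds
uniformly and a Lyapunov functional gives decay `exp(-ct)` (`exists_decay_of_routh_hurwitz`,
`exists_high_frequency_bound`).

The data have bounded Fourier transforms, and `r^k exp(-c r² s)` has `L²` norm proportional to
`s^(-k/2-n/4)` (`exists_gaussian_weight`). The values `k = 1, 0, -1` give the three rates, and `k =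
-1` is admissible near `r = 0` because `n ≥ 3`. High frequencies are estimated by Plancherel.

Since the solution is only distributional, it must also be shown that its Fourier transform solves
the ODE at almost every frequency (`IsSolution.ae_solvesODE`). Testing the equation and integrating
it three times in time gives a Volterra identity that involves only `L²`-valued primitives. Where
the coefficients are bounded, this identity is a linear ODE in `L²` with a bounded multiplication
operator, whose exponential acts pointwise. -/

/-- `y`, with derivatives `y₁` and `y₂`, solves `y''' + a₁ y'' + a₂ y' + a₃ y = 0`. -/
structure SolvesODE {F : Type*} [NormedAddCommGroup F] [NormedSpace ℝ F] (a₁ a₂ a₃ : ℝ)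
    (y y₁ y₂ : ℝ → F) : Prop where
  deriv_zero : ∀ t, HasDerivAt y (y₁ t) t
  deriv_one : ∀ t, HasDerivAt y₁ (y₂ t) t
  deriv_two : ∀ t, HasDerivAt y₂ (-(a₁ • y₂ t + a₂ • y₁ t + a₃ • y t)) t

/-! ### Uniform exponential decay by a Lyapunov functional -/

theorem le_mul_exp_of_deriv_le {W W' : ℝ → ℝ} {c : ℝ} (h : ∀ t, HasDerivAt W (W' t) t)
    (hW : ∀ t, W' t ≤ -c * W t) {t : ℝ} (ht : 0 ≤ t) : W t ≤ W 0 * Real.exp (-c * t) := by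
  have hd : ∀ s, HasDerivAt (fun s => W s * Real.exp (c * s))
      (W' s * Real.exp (c * s) + W s * (Real.exp (c * s) * c)) s := fun s => by
    have := ((hasDerivAt_id s).const_mul c).exp
    simp only [id, mul_one] at this
    exact (h s).mul this
  have ha : Antitone (fun s => W s * Real.exp (c * s)) :=
    antitone_of_hasDerivAt_nonpos hd fun s => by
      have := Real.exp_pos (c * s)
      have := hW s
      change W' s * Real.exp (c * s) + W s * (Real.exp (c * s) * c) ≤ 0
      nlinarith
  have h0 := ha ht
  simp only [mul_zero, Real.exp_zero, mul_one] at h0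
  rw [neg_mul, Real.exp_neg, ← div_eq_mul_inv, le_div_iff₀ (Real.exp_pos _)]
  exact h0

theorem mul_le_sq_add_sq {k : ℝ} (hk : 0 < k) (x y : ℝ) : x * y ≤ k * x ^ 2 + y ^ 2 / (4 * k) := by
  have h : k * x ^ 2 + y ^ 2 / (4 * k) - x * y = k * (x - y / (2 * k)) ^ 2 := by
    field_simp; ring
  have : 0 ≤ k * (x - y / (2 * k)) ^ 2 := by positivity
  linarith

theorem mul_le_sq_div_eight_add (x y : ℝ) : x * y ≤ x ^ 2 / 8 + 2 * y ^ 2 := by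
  nlinarith [sq_nonneg (x - 4 * y)]

/-- The small parameters of the Lyapunov functional. -/
theorem exists_lyapunov_weights {α₁ β m₀ m₁ : ℝ} (hα : 0 < α₁) (hβ : 0 < β) (hm₀ : 0 < m₀)
    (hm₁ : 0 < m₁) : ∃ η₁ η₂ : ℝ, 0 < η₁ ∧ 0 < η₂ ∧ 16 * η₁ ≤ α₁ ∧ 8 * η₁ ≤ β ∧
      8 * η₂ ^ 2 ≤ η₁ * β ∧ 8 * η₁ * m₁ ^ 2 ≤ η₂ * α₁ * m₀ ∧ 8 * η₂ ≤ m₀ ∧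
      16 * η₁ ^ 2 ≤ β * α₁ ∧ 16 * η₂ ^ 2 ≤ β * m₀ := by
  -- The ratio `θ = η₁ / η₂` turns the sixth condition into an equality; the others then hold once
  -- `η₂ = η` is small.
  obtain ⟨θ, hθ⟩ : ∃ θ, θ = α₁ * m₀ / (8 * m₁ ^ 2) := ⟨_, rfl⟩
  have hθ0 : 0 < θ := by rw [hθ]; positivity
  obtain ⟨η, hη⟩ : ∃ η, η = min (min (θ * β / 8) (m₀ / 8)) (min (min (α₁ / (16 * θ)) (β / (8 * θ)))
    (β / 8)) := ⟨_, rfl⟩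
  have h0 : 0 < η := by rw [hη]; positivity
  have h1 : η ≤ θ * β / 8 := by rw [hη]; simp
  have h2 : η ≤ m₀ / 8 := by rw [hη]; simp
  have h3 : η ≤ α₁ / (16 * θ) := by rw [hη]; simp
  have h4 : η ≤ β / (8 * θ) := by rw [hη]; simp
  have h5 : η ≤ β / 8 := by rw [hη]; simp
  rw [le_div_iff₀ (by positivity)] at h3 h4
  refine ⟨θ * η, η, by positivity, h0, by linarith, by linarith, by nlinarith, ?_, by linarith, ?_,
    by nlinarith⟩
  · rw [hθ]; apply le_of_eq; field_simp
  · have h6 : 0 < θ * η := by positivity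
    nlinarith

section Lyapunov

variable {α₁ β m₀ m₁ η₁ η₂ : ℝ} (hα : 0 < α₁) (hβ : 0 < β) (hm₀ : 0 < m₀)
    (h1 : 0 < η₁) (h2 : 0 < η₂) (h3 : 16 * η₁ ≤ α₁) (h4 : 8 * η₁ ≤ β)
    (h5 : 8 * η₂ ^ 2 ≤ η₁ * β) (h6 : 8 * η₁ * m₁ ^ 2 ≤ η₂ * α₁ * m₀) (h7 : 8 * η₂ ≤ m₀)
    (h8 : 16 * η₁ ^ 2 ≤ β * α₁) (h9 : 16 * η₂ ^ 2 ≤ β * m₀)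
    {α A m : ℝ} (gα : α₁ ≤ α) (gA : β * α ≤ A) (g0 : m₀ ≤ m) (g1 : m ≤ m₁)

/-- The Lyapunov functional, `z = y' + m y`, `w = z'`, `p = y'`. -/
def lyapunov (η₁ η₂ α A m z w p : ℝ) : ℝ :=
  w ^ 2 / 2 + A * z ^ 2 / 2 + m * α * p ^ 2 / 2 + η₁ * (z * w) - η₂ * α * (p * z)

include hα hβ hm₀ h1 h2 h3 h4 h5 h6 h7 gα gA g0 g1 in
-- With `q = y''`, the left side is the derivative of `lyapunov` along a solution. The quadratic
-- energy alone loses only `α q²`; the cross terms `z w` and `-p z` are there to produce `-η₁ A z²`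
-- and `-η₂ α m p²`. Young's inequality charges the mixed products to these three squares and spends
-- at most half of each.
theorem lyapunov_dissipation (z p q : ℝ) :
    -(α * q ^ 2) + η₁ * ((q + m * p) ^ 2 - α * (q * z) - A * z ^ 2)
      - η₂ * α * (q * z + p * q + m * p ^ 2) ≤
    -(α * q ^ 2 / 4 + η₁ * A * z ^ 2 / 4 + η₂ * α * m₀ * p ^ 2 / 4) := by
  have ha : 0 < α := hα.trans_le gα
  have hm : m ^ 2 ≤ m₁ ^ 2 := by nlinarith
  have e1 : η₁ * (q + m * p) ^ 2 ≤ α * q ^ 2 / 8 + η₂ * α * m₀ * p ^ 2 / 4 := by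
    have : (q + m * p) ^ 2 ≤ 2 * q ^ 2 + 2 * m ^ 2 * p ^ 2 := by nlinarith [sq_nonneg (q - m * p)]
    have f1 : η₁ * q ^ 2 ≤ α / 16 * q ^ 2 :=
      mul_le_mul_of_nonneg_right (by linarith) (sq_nonneg q)
    have f2 : (η₁ * m ^ 2) * p ^ 2 ≤ (η₂ * α * m₀ / 8) * p ^ 2 := by
      refine mul_le_mul_of_nonneg_right ?_ (sq_nonneg p)
      have g : η₁ * m ^ 2 ≤ η₁ * m₁ ^ 2 := mul_le_mul_of_nonneg_left hm h1.le
      have g' : η₂ * m₀ * α₁ ≤ η₂ * m₀ * α := mul_le_mul_of_nonneg_left gα (by positivity)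
      nlinarith
    have f3 := mul_le_mul_of_nonneg_left this h1.le
    nlinarith
  have e2 : -(η₁ * (α * (q * z))) ≤ α * q ^ 2 / 8 + η₁ * A * z ^ 2 / 4 := by
    have f1 := mul_le_sq_div_eight_add q (-(η₁ * z))
    have f2 := mul_le_mul_of_nonneg_left f1 ha.le
    have f3 : (η₁ * η₁) * (8 * α) * z ^ 2 ≤ η₁ * A * z ^ 2 := by
      refine mul_le_mul_of_nonneg_right ?_ (sq_nonneg z)
      have : η₁ * (8 * α) ≤ A := by nlinarith
      nlinarith
    nlinarith
  have e3 : -(η₂ * α * (q * z)) ≤ α * q ^ 2 / 8 + η₁ * A * z ^ 2 / 4 := by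
    have f1 := mul_le_sq_div_eight_add q (-(η₂ * z))
    have f2 := mul_le_mul_of_nonneg_left f1 ha.le
    have f3 : (8 * η₂ ^ 2 * α) * z ^ 2 ≤ η₁ * A * z ^ 2 := by
      refine mul_le_mul_of_nonneg_right ?_ (sq_nonneg z)
      nlinarith
    nlinarith
  have e4 : -(η₂ * α * (p * q)) ≤ α * q ^ 2 / 8 + η₂ * α * m₀ * p ^ 2 / 4 := by
    have f1 := mul_le_sq_div_eight_add q (-(η₂ * p))
    have f2 := mul_le_mul_of_nonneg_left f1 ha.le
    have f3 : (η₂ * α * (8 * η₂)) * p ^ 2 ≤ (η₂ * α * m₀) * p ^ 2 :=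
      mul_le_mul_of_nonneg_right (mul_le_mul_of_nonneg_left h7 (by positivity)) (sq_nonneg p)
    nlinarith
  have e5 : η₂ * α * m₀ * p ^ 2 ≤ η₂ * α * (m * p ^ 2) := by
    have := mul_le_mul_of_nonneg_right g0 (sq_nonneg p)
    nlinarith [mul_pos h2 ha]
  have e6 : 0 ≤ α * q ^ 2 := by positivity
  have e7 : 0 ≤ η₁ * A * z ^ 2 := by
    have : 0 < A := lt_of_lt_of_le (by positivity) gA
    positivity
  nlinarith

include hα hβ hm₀ h8 h9 gα gA g0 in
theorem lyapunov_bounds (z w p : ℝ) :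
    w ^ 2 / 4 + A * z ^ 2 / 4 + m * α * p ^ 2 / 4 ≤ lyapunov η₁ η₂ α A m z w p ∧
    lyapunov η₁ η₂ α A m z w p ≤ w ^ 2 + A * z ^ 2 + m * α * p ^ 2 := by
  have ha : 0 < α := hα.trans_le gα
  have hm : 0 < m := hm₀.trans_le g0
  have hA : 0 < A := lt_of_lt_of_le (by positivity) gA
  have k1 : ∀ w, η₁ * (z * w) ≤ w ^ 2 / 4 + A * z ^ 2 / 16 := fun w => by
    have f1 := mul_le_sq_add_sq (k := 1 / 4) (by norm_num) w (η₁ * z)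
    have f2 : (16 * η₁ ^ 2) * z ^ 2 ≤ A * z ^ 2 :=
      mul_le_mul_of_nonneg_right (by nlinarith) (sq_nonneg z)
    nlinarith
  have k2 : ∀ p, η₂ * α * (p * z) ≤ m * α * p ^ 2 / 4 + A * z ^ 2 / 16 := fun p => by
    have f1 := mul_le_sq_add_sq (k := m / 4) (by positivity) p (η₂ * z)
    have f2 := mul_le_mul_of_nonneg_left f1 ha.le
    have f3 : α * ((η₂ * z) ^ 2 / (4 * (m / 4))) ≤ A * z ^ 2 / 16 := by
      rw [show α * ((η₂ * z) ^ 2 / (4 * (m / 4))) = (η₂ ^ 2 * α / m) * z ^ 2 by field_simp,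
        show A * z ^ 2 / 16 = (A / 16) * z ^ 2 by ring]
      refine mul_le_mul_of_nonneg_right ?_ (sq_nonneg z)
      rw [div_le_iff₀ hm]
      have : 16 * η₂ ^ 2 * α ≤ β * m₀ * α := mul_le_mul_of_nonneg_right h9 ha.le
      have : β * α * m₀ ≤ A * m := mul_le_mul gA g0 hm₀.le hA.le
      linarith
    nlinarith
  have e0 : 0 ≤ A * z ^ 2 := by positivity
  have a1 := k1 w
  have a2 := k1 (-w)
  have a3 := k2 p
  have a4 := k2 (-p)
  have b1 : 0 ≤ w ^ 2 := sq_nonneg w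
  have b2 : 0 ≤ m * α * p ^ 2 := by positivity
  unfold lyapunov
  constructor <;> nlinarith

end Lyapunov

/-- Here `m = a₃ / a₂` and `α = a₁ - a₃ / a₂`, so that positivity of `α`, `m`, `A` is the
Routh–Hurwitz criterion. With `z = y' + m y` the equation becomes `z'' + α y'' + A z = 0`, and the
energy `z'² / 2 + A z² / 2 + m α y'² / 2` has derivative `-α y''²`. The constants must not depend on
`α` and `A`, which are unbounded at high frequency; therefore `A` is bounded below by `β α` and the
functional is divided by `A`. -/
theorem exists_decay_of_routh_hurwitz {α₁ β m₀ m₁ : ℝ} (hα : 0 < α₁) (hβ : 0 < β) (hm₀ : 0 < m₀)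
    (hm₁ : 0 < m₁) : ∃ C c : ℝ, 0 < C ∧ 0 < c ∧ ∀ α A m : ℝ, α₁ ≤ α → β * α ≤ A → m₀ ≤ m → m ≤ m₁ →
      ∀ y y₁ y₂ : ℝ → ℝ, SolvesODE (α + m) A (m * A) y y₁ y₂ → ∀ t, 0 ≤ t →
        y t ^ 2 ≤ C * (y 0 ^ 2 + y₁ 0 ^ 2 + y₂ 0 ^ 2) * Real.exp (-c * t) := by
  obtain ⟨η₁, η₂, h1, h2, h3, h4, h5, h6, h7, h8, h9⟩ := exists_lyapunov_weights hα hβ hm₀ hm₁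
  -- `d` is a lower bound for the dissipation coefficients; `K` below bounds the functional by the
  -- quadratic form that is dissipated.
  obtain ⟨d, hd⟩ : ∃ d, d = min (1 / 4) (min (η₁ / 4) (η₂ * m₀ / 4)) := ⟨_, rfl⟩
  have hd0 : 0 < d := by rw [hd]; positivity
  have hd1 : d ≤ 1 / 4 := by rw [hd]; simp
  have hd2 : d ≤ η₁ / 4 := by rw [hd]; simp
  have hd3 : d ≤ η₂ * m₀ / 4 := by rw [hd]; simp
  obtain ⟨K, hK⟩ : ∃ K, K = 2 / α₁ + 1 + 2 * m₁ ^ 2 / α₁ + m₁ := ⟨_, rfl⟩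
  have hK0 : 0 < K := by rw [hK]; positivity
  -- With this choice `Λ d / K = 4 / m₀`, twice the term `2 / m₀ * (E / A)` that `z` contributes as
  -- a forcing in `y' = -m y + z`.
  obtain ⟨Λ, hΛ⟩ : ∃ Λ, Λ = 4 * K / (m₀ * d) := ⟨_, rfl⟩
  have hΛ0 : 0 < Λ := by rw [hΛ]; positivity
  obtain ⟨c, hc⟩ : ∃ c, c = min (d / (2 * K)) m₀ := ⟨_, rfl⟩
  have hc0 : 0 < c := by rw [hc]; positivity
  obtain ⟨C, hC⟩ : ∃ C, C = 2 * (Λ * (2 / (β * α₁) + 2 * m₁ ^ 2 / (β * α₁) + 2 + 2 * m₁ ^ 2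
    + m₁ / β) + 1) := ⟨_, rfl⟩
  have hC0 : 0 < C := by rw [hC]; positivity
  refine ⟨C, c, hC0, hc0, fun α A m gα gA g0 g1 y y₁ y₂ hy t ht => ?_⟩
  have ha : 0 < α := hα.trans_le gα
  have hm : 0 < m := hm₀.trans_le g0
  have hA : 0 < A := lt_of_lt_of_le (by positivity) gA
  have hmm : m ^ 2 ≤ m₁ ^ 2 := pow_le_pow_left₀ hm.le g1 2
  set z : ℝ → ℝ := fun t => y₁ t + m * y t with hz
  set w : ℝ → ℝ := fun t => y₂ t + m * y₁ t with hw
  set E : ℝ → ℝ := fun t => lyapunov η₁ η₂ α A m (z t) (w t) (y₁ t) with hE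
  have dz : ∀ t, HasDerivAt z (w t) t := fun t => (hy.deriv_one t).add ((hy.deriv_zero t).const_mul m)
  have dw : ∀ t, HasDerivAt w (-(α * y₂ t) - A * z t) t := fun t => by
    refine ((hy.deriv_two t).add ((hy.deriv_one t).const_mul m)).congr_deriv ?_
    simp only [smul_eq_mul, hz]; ring
  have dE : ∀ t, HasDerivAt E (-(α * y₂ t ^ 2) + η₁ * ((y₂ t + m * y₁ t) ^ 2 - α * (y₂ t * z t)
      - A * z t ^ 2) - η₂ * α * (y₂ t * z t + y₁ t * y₂ t + m * y₁ t ^ 2)) t := fun t => by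
    have := ((((((dw t).pow 2).div_const 2).add ((((dz t).pow 2).const_mul A).div_const 2)).add
      ((((hy.deriv_one t).pow 2).const_mul (m * α)).div_const 2)).add
      (((dz t).mul (dw t)).const_mul η₁)).sub
      (((hy.deriv_one t).mul (dz t)).const_mul (η₂ * α))
    refine this.congr_deriv ?_
    simp only [hw]
    ring
  have bE := fun t => lyapunov_bounds hα hβ hm₀ h8 h9 gα gA g0 (z t) (w t) (y₁ t)
  have dis := fun t => lyapunov_dissipation hα hβ hm₀ h1 h2 h3 h4 h5 h6 h7 gα gA g0 g1
    (z t) (y₁ t) (y₂ t)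
  have hEz : ∀ t, z t ^ 2 ≤ 4 * (E t / A) := fun t => by
    have := (bE t).1
    rw [← mul_div_assoc, le_div_iff₀ hA]
    have b1 : 0 ≤ w t ^ 2 := sq_nonneg _
    have b2 : 0 ≤ m * α * y₁ t ^ 2 := by positivity
    simp only [hE]
    linarith
  have hE0 : ∀ t, 0 ≤ E t / A := fun t => by linarith [hEz t, sq_nonneg (z t)]
  have hw2 : ∀ t, w t ^ 2 ≤ 2 * y₂ t ^ 2 + 2 * m₁ ^ 2 * y₁ t ^ 2 := fun t => by
    have f1 : w t ^ 2 ≤ 2 * y₂ t ^ 2 + 2 * m ^ 2 * y₁ t ^ 2 := by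
      simp only [hw]; linarith [sq_nonneg (y₂ t - m * y₁ t)]
    have f2 := mul_le_mul_of_nonneg_right hmm (sq_nonneg (y₁ t))
    linarith
  have hEK : ∀ t, E t ≤ K * (α * y₂ t ^ 2 + A * z t ^ 2 + α * y₁ t ^ 2) := fun t => by
    have f1 := (bE t).2
    have f2 := hw2 t
    have e1 : y₂ t ^ 2 ≤ (1 / α₁) * (α * y₂ t ^ 2) := by
      rw [one_div_mul_eq_div, le_div_iff₀ hα, mul_comm]
      exact mul_le_mul_of_nonneg_right gα (sq_nonneg _)
    have e2 : y₁ t ^ 2 ≤ (1 / α₁) * (α * y₁ t ^ 2) := by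
      rw [one_div_mul_eq_div, le_div_iff₀ hα, mul_comm]
      exact mul_le_mul_of_nonneg_right gα (sq_nonneg _)
    have e3 : m * α * y₁ t ^ 2 ≤ m₁ * (α * y₁ t ^ 2) := by
      rw [mul_assoc]; exact mul_le_mul_of_nonneg_right g1 (by positivity)
    have e4 := mul_le_mul_of_nonneg_left e2 (by positivity : 0 ≤ 2 * m₁ ^ 2)
    have p1 : 0 ≤ α * y₂ t ^ 2 := by positivity
    have p2 : 0 ≤ A * z t ^ 2 := by positivity
    have p3 : 0 ≤ α * y₁ t ^ 2 := by positivity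
    have k1 : 2 * (1 / α₁) ≤ K := by
      rw [hK, show 2 * (1 / α₁) = 2 / α₁ by ring]
      have : 0 ≤ 2 * m₁ ^ 2 / α₁ := by positivity
      linarith
    have k2 : 1 ≤ K := by
      rw [hK]
      have : 0 ≤ 2 * m₁ ^ 2 / α₁ := by positivity
      have : 0 ≤ 2 / α₁ := by positivity
      linarith
    have k3 : 2 * m₁ ^ 2 * (1 / α₁) + m₁ ≤ K := by
      rw [hK, show 2 * m₁ ^ 2 * (1 / α₁) = 2 * m₁ ^ 2 / α₁ by ring]
      have : 0 ≤ 2 / α₁ := by positivity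
      linarith
    have q1 := mul_le_mul_of_nonneg_right k1 p1
    have q2 := mul_le_mul_of_nonneg_right k2 p2
    have q3 := mul_le_mul_of_nonneg_right k3 p3
    simp only [hE]
    linarith
  -- `E` controls `z`, `z'` and `y'` but not `y`. As `y' = -m y + z` is damped, adding `y² / 2` to a
  -- large multiple of `E / A` closes the estimate.
  set W : ℝ → ℝ := fun t => Λ * (E t / A) + y t ^ 2 / 2 with hW
  have hdec : ∀ t, -(α * y₂ t ^ 2) + η₁ * ((y₂ t + m * y₁ t) ^ 2 - α * (y₂ t * z t)
      - A * z t ^ 2) - η₂ * α * (y₂ t * z t + y₁ t * y₂ t + m * y₁ t ^ 2) ≤ -(d / K) * E t :=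
      fun t => by
    refine (dis t).trans ?_
    have p1 : 0 ≤ α * y₂ t ^ 2 := by positivity
    have p2 : 0 ≤ A * z t ^ 2 := by positivity
    have p3 : 0 ≤ α * y₁ t ^ 2 := by positivity
    have q1 := mul_le_mul_of_nonneg_right hd1 p1
    have q2 := mul_le_mul_of_nonneg_right hd2 p2
    have q3 := mul_le_mul_of_nonneg_right hd3 p3
    have q4 := mul_le_mul_of_nonneg_left (hEK t) (by positivity : 0 ≤ d / K)
    rw [show d / K * (K * (α * y₂ t ^ 2 + A * z t ^ 2 + α * y₁ t ^ 2)) =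
      d * (α * y₂ t ^ 2 + A * z t ^ 2 + α * y₁ t ^ 2) by field_simp] at q4
    linarith
  have dW := fun t => (((dE t).div_const A).const_mul Λ).add
    (((hy.deriv_zero t).pow 2).div_const 2)
  have hfin := le_mul_exp_of_deriv_le (W := W) (c := c) dW (fun t => ?_) ht
  · have f1 : y t ^ 2 / 2 ≤ W t := by
      simp only [hW]; linarith [mul_nonneg hΛ0.le (hE0 t)]
    have f2 : 2 * W 0 ≤ C * (y 0 ^ 2 + y₁ 0 ^ 2 + y₂ 0 ^ 2) := by
      have hz0 : z 0 ^ 2 ≤ 2 * y₁ 0 ^ 2 + 2 * m₁ ^ 2 * y 0 ^ 2 := by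
        have f1 : z 0 ^ 2 ≤ 2 * y₁ 0 ^ 2 + 2 * m ^ 2 * y 0 ^ 2 := by
          simp only [hz]; linarith [sq_nonneg (y₁ 0 - m * y 0)]
        have f2 := mul_le_mul_of_nonneg_right hmm (sq_nonneg (y 0))
        linarith
      have hβα : β * α₁ ≤ A := (mul_le_mul_of_nonneg_left gα hβ.le).trans gA
      have f3 : E 0 / A ≤ w 0 ^ 2 / (β * α₁) + z 0 ^ 2 + m₁ / β * y₁ 0 ^ 2 := by
        rw [div_le_iff₀ hA]
        refine (bE 0).2.trans ?_
        have g2 : w 0 ^ 2 ≤ w 0 ^ 2 / (β * α₁) * A := by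
          rw [div_mul_eq_mul_div, le_div_iff₀ (by positivity)]
          exact mul_le_mul_of_nonneg_left hβα (sq_nonneg _)
        have g3 : m * α * y₁ 0 ^ 2 ≤ m₁ / β * y₁ 0 ^ 2 * A := by
          rw [show m₁ / β * y₁ 0 ^ 2 * A = m₁ * (A / β) * y₁ 0 ^ 2 by ring]
          refine mul_le_mul_of_nonneg_right ?_ (sq_nonneg _)
          refine mul_le_mul g1 ?_ ha.le hm₁.le
          rw [le_div_iff₀ hβ]; linarith
        linarith
      have f4 : w 0 ^ 2 / (β * α₁) ≤ 2 / (β * α₁) * y₂ 0 ^ 2 + 2 * m₁ ^ 2 / (β * α₁) * y₁ 0 ^ 2 := by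
        have := div_le_div_of_nonneg_right (hw2 0) (by positivity : 0 ≤ β * α₁)
        refine this.trans (le_of_eq (by ring))
      have p1 : 0 ≤ y 0 ^ 2 := sq_nonneg _
      have p2 : 0 ≤ y₁ 0 ^ 2 := sq_nonneg _
      have p3 : 0 ≤ y₂ 0 ^ 2 := sq_nonneg _
      set Q := 2 / (β * α₁) + 2 * m₁ ^ 2 / (β * α₁) + 2 + 2 * m₁ ^ 2 + m₁ / β with hQ
      have r1 : 0 ≤ 2 / (β * α₁) := by positivity
      have r2 : 0 ≤ 2 * m₁ ^ 2 / (β * α₁) := by positivity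
      have r3 : 0 ≤ 2 * m₁ ^ 2 := by positivity
      have r4 : 0 ≤ m₁ / β := by positivity
      have f5 : E 0 / A ≤ Q * (y 0 ^ 2 + y₁ 0 ^ 2 + y₂ 0 ^ 2) := by
        have t1 := mul_le_mul_of_nonneg_right (show 2 * m₁ ^ 2 ≤ Q by rw [hQ]; linarith) p1
        have t2 := mul_le_mul_of_nonneg_right
          (show 2 * m₁ ^ 2 / (β * α₁) + 2 + m₁ / β ≤ Q by rw [hQ]; linarith) p2
        have t3 := mul_le_mul_of_nonneg_right (show 2 / (β * α₁) ≤ Q by rw [hQ]; linarith) p3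
        linarith
      have f6 := mul_le_mul_of_nonneg_left f5 hΛ0.le
      simp only [hW]
      rw [hC]
      linarith
    have f3 := Real.exp_pos (-c * t)
    have f4 := mul_le_mul_of_nonneg_right f2 f3.le
    linarith
  · have f1 := hdec t
    have f2 := hEz t
    have f3 := mul_le_sq_add_sq (k := m₀ / 2) (by positivity) (y t) (z t)
    have f4 : z t ^ 2 / (4 * (m₀ / 2)) ≤ 2 / m₀ * (E t / A) := by
      rw [div_le_iff₀ (by positivity)]
      calc z t ^ 2 ≤ 4 * (E t / A) := f2
        _ = _ := by field_simp
    have f5 : Λ * (d / K) = 4 / m₀ := by rw [hΛ]; field_simp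
    have hc1 : c * Λ ≤ 2 / m₀ := by
      have : c ≤ d / (2 * K) := by rw [hc]; simp
      calc c * Λ ≤ d / (2 * K) * Λ := mul_le_mul_of_nonneg_right this hΛ0.le
        _ = 2 / m₀ := by rw [hΛ]; field_simp; norm_num
    have hc2 : c ≤ m₀ := by rw [hc]; simp
    have f6 := mul_le_mul_of_nonneg_right hc1 (hE0 t)
    have f7 := mul_le_mul_of_nonneg_right hc2 (sq_nonneg (y t))
    have f8 := mul_le_mul_of_nonneg_left (div_le_div_of_nonneg_right f1 hA.le) hΛ0.le
    have f9 : Λ * (-(d / K) * E t / A) = -(4 / m₀ * (E t / A)) := by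
      rw [← f5]; ring
    rw [f9] at f8
    have f10 : y₁ t = z t - m * y t := by simp [hz]
    have f11 := mul_le_mul_of_nonneg_right g0 (sq_nonneg (y t))
    have f12 : y t * y₁ t ≤ m₀ / 2 * y t ^ 2 + 2 / m₀ * (E t / A) - m₀ * y t ^ 2 := by
      rw [f10]; linarith
    have f13 : 4 / m₀ * (E t / A) = 2 * (2 / m₀ * (E t / A)) := by ring
    simp only [hW, Nat.cast_ofNat, Nat.add_one_sub_one, pow_one]
    rw [show 2 * y t * y₁ t / 2 = y t * y₁ t by ring]
    linarith

/-! ### Explicit solutions and the characteristic roots at low frequency -/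

theorem eq_of_hasDerivAt_zero {F : Type*} [NormedAddCommGroup F] [NormedSpace ℝ F] {f : ℝ → F}
    (h : ∀ t, HasDerivAt f 0 t) (t : ℝ) : f t = f 0 :=
  is_const_of_deriv_eq_zero (fun t => (h t).differentiableAt) (fun t => (h t).deriv) t 0

theorem hasDerivAt_exp_mul_real (k t : ℝ) :
    HasDerivAt (fun t => Real.exp (k * t)) (Real.exp (k * t) * k) t := by
  have := ((hasDerivAt_id t).const_mul k).exp
  simpa only [id, mul_one] using this

theorem eq_mul_exp_of_hasDerivAt {f : ℝ → ℝ} {k : ℝ} (h : ∀ t, HasDerivAt f (k * f t) t) (t : ℝ) :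
    f t = f 0 * Real.exp (k * t) := by
  have h1 : ∀ t, HasDerivAt (fun t => f t * Real.exp (-k * t)) 0 t := fun t =>
    ((h t).mul (hasDerivAt_exp_mul_real (-k) t)).congr_deriv (by ring)
  have h2 := eq_of_hasDerivAt_zero h1 t
  simp only [mul_zero, Real.exp_zero, mul_one] at h2
  rw [← h2, mul_assoc, ← Real.exp_add]
  simp

theorem eq_cos_sin_of_hasDerivAt {g g' : ℝ → ℝ} {ω : ℝ} (hω : ω ≠ 0)
    (h : ∀ t, HasDerivAt g (g' t) t) (h' : ∀ t, HasDerivAt g' (-ω ^ 2 * g t) t) (t : ℝ) :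
    g t = g 0 * Real.cos (ω * t) + g' 0 * (Real.sin (ω * t) / ω) := by
  have hs : ∀ t, HasDerivAt (fun t => Real.sin (ω * t)) (Real.cos (ω * t) * ω) t := fun t => by
    simpa using ((hasDerivAt_id t).const_mul ω).sin
  have hc : ∀ t, HasDerivAt (fun t => Real.cos (ω * t)) (-Real.sin (ω * t) * ω) t := fun t => by
    simpa using ((hasDerivAt_id t).const_mul ω).cos
  have h1 : ∀ t, HasDerivAt (fun t => g t * Real.cos (ω * t) - g' t / ω * Real.sin (ω * t)) 0 t :=
    fun t => (((h t).mul (hc t)).sub (((h' t).div_const ω).mul (hs t))).congr_deriv (by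
      field_simp; ring)
  have h2 : ∀ t, HasDerivAt (fun t => g t * Real.sin (ω * t) + g' t / ω * Real.cos (ω * t)) 0 t :=
    fun t => (((h t).mul (hs t)).add (((h' t).div_const ω).mul (hc t))).congr_deriv (by
      field_simp; ring)
  have e1 := eq_of_hasDerivAt_zero h1 t
  have e2 := eq_of_hasDerivAt_zero h2 t
  simp only [mul_zero, Real.cos_zero, Real.sin_zero, mul_one, sub_zero, zero_add] at e1 e2
  rw [← e1, show g' 0 * (Real.sin (ω * t) / ω) = g' 0 / ω * Real.sin (ω * t) by ring, ← e2]
  linear_combination (-g t) * Real.sin_sq_add_cos_sq (ω * t)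

/-- The solution of a third order equation whose characteristic polynomial is
`(λ + σ) ((λ + p / 2) ^ 2 + ω ^ 2)`. -/
theorem SolvesODE.eq_exp_add_cos_add_sin {σ p ω a₁ a₂ a₃ N : ℝ} (hω : ω ≠ 0)
    (h1 : a₁ = σ + p) (h2 : a₂ = σ * p + (ω ^ 2 + p ^ 2 / 4)) (h3 : a₃ = σ * (ω ^ 2 + p ^ 2 / 4))
    (hN : N = σ ^ 2 - p * σ + (ω ^ 2 + p ^ 2 / 4)) (hN0 : N ≠ 0) {y y₁ y₂ : ℝ → ℝ}
    (hy : SolvesODE a₁ a₂ a₃ y y₁ y₂) {A B D : ℝ}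
    (hA : A = (y₂ 0 + p * y₁ 0 + (ω ^ 2 + p ^ 2 / 4) * y 0) / N) (hB : B = y 0 - A)
    (hD : D = y₁ 0 + σ * A + p * B / 2) (t : ℝ) :
    y t = A * Real.exp (-σ * t) + B * (Real.exp (-(p / 2) * t) * Real.cos (ω * t))
      + D / ω * (Real.exp (-(p / 2) * t) * Real.sin (ω * t)) := by
  set q := ω ^ 2 + p ^ 2 / 4 with hq
  -- The quadratic factor of the characteristic polynomial, applied to `y`, leaves a first order
  -- equation. Its solution is `A N exp(-σt)`, where `N` is the quadratic factor evaluated at `-σ`.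
  have hf : ∀ t, HasDerivAt (fun t => y₂ t + p * y₁ t + q * y t)
      (-σ * (y₂ t + p * y₁ t + q * y t)) t := fun t => by
    refine (((hy.deriv_two t).add ((hy.deriv_one t).const_mul p)).add
      ((hy.deriv_zero t).const_mul q)).congr_deriv ?_
    simp only [smul_eq_mul, h1, h2, h3]; ring
  have ef := eq_mul_exp_of_hasDerivAt hf
  have hNA : y₂ 0 + p * y₁ 0 + q * y 0 = A * N := by rw [hA]; field_simp
  simp only [hNA] at ef
  have hE := hasDerivAt_exp_mul_real (-σ)
  have hP := hasDerivAt_exp_mul_real (p / 2)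
  have dv : ∀ t, HasDerivAt (fun t => y t - A * Real.exp (-σ * t))
      (y₁ t + σ * A * Real.exp (-σ * t)) t := fun t =>
    ((hy.deriv_zero t).sub ((hE t).const_mul A)).congr_deriv (by ring)
  have dv' : ∀ t, HasDerivAt (fun t => y₁ t + σ * A * Real.exp (-σ * t))
      (y₂ t - σ ^ 2 * A * Real.exp (-σ * t)) t := fun t =>
    ((hy.deriv_one t).add ((hE t).const_mul (σ * A))).congr_deriv (by ring)
  -- Removing the real mode and the damping `exp(-pt/2)` leaves a harmonic oscillator of frequency
  -- `ω`.
  have hg := eq_cos_sin_of_hasDerivAt (g := fun t => (y t - A * Real.exp (-σ * t)) *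
      Real.exp (p / 2 * t)) (g' := fun t => (y₁ t + σ * A * Real.exp (-σ * t)) *
      Real.exp (p / 2 * t) + p / 2 * ((y t - A * Real.exp (-σ * t)) * Real.exp (p / 2 * t))) hω
    (fun t => ((dv t).mul (hP t)).congr_deriv (by ring))
    (fun t => (((dv' t).mul (hP t)).add (((dv t).mul (hP t)).const_mul (p / 2))).congr_deriv (by
      have := ef t
      have e : y₂ t = A * N * Real.exp (-σ * t) - p * y₁ t - q * y t := by linarith
      rw [e, hN, hq]; ring)) t
  simp only [mul_zero, Real.exp_zero, mul_one] at hg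
  have hexp : Real.exp (p / 2 * t) * Real.exp (-(p / 2) * t) = 1 := by
    rw [← Real.exp_add]; simp
  have : y t - A * Real.exp (-σ * t) = Real.exp (-(p / 2) * t) *
      (B * Real.cos (ω * t) + D * (Real.sin (ω * t) / ω)) := by
    have e1 : (y 0 - A) * Real.cos (ω * t) + (y₁ 0 + σ * A + p / 2 * (y 0 - A)) *
      (Real.sin (ω * t) / ω) = B * Real.cos (ω * t) + D * (Real.sin (ω * t) / ω) := by
      rw [hD, hB]; ring
    rw [← e1, ← hg]
    linear_combination (-(y t - A * Real.exp (-σ * t))) * hexp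
  linear_combination this

/-- The characteristic roots `-σ`, `-p / 2 ± i ω` for low frequencies. -/
structure LowRoots (a e δ κ K r σ p ω : ℝ) : Prop where
  sum_eq : a * r ^ 2 = σ + p
  pair_eq : r ^ 2 + e * r ^ 4 = σ * p + (ω ^ 2 + p ^ 2 / 4)
  prod_eq : κ * r ^ 4 = σ * (ω ^ 2 + p ^ 2 / 4)
  σ_le : |σ - κ * r ^ 2| ≤ K * r ^ 4
  p_le : |p - δ * r ^ 2| ≤ K * r ^ 4
  ω_le : |ω - r| ≤ K * r ^ 3

/-- Inserting `λ = -r² τ` into the characteristic polynomial and dividing by `r⁴` gives this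
equation with `s = r²`. It is a small perturbation of `κ - τ = 0`, so the intermediate value theorem
locates a root near `κ`. -/
theorem exists_scaled_root {a e κ : ℝ} (ha : 0 < a) (he : 0 < e) (hκ : 0 < κ) :
    ∃ M : ℝ, 0 < M ∧ ∀ s, 0 ≤ s → M * s ≤ κ / 2 → ∃ τ, κ / 2 ≤ τ ∧ τ ≤ 2 * κ ∧
      κ - τ + s * (-τ ^ 3 + a * τ ^ 2 - e * τ) = 0 ∧ |τ - κ| ≤ M * s := by
  obtain ⟨M, hM⟩ : ∃ M, M = (2 * κ) ^ 3 + a * (2 * κ) ^ 2 + e * (2 * κ) := ⟨_, rfl⟩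
  refine ⟨M, by rw [hM]; positivity, fun s hs hsM => ?_⟩
  have hb : ∀ τ, κ / 2 ≤ τ → τ ≤ 2 * κ → |-τ ^ 3 + a * τ ^ 2 - e * τ| ≤ M := fun τ h1 h2 => by
    have h0 : 0 ≤ τ := by linarith
    have k1 := pow_le_pow_left₀ h0 h2 3
    have k2 := mul_le_mul_of_nonneg_left (pow_le_pow_left₀ h0 h2 2) ha.le
    have k3 := mul_le_mul_of_nonneg_left h2 he.le
    have l1 : 0 ≤ τ ^ 3 := by positivity
    have l2 : 0 ≤ a * τ ^ 2 := by positivity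
    have l3 : 0 ≤ e * τ := by positivity
    rw [abs_le, hM]
    constructor <;> linarith
  have hb' : ∀ τ, κ / 2 ≤ τ → τ ≤ 2 * κ → |s * (-τ ^ 3 + a * τ ^ 2 - e * τ)| ≤ M * s :=
    fun τ h1 h2 => by
      rw [abs_mul, abs_of_nonneg hs, mul_comm]
      exact mul_le_mul_of_nonneg_right (hb τ h1 h2) hs
  have hcont : ContinuousOn (fun τ : ℝ => κ - τ + s * (-τ ^ 3 + a * τ ^ 2 - e * τ))
    (Icc (κ / 2) (2 * κ)) := by fun_prop
  have i1 := abs_le.1 (hb' (κ / 2) le_rfl (by linarith))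
  have i2 := abs_le.1 (hb' (2 * κ) (by linarith) le_rfl)
  obtain ⟨τ, hτ, h0⟩ := intermediate_value_Icc' (by linarith) hcont
    (show (0 : ℝ) ∈ _ from ⟨by linarith [i2.2], by linarith [i1.1]⟩)
  refine ⟨τ, hτ.1, hτ.2, h0, ?_⟩
  have : τ - κ = s * (-τ ^ 3 + a * τ ^ 2 - e * τ) := by linarith
  rw [this]
  exact hb' τ hτ.1 hτ.2

/-- The real root is `-σ = -r² τ`. Vieta's formulas then give `p = a r² - σ` and `ω² + p² / 4 = κ r⁴
/ σ`, and all expansions follow from `|τ - κ| ≤ M r²` and `a = δ + κ`. -/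
theorem exists_lowRoots {a e δ κ : ℝ} (ha : a = δ + κ) (he : 0 < e) (hδ : 0 < δ) (hκ : 0 < κ) :
    ∃ K r₁ : ℝ, 0 < K ∧ 0 < r₁ ∧ ∀ r, 0 < r → r ≤ r₁ → ∃ σ p ω, LowRoots a e δ κ K r σ p ω := by
  have ha0 : 0 < a := by linarith
  obtain ⟨M, hM, h⟩ := exists_scaled_root ha0 he hκ
  obtain ⟨K, hK⟩ : ∃ K, K = M + 2 * M / κ + a ^ 2 := ⟨_, rfl⟩
  have hK0 : 0 < K := by rw [hK]; positivity
  -- The three thresholds on `r²` guarantee the root `τ`, `p ≥ 0`, and a nonnegative value for `ω²`.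
  obtain ⟨s₁, hs₁⟩ : ∃ s₁, s₁ = min (min (κ / (2 * M)) (δ / M)) (1 / K) := ⟨_, rfl⟩
  have hs0 : 0 < s₁ := by rw [hs₁]; positivity
  refine ⟨K, √s₁, hK0, Real.sqrt_pos.2 hs0, fun r hr hr1 => ?_⟩
  have hs : r ^ 2 ≤ s₁ := by
    have := pow_le_pow_left₀ hr.le hr1 2
    rwa [Real.sq_sqrt hs0.le] at this
  have k1 : M * r ^ 2 ≤ κ / 2 := by
    have : r ^ 2 ≤ κ / (2 * M) := hs.trans (by rw [hs₁]; simp)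
    rw [le_div_iff₀ (by positivity)] at this; linarith
  have k2 : M * r ^ 2 ≤ δ := by
    have : r ^ 2 ≤ δ / M := hs.trans (by rw [hs₁]; simp)
    rw [le_div_iff₀ (by positivity)] at this; linarith
  have k3 : K * r ^ 2 ≤ 1 := by
    have : r ^ 2 ≤ 1 / K := hs.trans (by rw [hs₁]; simp)
    rw [le_div_iff₀ (by positivity)] at this; linarith
  obtain ⟨τ, t1, t2, t3, t4⟩ := h (r ^ 2) (by positivity) k1
  have hτ : 0 < τ := by linarith
  have t5 := abs_le.1 t4
  set p := r ^ 2 * (a - τ) with hp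
  have hp0 : 0 ≤ a - τ := by linarith
  have hp1 : p ^ 2 ≤ a ^ 2 * r ^ 4 := by
    have : (a - τ) ^ 2 ≤ a ^ 2 := pow_le_pow_left₀ hp0 (by linarith) 2
    rw [hp, show (r ^ 2 * (a - τ)) ^ 2 = (a - τ) ^ 2 * r ^ 4 by ring]
    exact mul_le_mul_of_nonneg_right this (by positivity)
  have hq : |r ^ 2 * κ / τ - r ^ 2| ≤ 2 * M / κ * r ^ 4 := by
    rw [show r ^ 2 * κ / τ - r ^ 2 = r ^ 2 * (κ - τ) / τ by field_simp, abs_div, abs_mul,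
      abs_of_pos hτ, abs_of_pos (by positivity : 0 < r ^ 2), div_le_iff₀ hτ, abs_sub_comm]
    have e1 := mul_le_mul_of_nonneg_left t4 (by positivity : 0 ≤ r ^ 2)
    refine e1.trans ?_
    rw [show 2 * M / κ * r ^ 4 * τ = r ^ 2 * (M * r ^ 2) * (2 * τ / κ) by field_simp]
    refine le_mul_of_one_le_right (by positivity) ?_
    rw [le_div_iff₀ hκ]; linarith
  have hq' := abs_le.1 hq
  have hω2 : |(r ^ 2 * κ / τ - p ^ 2 / 4) - r ^ 2| ≤ K * r ^ 4 := by
    rw [abs_le, hK]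
    have : 0 ≤ M * r ^ 4 := by positivity
    have : 0 ≤ a ^ 2 * r ^ 4 := by positivity
    constructor <;> nlinarith [sq_nonneg p]
  have hω0 : 0 ≤ r ^ 2 * κ / τ - p ^ 2 / 4 := by
    have := (abs_le.1 hω2).1
    have e1 := mul_le_mul_of_nonneg_left k3 (by positivity : 0 ≤ r ^ 2)
    nlinarith
  set ω := √(r ^ 2 * κ / τ - p ^ 2 / 4) with hω
  have hωsq : ω ^ 2 = r ^ 2 * κ / τ - p ^ 2 / 4 := Real.sq_sqrt hω0
  have hωpos : 0 ≤ ω := Real.sqrt_nonneg _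
  refine ⟨r ^ 2 * τ, p, ω, ⟨by rw [hp]; ring, ?_, ?_, ?_, ?_, ?_⟩⟩
  · rw [hωsq, hp]
    have : κ / τ = 1 - r ^ 2 * (-τ ^ 2 + a * τ - e) := by
      rw [div_eq_iff hτ.ne']; linarith
    rw [mul_div_assoc, this]; ring
  · rw [hωsq]; field_simp; ring
  · rw [show r ^ 2 * τ - κ * r ^ 2 = r ^ 2 * (τ - κ) by ring, abs_mul,
      abs_of_pos (by positivity : 0 < r ^ 2)]
    have e1 := mul_le_mul_of_nonneg_left t4 (by positivity : 0 ≤ r ^ 2)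
    have e2 : 0 ≤ (2 * M / κ + a ^ 2) * r ^ 4 := by positivity
    rw [hK]; linarith
  · rw [hp, ha, show r ^ 2 * (δ + κ - τ) - δ * r ^ 2 = -(r ^ 2 * (τ - κ)) by ring, abs_neg, abs_mul,
      abs_of_pos (by positivity : 0 < r ^ 2)]
    have e1 := mul_le_mul_of_nonneg_left t4 (by positivity : 0 ≤ r ^ 2)
    have e2 : 0 ≤ (2 * M / κ + a ^ 2) * r ^ 4 := by positivity
    rw [hK]; linarith
  · rw [← hωsq] at hω2
    rw [show ω ^ 2 - r ^ 2 = (ω - r) * (ω + r) by ring, abs_mul,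
      abs_of_pos (by positivity : 0 < ω + r)] at hω2
    have e1 : |ω - r| * r ≤ |ω - r| * (ω + r) :=
      mul_le_mul_of_nonneg_left (by linarith) (abs_nonneg _)
    have e2 : |ω - r| * r ≤ (K * r ^ 3) * r := by linarith
    exact le_of_mul_le_mul_right e2 hr

/-! ### Comparison with the symbols at low frequency -/

theorem abs_exp_neg_sub_exp_neg_le {x y m : ℝ} (hx : m ≤ x) (hy : m ≤ y) :
    |Real.exp (-x) - Real.exp (-y)| ≤ |x - y| * Real.exp (-m) := by
  wlog h : x ≤ y generalizing x y
  · rw [abs_sub_comm, abs_sub_comm x]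
    exact this hy hx (le_of_not_ge h)
  have h1 : Real.exp (-y) ≤ Real.exp (-x) := Real.exp_le_exp.2 (by linarith)
  rw [abs_of_nonneg (by linarith), abs_of_nonpos (by linarith : x - y ≤ 0)]
  have h2 := Real.add_one_le_exp (-(y - x))
  have h3 : Real.exp (-y) = Real.exp (-x) * Real.exp (-(y - x)) := by
    rw [← Real.exp_add]; congr 1; ring
  have h4 : Real.exp (-x) ≤ Real.exp (-m) := Real.exp_le_exp.2 (by linarith)
  have h5 := Real.exp_pos (-x)
  rw [h3]
  calc Real.exp (-x) - Real.exp (-x) * Real.exp (-(y - x))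
      = Real.exp (-x) * (1 - Real.exp (-(y - x))) := by ring
    _ ≤ Real.exp (-x) * (y - x) := mul_le_mul_of_nonneg_left (by linarith) h5.le
    _ ≤ Real.exp (-m) * (y - x) := mul_le_mul_of_nonneg_right h4 (by linarith)
    _ = _ := by ring

/-- Used with `X = r² t`: half of the Gaussian decay pays for the linear growth in time of the
errors in the exponents. -/
theorem mul_exp_neg_two_mul_le {c : ℝ} (hc : 0 < c) (X : ℝ) :
    X * Real.exp (-(2 * c * X)) ≤ 1 / c * Real.exp (-(c * X)) := by
  have h1 := Real.add_one_le_exp (c * X)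
  have h2 : Real.exp (-(2 * c * X)) = Real.exp (-(c * X)) * Real.exp (-(c * X)) := by
    rw [← Real.exp_add]; congr 1; ring
  have h3 : Real.exp (c * X) * Real.exp (-(c * X)) = 1 := by rw [← Real.exp_add]; simp
  have h4 := Real.exp_pos (-(c * X))
  rw [h2, ← mul_assoc]
  refine mul_le_mul_of_nonneg_right ?_ h4.le
  rw [le_div_iff₀ hc]
  have := mul_le_mul_of_nonneg_right h1 h4.le
  rw [h3] at this
  linarith

theorem abs_exp_sub_exp_le {x y X L c r : ℝ} (hc : 0 < c) (hL : 0 ≤ L) (hx : 2 * c * X ≤ x)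
    (hy : 2 * c * X ≤ y) (h : |x - y| ≤ L * r ^ 2 * X) :
    |Real.exp (-x) - Real.exp (-y)| ≤ L / c * r ^ 2 * Real.exp (-(c * X)) := by
  refine (abs_exp_neg_sub_exp_neg_le hx hy).trans ?_
  calc _ ≤ L * r ^ 2 * X * Real.exp (-(2 * c * X)) :=
        mul_le_mul_of_nonneg_right h (Real.exp_pos _).le
    _ = L * r ^ 2 * (X * Real.exp (-(2 * c * X))) := by ring
    _ ≤ L * r ^ 2 * (1 / c * Real.exp (-(c * X))) :=
        mul_le_mul_of_nonneg_left (mul_exp_neg_two_mul_le hc X) (by positivity)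
    _ = _ := by ring

/-- `f` is `cos` or `sin`. The phase error `(ω - r) t = O(r³ t) = O(r X)` is weaker than the damping
error `O(r² X)`, so the oscillating modes gain one power of `r` only. -/
theorem abs_exp_mul_sub_exp_mul_le {x y X L c r : ℝ} (hc : 0 < c) (hL : 0 ≤ L)
    (hx : 2 * c * X ≤ x) (hy : 2 * c * X ≤ y) (h : |x - y| ≤ L * r ^ 2 * X) (hr : 0 < r)
    (hr1 : r ≤ 1) {f : ℝ → ℝ} (hf : ∀ u, |f u| ≤ 1) (hf' : ∀ u v, |f u - f v| ≤ |u - v|) {u v : ℝ}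
    (huv : |u - v| ≤ L * r * X) :
    |Real.exp (-x) * f u - Real.exp (-y) * f v| ≤ 2 * L / c * r * Real.exp (-(c * X)) := by
  have e1 := abs_exp_sub_exp_le hc hL hx hy h
  have hG := Real.exp_pos (-(c * X))
  have e2 : |Real.exp (-x) * (f u - f v)| ≤ L / c * r * Real.exp (-(c * X)) := by
    rw [abs_mul, abs_of_pos (Real.exp_pos _)]
    calc Real.exp (-x) * |f u - f v| ≤ Real.exp (-(2 * c * X)) * (L * r * X) :=
          mul_le_mul (Real.exp_le_exp.2 (by linarith)) ((hf' u v).trans huv) (abs_nonneg _)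
            (Real.exp_pos _).le
      _ = L * r * (X * Real.exp (-(2 * c * X))) := by ring
      _ ≤ L * r * (1 / c * Real.exp (-(c * X))) :=
          mul_le_mul_of_nonneg_left (mul_exp_neg_two_mul_le hc X) (by positivity)
      _ = _ := by ring
  have e3 : |(Real.exp (-x) - Real.exp (-y)) * f v| ≤ L / c * r * Real.exp (-(c * X)) := by
    rw [abs_mul]
    calc _ ≤ L / c * r ^ 2 * Real.exp (-(c * X)) * 1 :=
          mul_le_mul e1 (hf v) (abs_nonneg _) (by positivity)
      _ = L / c * (r * r) * Real.exp (-(c * X)) := by ring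
      _ ≤ L / c * (r * 1) * Real.exp (-(c * X)) := by gcongr
      _ = _ := by ring
  calc _ = |Real.exp (-x) * (f u - f v) + (Real.exp (-x) - Real.exp (-y)) * f v| := by
        congr 1; ring
    _ ≤ _ := abs_add_le _ _
    _ ≤ _ := add_le_add e2 e3
    _ = _ := by ring

theorem abs_mul_sub_mul_le {X Y x y P Q R S : ℝ} (h1 : |X - Y| ≤ P) (h2 : |x| ≤ Q) (h3 : |Y| ≤ R)
    (h4 : |x - y| ≤ S) : |X * x - Y * y| ≤ P * Q + R * S := by
  calc |X * x - Y * y| = |(X - Y) * x + Y * (x - y)| := by congr 1; ring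
    _ ≤ |(X - Y) * x| + |Y * (x - y)| := abs_add_le _ _
    _ = |X - Y| * |x| + |Y| * |x - y| := by rw [abs_mul, abs_mul]
    _ ≤ _ := add_le_add (mul_le_mul h1 h2 (abs_nonneg _) ((abs_nonneg _).trans h1))
        (mul_le_mul h3 h4 (abs_nonneg _) ((abs_nonneg _).trans h3))

set_option maxHeartbeats 1000000 in
/-- The coefficients of the three modes at low frequency. -/
theorem LowRoots.abs_coeff_le {a e δ κ K r σ p ω L : ℝ} (h : LowRoots a e δ κ K r σ p ω)
    (he : 0 < e) (hδ : 0 < δ) (hκ : 0 < κ) (hL : L = K + 4 * κ ^ 2 + 8 * δ * κ + e)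
    (hr : 0 < r) (hr1 : r ≤ 1) (hK : 0 < K) (k1 : L * r ^ 2 ≤ 1 / 2)
    (k2 : K * r ^ 2 ≤ κ / 2) (k3 : K * r ^ 2 ≤ δ / 2) {N y₀ y₁ y₂ A B D F CA : ℝ}
    (hN : N = σ ^ 2 - p * σ + (ω ^ 2 + p ^ 2 / 4))
    (hA : A = (y₂ + p * y₁ + (ω ^ 2 + p ^ 2 / 4) * y₀) / N) (hB : B = y₀ - A)
    (hD : D = y₁ + σ * A + p * B / 2) (hF : F = r * |y₀| + |y₁| + |y₂| / r)
    (hCA : CA = 4 * δ + 2 * L) :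
    0 < N ∧ 0 < ω ∧ κ / 2 * r ^ 2 ≤ σ ∧ δ / 2 * r ^ 2 ≤ p ∧
    |A - (y₀ + y₂ / r ^ 2)| ≤ CA * F ∧ |B - -(y₂ / r ^ 2)| ≤ CA * F ∧
    |D / ω - y₁ / r| ≤ (2 * L + 2 * (2 * κ + δ) * (1 + CA)) * F := by
  have hL0 : 0 < L := by rw [hL]; positivity
  have hKL : K ≤ L := by rw [hL]; have : 0 < 4 * κ ^ 2 + 8 * δ * κ + e := by positivity
                         linarith
  have hCA0 : 0 < CA := by rw [hCA]; positivity
  have hr2 : 0 < r ^ 2 := by positivity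
  have hr22 : r ^ 2 ≤ r := by rw [sq]; exact mul_le_of_le_one_right hr.le hr1
  have n0 := abs_nonneg y₀
  have n1 := abs_nonneg y₁
  have n2 := abs_nonneg y₂
  have m2 : |y₂| ≤ |y₂| / r := by rw [le_div_iff₀ hr]; exact mul_le_of_le_one_right n2 hr1
  have m0 : r ^ 2 * |y₀| ≤ r * |y₀| := mul_le_mul_of_nonneg_right hr22 n0
  have m0' : 0 ≤ r * |y₀| := by positivity
  have m2' : 0 ≤ |y₂| / r := by positivity
  have hF0 : 0 ≤ F := by rw [hF]; positivity
  have s1 := abs_le.1 h.σ_le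
  have p1 := abs_le.1 h.p_le
  have w1 := abs_le.1 h.ω_le
  have k2' := mul_le_mul_of_nonneg_right k2 hr2.le
  have k3' := mul_le_mul_of_nonneg_right k3 hr2.le
  have e4 : K * r ^ 4 = K * r ^ 2 * r ^ 2 := by ring
  have σlo : κ / 2 * r ^ 2 ≤ σ := by linarith
  have σhi : σ ≤ 2 * κ * r ^ 2 := by have : 0 < κ * r ^ 2 := by positivity
                                     linarith
  have plo : δ / 2 * r ^ 2 ≤ p := by linarith
  have phi : p ≤ 2 * δ * r ^ 2 := by have : 0 < δ * r ^ 2 := by positivity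
                                     linarith
  have σ0 : 0 < σ := lt_of_lt_of_le (by positivity) σlo
  have p0 : 0 < p := lt_of_lt_of_le (by positivity) plo
  have ωlo : r / 2 ≤ ω := by
    have : K * r ^ 3 ≤ L * r ^ 2 * r := by
      rw [show L * r ^ 2 * r = L * r ^ 3 by ring]
      exact mul_le_mul_of_nonneg_right hKL (by positivity)
    have := mul_le_mul_of_nonneg_right k1 hr.le
    linarith
  have ω0 : 0 < ω := by linarith
  have σsq : σ ^ 2 ≤ 4 * κ ^ 2 * r ^ 4 := by
    have := pow_le_pow_left₀ σ0.le σhi 2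
    linarith
  have pσ : p * σ ≤ 4 * δ * κ * r ^ 4 := by
    have := mul_le_mul phi σhi σ0.le (by positivity)
    linarith
  have pσ0 : 0 < p * σ := by positivity
  have σsq0 : 0 < σ ^ 2 := by positivity
  have r4 : 0 < r ^ 4 := by positivity
  -- `pair_eq` gives `N = r² + σ² - 2pσ + e r⁴`, and everything after `r²` is `O(r⁴)`.
  have hNr : |N - r ^ 2| ≤ L * r ^ 4 := by
    have e1 : N - r ^ 2 = σ ^ 2 - 2 * (p * σ) + e * r ^ 4 := by
      rw [hN]; linear_combination -h.pair_eq
    have : 0 < e * r ^ 4 := by positivity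
    have : 0 < κ ^ 2 * r ^ 4 := by positivity
    have : 0 < δ * κ * r ^ 4 := by positivity
    have : 0 < K * r ^ 4 := by positivity
    rw [e1, hL, abs_le]
    constructor <;> linarith
  have hqN : |ω ^ 2 + p ^ 2 / 4 - N| ≤ L * r ^ 4 := by
    have e1 : ω ^ 2 + p ^ 2 / 4 - N = p * σ - σ ^ 2 := by rw [hN]; ring
    have : 0 < e * r ^ 4 := by positivity
    have : 0 < κ ^ 2 * r ^ 4 := by positivity
    have : 0 < δ * κ * r ^ 4 := by positivity
    have : 0 < K * r ^ 4 := by positivity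
    rw [e1, hL, abs_le]
    constructor <;> linarith
  have hNlo : r ^ 2 / 2 ≤ N := by
    have := (abs_le.1 hNr).1
    have := mul_le_mul_of_nonneg_right k1 hr2.le
    linarith
  have hN0 : 0 < N := by linarith
  have hAA : |A - (y₀ + y₂ / r ^ 2)| ≤ CA * F := by
    have e1 : A - (y₀ + y₂ / r ^ 2) =
        (p * y₁ + (ω ^ 2 + p ^ 2 / 4 - N) * y₀ + (-(N - r ^ 2)) * (y₂ / r ^ 2)) / N := by
      rw [hA]; field_simp; ring
    have t1 : |p * y₁| ≤ 2 * δ * r ^ 2 * |y₁| := by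
      rw [abs_mul, abs_of_pos p0]; exact mul_le_mul_of_nonneg_right phi n1
    have t2 : |(ω ^ 2 + p ^ 2 / 4 - N) * y₀| ≤ L * r ^ 4 * |y₀| := by
      rw [abs_mul]; exact mul_le_mul_of_nonneg_right hqN n0
    have t3 : |(-(N - r ^ 2)) * (y₂ / r ^ 2)| ≤ L * r ^ 2 * |y₂| := by
      rw [abs_mul, abs_neg, abs_div, abs_of_pos hr2]
      calc _ ≤ L * r ^ 4 * (|y₂| / r ^ 2) := mul_le_mul_of_nonneg_right hNr (by positivity)
        _ = _ := by field_simp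
    rw [e1, abs_div, abs_of_pos hN0, div_le_iff₀ hN0]
    refine ((abs_add_le _ _).trans (add_le_add (abs_add_le _ _) le_rfl)).trans ?_
    have c1 : 2 * δ * r ^ 2 * |y₁| + L * r ^ 4 * |y₀| + L * r ^ 2 * |y₂| ≤
        CA * F * (r ^ 2 / 2) := by
      have : 2 * δ * |y₁| + L * (r ^ 2 * |y₀|) + L * |y₂| ≤ CA * F / 2 := by
        have a1 := mul_le_mul_of_nonneg_left m0 hL0.le
        have a2 := mul_le_mul_of_nonneg_left m2 hL0.le
        have a3 : 0 ≤ L * |y₁| := by positivity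
        have a4 : 0 ≤ δ * (r * |y₀|) := by positivity
        have a5 : 0 ≤ δ * (|y₂| / r) := by positivity
        rw [hCA, hF]; linarith
      have := mul_le_mul_of_nonneg_right this hr2.le
      linarith
    have c2 := mul_le_mul_of_nonneg_left hNlo (by positivity : 0 ≤ CA * F)
    linarith
  have hBB : |B - -(y₂ / r ^ 2)| ≤ CA * F := by
    rw [hB, show y₀ - A - -(y₂ / r ^ 2) = -(A - (y₀ + y₂ / r ^ 2)) by ring, abs_neg]
    exact hAA
  refine ⟨hN0, ω0, σlo, plo, hAA, hBB, ?_⟩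
  have y2r : |y₂ / r ^ 2| = |y₂| / r ^ 2 := by rw [abs_div, abs_of_pos hr2]
  have rF : r * F ≤ F := mul_le_of_le_one_left hF0 hr1
  have e2r : r * (|y₂| / r ^ 2) = |y₂| / r := by field_simp
  -- `A` and `B` may be as large as `|y₂| / r²`, which `F` does not control. In `D / ω` they carry
  -- the factors `σ` and `p` of order `r²` over `ω` of order `r`, so a bound for `r |A|` and `r |B|`
  -- is enough.
  have bA : r * |A| ≤ (1 + CA) * F := by
    have a1 : |A| ≤ CA * F + (|y₀| + |y₂| / r ^ 2) := by
      have : A = (A - (y₀ + y₂ / r ^ 2)) + (y₀ + y₂ / r ^ 2) := by ring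
      rw [this]
      refine (abs_add_le _ _).trans (add_le_add hAA ((abs_add_le _ _).trans ?_))
      rw [y2r]
    have a2 := mul_le_mul_of_nonneg_left a1 hr.le
    have a3 := mul_le_mul_of_nonneg_left rF hCA0.le
    have a4 : r * |y₀| + |y₂| / r ≤ F := by rw [hF]; linarith
    linarith
  have bB : r * |B| ≤ (1 + CA) * F := by
    have a1 : |B| ≤ CA * F + |y₂| / r ^ 2 := by
      have : B = (B - -(y₂ / r ^ 2)) + -(y₂ / r ^ 2) := by ring
      rw [this]
      refine (abs_add_le _ _).trans (add_le_add hBB ?_)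
      rw [abs_neg, y2r]
    have a2 := mul_le_mul_of_nonneg_left a1 hr.le
    have a3 := mul_le_mul_of_nonneg_left rF hCA0.le
    have a4 : |y₂| / r ≤ F := by rw [hF]; linarith
    linarith
  have e1 : D / ω - y₁ / r = (-(ω - r) * (y₁ / r) + (σ * A + p * B / 2)) / ω := by
    rw [hD]; field_simp; ring
  rw [e1, abs_div, abs_of_pos ω0, div_le_iff₀ ω0]
  have t1 : |-(ω - r) * (y₁ / r)| ≤ L * F * r := by
    rw [abs_mul, abs_neg, abs_div, abs_of_pos hr]
    calc _ ≤ K * r ^ 3 * (|y₁| / r) := mul_le_mul_of_nonneg_right h.ω_le (by positivity)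
      _ = K * r ^ 2 * |y₁| := by field_simp
      _ ≤ L * r * F := by
        refine mul_le_mul (mul_le_mul hKL hr22 hr2.le hL0.le) ?_ n1 (by positivity)
        rw [hF]; linarith
      _ = _ := by ring
  have t2 : |σ * A| ≤ 2 * κ * ((1 + CA) * F) * r := by
    rw [abs_mul, abs_of_pos σ0]
    calc σ * |A| ≤ 2 * κ * r ^ 2 * |A| := mul_le_mul_of_nonneg_right σhi (abs_nonneg _)
      _ = 2 * κ * r * (r * |A|) := by ring
      _ ≤ 2 * κ * r * ((1 + CA) * F) := mul_le_mul_of_nonneg_left bA (by positivity)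
      _ = _ := by ring
  have t3 : |p * B / 2| ≤ δ * ((1 + CA) * F) * r := by
    rw [abs_div, abs_mul, abs_of_pos p0, abs_of_pos (by norm_num : (0 : ℝ) < 2)]
    calc p * |B| / 2 ≤ 2 * δ * r ^ 2 * |B| / 2 := by
          have := mul_le_mul_of_nonneg_right phi (abs_nonneg B)
          linarith
      _ = δ * r * (r * |B|) := by ring
      _ ≤ δ * r * ((1 + CA) * F) := mul_le_mul_of_nonneg_left bB (by positivity)
      _ = _ := by ring
  refine ((abs_add_le _ _).trans (add_le_add t1 ((abs_add_le _ _).trans (add_le_add t2 t3)))).trans ?_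
  have := mul_le_mul_of_nonneg_left ωlo
    (by positivity : 0 ≤ (2 * L + 2 * (2 * κ + δ) * (1 + CA)) * F)
  linarith

theorem abs_sin_sub_sin_le (u v : ℝ) : |Real.sin u - Real.sin v| ≤ |u - v| := by
  simpa [Real.dist_eq] using Real.lipschitzWith_sin.dist_le_mul u v

theorem abs_cos_sub_cos_le (u v : ℝ) : |Real.cos u - Real.cos v| ≤ |u - v| := by
  simpa [Real.dist_eq] using Real.lipschitzWith_cos.dist_le_mul u v

set_option maxHeartbeats 1000000 in
/-- At low frequency the solution is close to the symbols of `J₀`, `J₁`, `J₂`. -/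
theorem exists_low_frequency_bound {a e δ κ : ℝ} (ha : a = δ + κ) (he : 0 < e) (hδ : 0 < δ)
    (hκ : 0 < κ) :
    ∃ C c r₁ : ℝ, 0 < C ∧ 0 < c ∧ 0 < r₁ ∧ ∀ r, 0 < r → r ≤ r₁ → ∀ y y₁ y₂ : ℝ → ℝ,
      SolvesODE (a * r ^ 2) (r ^ 2 + e * r ^ 4) (κ * r ^ 4) y y₁ y₂ → ∀ t, 0 ≤ t →
      |y t - symbolJ0 κ t r * y 0 - symbolJ1 δ t r * y₁ 0 - symbolJ2 δ κ t r * y₂ 0| ≤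
        C * Real.exp (-(c * (r ^ 2 * t))) * (r * |y 0| + |y₁ 0| + |y₂ 0| / r) := by
  obtain ⟨K, r₀, hK, hr₀, hroots⟩ := exists_lowRoots ha he hδ hκ
  obtain ⟨L, hL⟩ : ∃ L, L = K + 4 * κ ^ 2 + 8 * δ * κ + e := ⟨_, rfl⟩
  have hL0 : 0 < L := by rw [hL]; positivity
  have hKL : K ≤ L := by rw [hL]; have : 0 < 4 * κ ^ 2 + 8 * δ * κ + e := by positivity
                         linarith
  -- The roots satisfy `σ ≥ κ r² / 2` and `p / 2 ≥ δ r² / 4`; `c` makes both at least `2 c r²`,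
  -- which leaves one spare factor `exp(-c r² t)`.
  obtain ⟨c, hc⟩ : ∃ c, c = min (κ / 4) (δ / 8) := ⟨_, rfl⟩
  have hc0 : 0 < c := by rw [hc]; positivity
  have hcκ : c ≤ κ / 4 := by rw [hc]; simp
  have hcδ : c ≤ δ / 8 := by rw [hc]; simp
  obtain ⟨CA, hCA⟩ : ∃ CA, CA = 4 * δ + 2 * L := ⟨_, rfl⟩
  have hCA0 : 0 < CA := by rw [hCA]; positivity
  obtain ⟨CD, hCD⟩ : ∃ CD, CD = 2 * L + 2 * (2 * κ + δ) * (1 + CA) := ⟨_, rfl⟩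
  have hCD0 : 0 < CD := by rw [hCD]; positivity
  obtain ⟨s₁, hs₁⟩ : ∃ s₁, s₁ = min (1 / (2 * L)) (min (κ / (2 * K)) (δ / (2 * K))) := ⟨_, rfl⟩
  have hs0 : 0 < s₁ := by rw [hs₁]; positivity
  refine ⟨2 * CA + CD + 5 * L / c, c, min (min r₀ 1) √s₁, by positivity, hc0, by positivity,
    fun r hr hr1 y y₁ y₂ hy t ht => ?_⟩
  have hrr0 : r ≤ r₀ := hr1.trans (by simp)
  have hr_one : r ≤ 1 := hr1.trans (by simp)
  have hrs : r ^ 2 ≤ s₁ := by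
    have := pow_le_pow_left₀ hr.le (hr1.trans (min_le_right _ _)) 2
    rwa [Real.sq_sqrt hs0.le] at this
  have hr2 : 0 < r ^ 2 := by positivity
  have k1 : L * r ^ 2 ≤ 1 / 2 := by
    have : r ^ 2 ≤ 1 / (2 * L) := hrs.trans (by rw [hs₁]; simp)
    rw [le_div_iff₀ (by positivity)] at this; linarith
  have k2 : K * r ^ 2 ≤ κ / 2 := by
    have : r ^ 2 ≤ κ / (2 * K) := hrs.trans (by rw [hs₁]; simp)
    rw [le_div_iff₀ (by positivity)] at this; linarith
  have k3 : K * r ^ 2 ≤ δ / 2 := by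
    have : r ^ 2 ≤ δ / (2 * K) := hrs.trans (by rw [hs₁]; simp)
    rw [le_div_iff₀ (by positivity)] at this; linarith
  obtain ⟨σ, p, ω, h⟩ := hroots r hr hrr0
  obtain ⟨N, hN⟩ : ∃ N, N = σ ^ 2 - p * σ + (ω ^ 2 + p ^ 2 / 4) := ⟨_, rfl⟩
  obtain ⟨A, hA⟩ : ∃ A, A = (y₂ 0 + p * y₁ 0 + (ω ^ 2 + p ^ 2 / 4) * y 0) / N := ⟨_, rfl⟩
  obtain ⟨B, hB⟩ : ∃ B, B = y 0 - A := ⟨_, rfl⟩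
  obtain ⟨D, hD⟩ : ∃ D, D = y₁ 0 + σ * A + p * B / 2 := ⟨_, rfl⟩
  obtain ⟨F, hF⟩ : ∃ F, F = r * |y 0| + |y₁ 0| + |y₂ 0| / r := ⟨_, rfl⟩
  obtain ⟨hN0, hω, σlo, plo, bA, bB, bD⟩ := h.abs_coeff_le he hδ hκ hL hr hr_one hK k1 k2 k3 hN hA hB
    hD hF hCA
  rw [← hCD] at bD
  have rep := hy.eq_exp_add_cos_add_sin hω.ne' h.sum_eq h.pair_eq h.prod_eq hN hN0.ne' hA hB hD t
  rw [← hF]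
  obtain ⟨X, hX⟩ : ∃ X, X = r ^ 2 * t := ⟨_, rfl⟩
  have hX0 : 0 ≤ X := by rw [hX]; positivity
  rw [← hX]
  obtain ⟨G, hG⟩ : ∃ G, G = Real.exp (-(c * X)) := ⟨_, rfl⟩
  have hG0 : 0 < G := by rw [hG]; exact Real.exp_pos _
  have x1 : 2 * c * X ≤ σ * t := by
    have : 2 * c * r ^ 2 ≤ σ := by linarith [mul_le_mul_of_nonneg_right hcκ hr2.le]
    have := mul_le_mul_of_nonneg_right this ht
    rw [hX]; linarith
  have x2 : 2 * c * X ≤ κ * r ^ 2 * t := by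
    have := mul_le_mul_of_nonneg_right hcκ hX0
    have e : κ * r ^ 2 * t = κ * X := by rw [hX]; ring
    have : 0 ≤ κ * X := by positivity
    linarith
  have x3 : 2 * c * X ≤ p / 2 * t := by
    have : 2 * c * r ^ 2 ≤ p / 2 := by linarith [mul_le_mul_of_nonneg_right hcδ hr2.le]
    have := mul_le_mul_of_nonneg_right this ht
    rw [hX]; linarith
  have x4 : 2 * c * X ≤ δ / 2 * r ^ 2 * t := by
    have := mul_le_mul_of_nonneg_right hcδ hX0
    have e : δ / 2 * r ^ 2 * t = δ / 2 * X := by rw [hX]; ring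
    have : 0 ≤ δ * X := by positivity
    linarith
  have d1 : |σ * t - κ * r ^ 2 * t| ≤ L * r ^ 2 * X := by
    rw [← sub_mul, abs_mul, abs_of_nonneg ht, hX]
    calc _ ≤ K * r ^ 4 * t := mul_le_mul_of_nonneg_right h.σ_le ht
      _ ≤ L * r ^ 4 * t := by gcongr
      _ = _ := by ring
  have d2 : |p / 2 * t - δ / 2 * r ^ 2 * t| ≤ L * r ^ 2 * X := by
    rw [show p / 2 * t - δ / 2 * r ^ 2 * t = (p - δ * r ^ 2) * (t / 2) by ring, abs_mul,
      abs_of_nonneg (by positivity : 0 ≤ t / 2), hX]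
    calc _ ≤ K * r ^ 4 * (t / 2) := mul_le_mul_of_nonneg_right h.p_le (by positivity)
      _ ≤ L * r ^ 4 * t := by gcongr; linarith
      _ = _ := by ring
  have d3 : |ω * t - r * t| ≤ L * r * X := by
    rw [← sub_mul, abs_mul, abs_of_nonneg ht, hX]
    calc _ ≤ K * r ^ 3 * t := mul_le_mul_of_nonneg_right h.ω_le ht
      _ ≤ L * r ^ 3 * t := by gcongr
      _ = _ := by ring
  have E1 := abs_exp_sub_exp_le (r := r) hc0 hL0.le x1 x2 d1
  have E2 := abs_exp_mul_sub_exp_mul_le hc0 hL0.le x3 x4 d2 hr hr_one Real.abs_cos_le_one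
    abs_cos_sub_cos_le d3
  have E3 := abs_exp_mul_sub_exp_mul_le hc0 hL0.le x3 x4 d2 hr hr_one Real.abs_sin_le_one
    abs_sin_sub_sin_le d3
  rw [← hG] at E1 E2 E3 ⊢
  have le_G : ∀ x, 2 * c * X ≤ x → Real.exp (-x) ≤ G := fun x hx => by
    rw [hG]; refine Real.exp_le_exp.2 ?_
    have : 0 ≤ c * X := by positivity
    linarith
  have G1 : |Real.exp (-(σ * t))| ≤ G := by rw [abs_of_pos (Real.exp_pos _)]; exact le_G _ x1
  have G2 : ∀ v, |v| ≤ 1 → |Real.exp (-(p / 2 * t)) * v| ≤ G := fun v hv => by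
    rw [abs_mul, abs_of_pos (Real.exp_pos _)]
    calc _ ≤ G * 1 := mul_le_mul (le_G _ x3) hv (abs_nonneg _) hG0.le
      _ = G := mul_one G
  have n0 := abs_nonneg (y 0)
  have n1 := abs_nonneg (y₁ 0)
  have n2 := abs_nonneg (y₂ 0)
  have hF0 : 0 ≤ F := by rw [hF]; positivity
  have hr22 : r ^ 2 ≤ r := by rw [sq]; exact mul_le_of_le_one_right hr.le hr_one
  have f2 : |y₂ 0| / r ≤ F := by rw [hF]; have : 0 ≤ r * |y 0| := by positivity
                                 linarith
  have f1 : |y₁ 0| ≤ F := by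
    rw [hF]
    have : 0 ≤ r * |y 0| := by positivity
    have : 0 ≤ |y₂ 0| / r := by positivity
    linarith
  have f0 : r ^ 2 * |y 0| + |y₂ 0| ≤ F := by
    rw [hF]
    have a1 := mul_le_mul_of_nonneg_right hr22 n0
    have a2 : |y₂ 0| ≤ |y₂ 0| / r := by rw [le_div_iff₀ hr]; exact mul_le_of_le_one_right n2 hr_one
    linarith
  -- For each mode: the error of the coefficient times the decay, plus the leading coefficient times
  -- the error of the exponential. The leading coefficients have size `|y₀| + |y₂|/r²`, `|y₂|/r²`,
  -- `|y₁|/r`, and the gains `r²`, `r`, `r` bring each product below `F`.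
  have R1 := abs_mul_sub_mul_le bA G1
    (R := |y 0| + |y₂ 0| / r ^ 2) ((abs_add_le _ _).trans (by rw [abs_div, abs_of_pos hr2])) E1
  have R2 := abs_mul_sub_mul_le bB (G2 _ (Real.abs_cos_le_one (ω * t)))
    (R := |y₂ 0| / r ^ 2) (by rw [abs_neg, abs_div, abs_of_pos hr2]) E2
  have R3 := abs_mul_sub_mul_le bD (G2 _ (Real.abs_sin_le_one (ω * t)))
    (R := |y₁ 0| / r) (by rw [abs_div, abs_of_pos hr]) E3
  have S1 : (|y 0| + |y₂ 0| / r ^ 2) * (L / c * r ^ 2 * G) ≤ L / c * G * F := by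
    rw [show (|y 0| + |y₂ 0| / r ^ 2) * (L / c * r ^ 2 * G) =
      L / c * G * (r ^ 2 * |y 0| + |y₂ 0|) by field_simp]
    exact mul_le_mul_of_nonneg_left f0 (by positivity)
  have S2 : |y₂ 0| / r ^ 2 * (2 * L / c * r * G) ≤ 2 * (L / c * G * F) := by
    rw [show |y₂ 0| / r ^ 2 * (2 * L / c * r * G) = 2 * (L / c * G * (|y₂ 0| / r)) by field_simp]
    gcongr
  have S3 : |y₁ 0| / r * (2 * L / c * r * G) ≤ 2 * (L / c * G * F) := by
    rw [show |y₁ 0| / r * (2 * L / c * r * G) = 2 * (L / c * G * |y₁ 0|) by field_simp]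
    gcongr
  have key : y t - symbolJ0 κ t r * y 0 - symbolJ1 δ t r * y₁ 0 - symbolJ2 δ κ t r * y₂ 0 =
      (A * Real.exp (-(σ * t)) - (y 0 + y₂ 0 / r ^ 2) * Real.exp (-(κ * r ^ 2 * t))) +
      (B * (Real.exp (-(p / 2 * t)) * Real.cos (ω * t)) -
        -(y₂ 0 / r ^ 2) * (Real.exp (-(δ / 2 * r ^ 2 * t)) * Real.cos (r * t))) +
      (D / ω * (Real.exp (-(p / 2 * t)) * Real.sin (ω * t)) -
        y₁ 0 / r * (Real.exp (-(δ / 2 * r ^ 2 * t)) * Real.sin (r * t))) := by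
    rw [rep]
    simp only [symbolJ0, symbolJ1, symbolJ2, neg_mul]
    ring
  rw [key]
  refine ((abs_add_le _ _).trans (add_le_add ((abs_add_le _ _).trans (add_le_add R1 R2)) R3)).trans ?_
  have : (2 * CA + CD + 5 * L / c) * G * F = 2 * (CA * F * G) + CD * F * G + 5 * (L / c * G * F) := by
    ring
  rw [this]
  linarith

/-! ### High frequencies, and the combined frequency bounds -/

theorem exp_neg_mul_sq_mul_le {k r r₁ t c : ℝ} (hr₁ : 0 ≤ r₁) (hr : r₁ ≤ r) (hk : 0 ≤ k)
    (hc : c ≤ k * r₁ ^ 2) (ht : 0 ≤ t) : Real.exp (-k * r ^ 2 * t) ≤ Real.exp (-c * t) := by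
  refine Real.exp_le_exp.2 ?_
  have h1 := mul_le_mul_of_nonneg_left (pow_le_pow_left₀ hr₁ hr 2) hk
  have := mul_le_mul_of_nonneg_right (hc.trans h1) ht
  linarith

/-- Away from zero frequency both the solution and the symbols decay exponentially. -/
theorem exists_high_frequency_bound {a e δ κ : ℝ} (ha : a = δ + κ) (he : 0 < e) (hδ : 0 < δ)
    (hκ : 0 < κ) {r₁ : ℝ} (hr₁ : 0 < r₁) :
    ∃ C c : ℝ, 0 < C ∧ 0 < c ∧ ∀ r, r₁ ≤ r → ∀ y y₁ y₂ : ℝ → ℝ,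
      SolvesODE (a * r ^ 2) (r ^ 2 + e * r ^ 4) (κ * r ^ 4) y y₁ y₂ → ∀ t, 0 ≤ t →
      |y t - symbolJ0 κ t r * y 0 - symbolJ1 δ t r * y₁ 0 - symbolJ2 δ κ t r * y₂ 0| ≤
        C * Real.exp (-c * t) * (|y 0| + |y₁ 0| + |y₂ 0|) := by
  have ha0 : 0 < a := by linarith
  -- Here `m = κ r² / (1 + e r²)` increases in `r` from its value at `r₁` towards `κ / e`. As `m ≤ κ
  -- r²`, the gap `a r² - m` is at least `δ r²`, and `(a r² - m) / a ≤ r²` lies below the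
  -- coefficient of `y'`.
  obtain ⟨C, c, hC, hc, h⟩ := exists_decay_of_routh_hurwitz (α₁ := δ * r₁ ^ 2) (β := 1 / a)
    (m₀ := κ * r₁ ^ 2 / (1 + e * r₁ ^ 2)) (m₁ := κ / e) (by positivity) (by positivity)
    (by positivity) (by positivity)
  -- The decay lemma bounds `y²`, so the square root halves the rate `c`; the other two entries are
  -- the rates of the symbols for `r ≥ r₁`.
  obtain ⟨c', hc'⟩ : ∃ c', c' = min (c / 2) (min (κ * r₁ ^ 2) (δ / 2 * r₁ ^ 2)) := ⟨_, rfl⟩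
  have hc'1 : c' ≤ c / 2 := by rw [hc']; simp
  have hc'2 : c' ≤ κ * r₁ ^ 2 := by rw [hc']; simp
  have hc'3 : c' ≤ δ / 2 * r₁ ^ 2 := by rw [hc']; simp
  refine ⟨√C + 1 + 1 / r₁ + 2 / r₁ ^ 2, c', by positivity, by rw [hc']; positivity,
    fun r hr y y₁ y₂ hy t ht => ?_⟩
  have hr0 : 0 < r := hr₁.trans_le hr
  have hsq : r₁ ^ 2 ≤ r ^ 2 := pow_le_pow_left₀ hr₁.le hr 2
  have hr2 : 0 < r ^ 2 := by positivity
  obtain ⟨G, hG⟩ : ∃ G, G = Real.exp (-c' * t) := ⟨_, rfl⟩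
  have hG0 : 0 < G := by rw [hG]; exact Real.exp_pos _
  obtain ⟨m, hm⟩ : ∃ m, m = κ * r ^ 2 / (1 + e * r ^ 2) := ⟨_, rfl⟩
  have hm0 : 0 < m := by rw [hm]; positivity
  have hmκ : m ≤ κ * r ^ 2 := by
    rw [hm]; refine div_le_self (by positivity) ?_
    have : 0 < e * r ^ 2 := by positivity
    linarith
  have hsol := h (a * r ^ 2 - m) (r ^ 2 + e * r ^ 4) m ?_ ?_ ?_ ?_ y y₁ y₂ ?_ t ht
  · have h1 : |y t| ≤ √C * G * (|y 0| + |y₁ 0| + |y₂ 0|) := by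
      refine abs_le_of_sq_le_sq ?_ (by positivity)
      refine hsol.trans ?_
      rw [mul_pow, mul_pow, Real.sq_sqrt hC.le]
      have e1 : Real.exp (-c * t) ≤ G ^ 2 := by
        rw [hG, sq, ← Real.exp_add]
        refine Real.exp_le_exp.2 ?_
        have := mul_le_mul_of_nonneg_right hc'1 ht
        linarith
      have e2 : y 0 ^ 2 + y₁ 0 ^ 2 + y₂ 0 ^ 2 ≤ (|y 0| + |y₁ 0| + |y₂ 0|) ^ 2 := by
        rw [← sq_abs (y 0), ← sq_abs (y₁ 0), ← sq_abs (y₂ 0)]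
        have := mul_nonneg (abs_nonneg (y 0)) (abs_nonneg (y₁ 0))
        have := mul_nonneg (abs_nonneg (y 0)) (abs_nonneg (y₂ 0))
        have := mul_nonneg (abs_nonneg (y₁ 0)) (abs_nonneg (y₂ 0))
        linarith
      calc C * (y 0 ^ 2 + y₁ 0 ^ 2 + y₂ 0 ^ 2) * Real.exp (-c * t)
          ≤ C * (|y 0| + |y₁ 0| + |y₂ 0|) ^ 2 * G ^ 2 := by gcongr
        _ = _ := by ring
    have j0 : |symbolJ0 κ t r| ≤ G := by
      rw [symbolJ0, abs_of_pos (Real.exp_pos _), hG]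
      exact exp_neg_mul_sq_mul_le hr₁.le hr hκ.le hc'2 ht
    have jδ : Real.exp (-(δ / 2) * r ^ 2 * t) ≤ G := by
      rw [hG]; exact exp_neg_mul_sq_mul_le hr₁.le hr (by positivity) hc'3 ht
    have j1 : |symbolJ1 δ t r| ≤ 1 / r₁ * G := by
      rw [symbolJ1, abs_mul, abs_of_pos (Real.exp_pos _), abs_div, abs_of_pos hr0]
      gcongr
      exact Real.abs_sin_le_one _
    have j2 : |symbolJ2 δ κ t r| ≤ 2 / r₁ ^ 2 * G := by
      have e1 : |-(Real.cos (r * t) / r ^ 2) * Real.exp (-(δ / 2) * r ^ 2 * t)| ≤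
          1 / r₁ ^ 2 * G := by
        rw [abs_mul, abs_of_pos (Real.exp_pos _), abs_neg, abs_div, abs_of_pos hr2]
        gcongr
        exact Real.abs_cos_le_one _
      have e2 : |1 / r ^ 2 * Real.exp (-κ * r ^ 2 * t)| ≤ 1 / r₁ ^ 2 * G := by
        rw [abs_mul, abs_of_pos (by positivity : 0 < 1 / r ^ 2)]
        exact mul_le_mul (by gcongr) j0 (abs_nonneg _) (by positivity)
      refine (abs_add_le _ _).trans ((add_le_add e1 e2).trans (le_of_eq (by ring)))
    have n0 := abs_nonneg (y 0)
    have n1 := abs_nonneg (y₁ 0)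
    have n2 := abs_nonneg (y₂ 0)
    have t0 : |symbolJ0 κ t r * y 0| ≤ G * |y 0| := by
      rw [abs_mul]; exact mul_le_mul_of_nonneg_right j0 n0
    have t1 : |symbolJ1 δ t r * y₁ 0| ≤ 1 / r₁ * G * |y₁ 0| := by
      rw [abs_mul]; exact mul_le_mul_of_nonneg_right j1 n1
    have t2 : |symbolJ2 δ κ t r * y₂ 0| ≤ 2 / r₁ ^ 2 * G * |y₂ 0| := by
      rw [abs_mul]; exact mul_le_mul_of_nonneg_right j2 n2
    have tri := (abs_sub (y t - symbolJ0 κ t r * y 0 - symbolJ1 δ t r * y₁ 0)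
      (symbolJ2 δ κ t r * y₂ 0)).trans (add_le_add ((abs_sub _ _).trans
      (add_le_add ((abs_sub _ _).trans (add_le_add h1 t0)) t1)) t2)
    refine tri.trans ?_
    rw [← hG]
    have z0 : G * |y 0| ≤ 1 * G * (|y 0| + |y₁ 0| + |y₂ 0|) := by
      rw [one_mul]; gcongr; linarith
    have z1 : 1 / r₁ * G * |y₁ 0| ≤ 1 / r₁ * G * (|y 0| + |y₁ 0| + |y₂ 0|) := by
      gcongr; linarith
    have z2 : 2 / r₁ ^ 2 * G * |y₂ 0| ≤ 2 / r₁ ^ 2 * G * (|y 0| + |y₁ 0| + |y₂ 0|) := by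
      gcongr; linarith
    linarith
  · have : δ * r₁ ^ 2 ≤ δ * r ^ 2 := by gcongr
    rw [ha]; linarith
  · rw [one_div, inv_mul_le_iff₀ ha0]
    have : 0 < e * r ^ 4 := by positivity
    nlinarith
  · rw [hm, div_le_div_iff₀ (by positivity) (by positivity)]
    nlinarith
  · rw [hm, div_le_div_iff₀ (by positivity) he]
    nlinarith
  · have e1 : a * r ^ 2 - m + m = a * r ^ 2 := by ring
    have e2 : m * (r ^ 2 + e * r ^ 4) = κ * r ^ 4 := by rw [hm]; field_simp
    rw [e1, e2]; exact hy

theorem SolvesODE.map {F F' : Type*} [NormedAddCommGroup F] [NormedSpace ℝ F]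
    [NormedAddCommGroup F'] [NormedSpace ℝ F'] {a₁ a₂ a₃ : ℝ} {y y₁ y₂ : ℝ → F}
    (h : SolvesODE a₁ a₂ a₃ y y₁ y₂) (T : F →L[ℝ] F') :
    SolvesODE a₁ a₂ a₃ (fun t => T (y t)) (fun t => T (y₁ t)) (fun t => T (y₂ t)) where
  deriv_zero t := T.hasFDerivAt.comp_hasDerivAt t (h.deriv_zero t)
  deriv_one t := T.hasFDerivAt.comp_hasDerivAt t (h.deriv_one t)
  deriv_two t := by
    have := T.hasFDerivAt.comp_hasDerivAt t (h.deriv_two t)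
    simpa [Function.comp_def] using this

theorem exists_frequency_bounds {a e δ κ : ℝ} (ha : a = δ + κ) (he : 0 < e) (hδ : 0 < δ)
    (hκ : 0 < κ) :
    ∃ C c r₁ : ℝ, 0 < C ∧ 0 < c ∧ 0 < r₁ ∧ ∀ r, 0 < r → ∀ y y₁ y₂ : ℝ → ℂ,
      SolvesODE (a * r ^ 2) (r ^ 2 + e * r ^ 4) (κ * r ^ 4) y y₁ y₂ → ∀ t, 0 ≤ t →
      (r ≤ r₁ → ‖y t - symbolJ0 κ t r * y 0 - symbolJ1 δ t r * y₁ 0 - symbolJ2 δ κ t r * y₂ 0‖ ≤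
        C * Real.exp (-(c * (r ^ 2 * t))) * (r * ‖y 0‖ + ‖y₁ 0‖ + ‖y₂ 0‖ / r)) ∧
      (r₁ ≤ r → ‖y t - symbolJ0 κ t r * y 0 - symbolJ1 δ t r * y₁ 0 - symbolJ2 δ κ t r * y₂ 0‖ ≤
        C * Real.exp (-(c * t)) * (‖y 0‖ + ‖y₁ 0‖ + ‖y₂ 0‖)) := by
  obtain ⟨C, c, r₁, hC, hc, hr₁, h⟩ := exists_low_frequency_bound ha he hδ hκ
  obtain ⟨C', c', hC', hc', h'⟩ := exists_high_frequency_bound ha he hδ hκ hr₁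
  -- The coefficients are real, so real and imaginary parts solve the same equation; estimating them
  -- separately costs the factor two.
  refine ⟨2 * C + 2 * C', min c c', r₁, by positivity, by positivity, hr₁,
    fun r hr y y₁ y₂ hy t ht => ?_⟩
  have hre := hy.map Complex.reCLM
  have him := hy.map Complex.imCLM
  have n0 := norm_nonneg (y 0)
  have n1 := norm_nonneg (y₁ 0)
  have n2 := norm_nonneg (y₂ 0)
  have b1 := Complex.norm_le_abs_re_add_abs_im
    (y t - symbolJ0 κ t r * y 0 - symbolJ1 δ t r * y₁ 0 - symbolJ2 δ κ t r * y₂ 0)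
  simp only [Complex.sub_re, Complex.sub_im, Complex.re_ofReal_mul, Complex.im_ofReal_mul] at b1
  constructor
  · intro hrr
    have e1 := h r hr hrr _ _ _ hre t ht
    have e2 := h r hr hrr _ _ _ him t ht
    simp only [Complex.reCLM_apply, Complex.imCLM_apply] at e1 e2
    have k1 : r * |(y 0).re| + |(y₁ 0).re| + |(y₂ 0).re| / r ≤ r * ‖y 0‖ + ‖y₁ 0‖ + ‖y₂ 0‖ / r := by
      gcongr <;> exact Complex.abs_re_le_norm _
    have k2 : r * |(y 0).im| + |(y₁ 0).im| + |(y₂ 0).im| / r ≤ r * ‖y 0‖ + ‖y₁ 0‖ + ‖y₂ 0‖ / r := by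
      gcongr <;> exact Complex.abs_im_le_norm _
    have g : Real.exp (-(c * (r ^ 2 * t))) ≤ Real.exp (-(min c c' * (r ^ 2 * t))) := by
      gcongr; exact min_le_left _ _
    have q1 := e1.trans (mul_le_mul (mul_le_mul_of_nonneg_left g hC.le) k1 (by positivity)
      (by positivity))
    have q2 := e2.trans (mul_le_mul (mul_le_mul_of_nonneg_left g hC.le) k2 (by positivity)
      (by positivity))
    refine (b1.trans (add_le_add q1 q2)).trans ?_
    have : 0 ≤ C' * Real.exp (-(min c c' * (r ^ 2 * t))) * (r * ‖y 0‖ + ‖y₁ 0‖ + ‖y₂ 0‖ / r) := by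
      positivity
    linarith
  · intro hrr
    have e1 := h' r hrr _ _ _ hre t ht
    have e2 := h' r hrr _ _ _ him t ht
    simp only [Complex.reCLM_apply, Complex.imCLM_apply] at e1 e2
    have k1 : |(y 0).re| + |(y₁ 0).re| + |(y₂ 0).re| ≤ ‖y 0‖ + ‖y₁ 0‖ + ‖y₂ 0‖ := by
      gcongr <;> exact Complex.abs_re_le_norm _
    have k2 : |(y 0).im| + |(y₁ 0).im| + |(y₂ 0).im| ≤ ‖y 0‖ + ‖y₁ 0‖ + ‖y₂ 0‖ := by
      gcongr <;> exact Complex.abs_im_le_norm _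
    have g : Real.exp (-c' * t) ≤ Real.exp (-(min c c' * t)) := by
      rw [← neg_mul]; gcongr; exact min_le_right _ _
    have q1 := e1.trans (mul_le_mul (mul_le_mul_of_nonneg_left g hC'.le) k1 (by positivity)
      (by positivity))
    have q2 := e2.trans (mul_le_mul (mul_le_mul_of_nonneg_left g hC'.le) k2 (by positivity)
      (by positivity))
    refine (b1.trans (add_le_add q1 q2)).trans ?_
    have : 0 ≤ C * Real.exp (-(min c c' * t)) * (‖y 0‖ + ‖y₁ 0‖ + ‖y₂ 0‖) := by positivity
    linarith

/-! ### From evolution equations in L² to pointwise ODEs -/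

theorem eq_zero_value_of_hasDerivAt_zero {F : Type*} [NormedAddCommGroup F] [NormedSpace ℝ F]
    {f : ℝ → F} (hf : ContinuousOn f (Ici 0)) (hf' : ∀ t > 0, HasDerivAt f 0 t) {t : ℝ}
    (ht : 0 ≤ t) : f t = f 0 := by
  rcases ht.eq_or_lt with rfl | h0
  · rfl
  have h1 : ∀ s ∈ Ioc 0 t, f s = f t := fun s hs =>
    (constant_of_has_deriv_right_zero
      (hf.mono fun x hx => hs.1.le.trans hx.1)
      (fun x hx => (hf' x (hs.1.trans_le hx.1)).hasDerivWithinAt) t ⟨hs.2, le_rfl⟩).symm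
  have h2 : Filter.Tendsto f (nhdsWithin 0 (Ioi 0)) (nhds (f 0)) :=
    (hf 0 self_mem_Ici).mono_left (nhdsWithin_mono _ Ioi_subset_Ici_self)
  have h3 : Filter.Tendsto f (nhdsWithin 0 (Ioi 0)) (nhds (f t)) :=
    tendsto_const_nhds.congr' (by
      filter_upwards [Ioc_mem_nhdsGT h0] with s hs using (h1 s hs).symm)
  exact tendsto_nhds_unique h3 h2

section Multiplication

variable {α E : Type*} [MeasurableSpace α] {μ : Measure α} [NormedAddCommGroup E] [NormedSpace ℝ E]

/-- The operator `f ↦ M f` on `L²` for a bounded field `M` of operators. -/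
def lpMul {M : α → E →L[ℝ] E} (hM : AEStronglyMeasurable M μ) {C : ℝ} (hC : ∀ x, ‖M x‖ ≤ C) :
    Lp E 2 μ →L[ℝ] Lp E 2 μ :=
  have hb : ∀ (f : α → E) x, ‖M x (f x)‖ ≤ C * ‖f x‖ := fun f x =>
    (M x).le_of_opNorm_le (hC x) (f x)
  have hmem : ∀ f : Lp E 2 μ, MemLp (fun x => M x (f x)) 2 μ := fun f =>
    MemLp.of_le_mul (Lp.memLp f)
      ((ContinuousLinearMap.id ℝ (E →L[ℝ] E)).aestronglyMeasurable_comp₂ hM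
        (Lp.aestronglyMeasurable f)) (Filter.Eventually.of_forall (hb f))
  LinearMap.mkContinuous
    { toFun := fun f => (hmem f).toLp
      map_add' := fun f g => by
        rw [← MemLp.toLp_add]
        refine MemLp.toLp_congr _ _ ?_
        filter_upwards [Lp.coeFn_add f g] with x hx
        rw [hx, Pi.add_apply, map_add, Pi.add_apply]
      map_smul' := fun c f => by
        rw [RingHom.id_apply, ← MemLp.toLp_const_smul]
        refine MemLp.toLp_congr _ _ ?_
        filter_upwards [Lp.coeFn_smul c f] with x hx
        rw [hx, Pi.smul_apply, map_smul, Pi.smul_apply] } C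
    (fun f => by
      refine Lp.norm_le_mul_norm_of_ae_le_mul ?_
      filter_upwards [(hmem f).coeFn_toLp] with x hx
      simp only [LinearMap.coe_mk, AddHom.coe_mk]
      rw [hx]
      exact hb f x)

theorem coeFn_lpMul {M : α → E →L[ℝ] E} (hM : AEStronglyMeasurable M μ) {C : ℝ}
    (hC : ∀ x, ‖M x‖ ≤ C) (f : Lp E 2 μ) : lpMul hM hC f =ᵐ[μ] fun x => M x (f x) :=
  MemLp.coeFn_toLp (MemLp.of_le_mul (Lp.memLp f)
    ((ContinuousLinearMap.id ℝ (E →L[ℝ] E)).aestronglyMeasurable_comp₂ hM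
      (Lp.aestronglyMeasurable f))
    (Filter.Eventually.of_forall fun x => (M x).le_of_opNorm_le (hC x) (f x)))

/-- Uniqueness for a linear ODE with bounded generator: `exp(-tT) V(t)` has zero derivative for `t >
0` and is continuous up to `t = 0`. -/
theorem eq_exp_smul_apply {F : Type*} [NormedAddCommGroup F] [NormedSpace ℝ F] [CompleteSpace F]
    (T : F →L[ℝ] F) {V : ℝ → F} (hV : ContinuousOn V (Ici 0))
    (hV' : ∀ t > 0, HasDerivAt V (T (V t)) t) {t : ℝ} (ht : 0 ≤ t) :
    V t = NormedSpace.exp (t • T) (V 0) := by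
  have hexp : ∀ s : ℝ, HasDerivAt (fun s : ℝ => NormedSpace.exp (s • (-T)))
      (NormedSpace.exp (s • (-T)) * (-T)) s := fun s => hasDerivAt_exp_smul_const (-T) s
  have key : NormedSpace.exp (t • (-T)) (V t) = V 0 := by
    have := eq_zero_value_of_hasDerivAt_zero (f := fun s => NormedSpace.exp (s • (-T)) (V s))
      (ContinuousOn.clm_apply (fun s _ => (hexp s).continuousAt.continuousWithinAt) hV)
      (fun s hs => ((hexp s).clm_apply (hV' s hs)).congr_deriv (by simp)) ht
    simpa using this
  let _ : NormedAlgebra ℚ (F →L[ℝ] F) := NormedAlgebra.restrictScalars ℚ ℝ _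
  rw [← key]
  change V t = (NormedSpace.exp (t • T) * NormedSpace.exp (t • (-T))) (V t)
  rw [← NormedSpace.exp_add_of_commute]
  · simp
  · exact ((Commute.refl T).neg_right.smul_left t).smul_right t

theorem hasSum_exp_apply {F : Type*} [NormedAddCommGroup F] [NormedSpace ℝ F] [CompleteSpace F]
    (T : F →L[ℝ] F) (v : F) :
    HasSum (fun n : ℕ => ((n.factorial : ℝ)⁻¹) • (T ^ n) v) (NormedSpace.exp T v) :=
  (NormedSpace.exp_series_hasSum_exp' (𝕂 := ℝ) T).mapL (ContinuousLinearMap.apply ℝ F v)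

theorem coeFn_lpMul_pow {M : α → E →L[ℝ] E} (hM : AEStronglyMeasurable M μ) {C : ℝ}
    (hC : ∀ x, ‖M x‖ ≤ C) (f : Lp E 2 μ) (n : ℕ) :
    ((lpMul hM hC) ^ n) f =ᵐ[μ] fun x => (M x ^ n) (f x) := by
  induction n with
  | zero => simp
  | succ n ih =>
    rw [pow_succ']
    change lpMul hM hC (((lpMul hM hC) ^ n) f) =ᵐ[μ] _
    filter_upwards [coeFn_lpMul hM hC (((lpMul hM hC) ^ n) f), ih] with x h1 h2
    rw [h1, h2, pow_succ']
    rfl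

/-- The partial sums of the exponential series converge in `L²`, so a subsequence converges almost
everywhere. At each point the same sums converge to the exponential of `t • M x`, and the limits
agree. -/
theorem coeFn_exp_lpMul [CompleteSpace E] {M : α → E →L[ℝ] E} (hM : AEStronglyMeasurable M μ)
    {C : ℝ} (hC : ∀ x, ‖M x‖ ≤ C) (t : ℝ) (f : Lp E 2 μ) :
    (NormedSpace.exp (t • lpMul hM hC)) f =ᵐ[μ] fun x => NormedSpace.exp (t • M x) (f x) := by
  have h1 := (hasSum_exp_apply (t • lpMul hM hC) f).tendsto_sum_nat
  obtain ⟨ns, hns, h2⟩ := (tendstoInMeasure_of_tendsto_Lp h1).exists_seq_tendsto_ae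
  have h3 : ∀ᵐ x ∂μ, ∀ N : ℕ, (∑ n ∈ Finset.range N, ((n.factorial : ℝ)⁻¹) •
      ((t • lpMul hM hC) ^ n) f : Lp E 2 μ) x =
      ∑ n ∈ Finset.range N, ((n.factorial : ℝ)⁻¹) • ((t • M x) ^ n) (f x) := by
    rw [ae_all_iff]
    intro N
    induction N with
    | zero =>
      filter_upwards [Lp.coeFn_zero E 2 μ] with x hx
      simpa using hx
    | succ N ih =>
      simp only [Finset.sum_range_succ]
      filter_upwards [ih, Lp.coeFn_add (∑ n ∈ Finset.range N, ((n.factorial : ℝ)⁻¹) •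
        ((t • lpMul hM hC) ^ n) f : Lp E 2 μ) (((N.factorial : ℝ)⁻¹) • ((t • lpMul hM hC) ^ N) f),
        Lp.coeFn_smul ((N.factorial : ℝ)⁻¹) (((t • lpMul hM hC) ^ N) f),
        Lp.coeFn_smul (t ^ N) (((lpMul hM hC) ^ N) f), coeFn_lpMul_pow hM hC f N] with x a1 a2 a3 a4 a5
      rw [a2, Pi.add_apply, a1, a3, Pi.smul_apply, smul_pow, smul_pow]
      congr 2
      change (t ^ N • ((lpMul hM hC) ^ N) f : Lp E 2 μ) x = _
      rw [a4, Pi.smul_apply, a5]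
      rfl
  filter_upwards [h2, h3] with x b1 b2
  have b3 := (hasSum_exp_apply (t • M x) (f x)).tendsto_sum_nat.comp hns.tendsto_atTop
  refine tendsto_nhds_unique b1 (b3.congr fun i => ?_)
  exact (b2 (ns i)).symm

end Multiplication

section Companion

/-- The phase space of a third order scalar equation. -/
abbrev Phase : Type := ℂ × ℂ × ℂ

/-- One of the inclusions of the coordinates of the phase space. -/
def incl₀ : ℂ →L[ℝ] Phase := ContinuousLinearMap.inl ℝ ℂ (ℂ × ℂ)

/-- One of the inclusions of the coordinates of the phase space. -/
def incl₁ : ℂ →L[ℝ] Phase :=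
  ContinuousLinearMap.inr ℝ ℂ (ℂ × ℂ) ∘L ContinuousLinearMap.inl ℝ ℂ ℂ

/-- One of the inclusions of the coordinates of the phase space. -/
def incl₂ : ℂ →L[ℝ] Phase :=
  ContinuousLinearMap.inr ℝ ℂ (ℂ × ℂ) ∘L ContinuousLinearMap.inr ℝ ℂ ℂ

/-- One of the coordinates of the phase space. -/
def coord₀ : Phase →L[ℝ] ℂ := ContinuousLinearMap.fst ℝ ℂ (ℂ × ℂ)

/-- One of the coordinates of the phase space. -/
def coord₁ : Phase →L[ℝ] ℂ :=
  ContinuousLinearMap.fst ℝ ℂ ℂ ∘L ContinuousLinearMap.snd ℝ ℂ (ℂ × ℂ)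

/-- One of the coordinates of the phase space. -/
def coord₂ : Phase →L[ℝ] ℂ :=
  ContinuousLinearMap.snd ℝ ℂ ℂ ∘L ContinuousLinearMap.snd ℝ ℂ (ℂ × ℂ)

@[simp] theorem coord₀_apply (v : Phase) : coord₀ v = v.1 := rfl
@[simp] theorem coord₁_apply (v : Phase) : coord₁ v = v.2.1 := rfl
@[simp] theorem coord₂_apply (v : Phase) : coord₂ v = v.2.2 := rfl
@[simp] theorem incl₀_apply (z : ℂ) : incl₀ z = (z, 0, 0) := rfl
@[simp] theorem incl₁_apply (z : ℂ) : incl₁ z = (0, z, 0) := rfl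
@[simp] theorem incl₂_apply (z : ℂ) : incl₂ z = (0, 0, z) := rfl

/-- The companion operator of `y''' + a₁ y'' + a₂ y' + a₃ y = 0`. -/
def companion (a₁ a₂ a₃ : ℝ) : Phase →L[ℝ] Phase :=
  (incl₀ ∘L coord₁ + incl₁ ∘L coord₂) -
    (a₁ • (incl₂ ∘L coord₂) + a₂ • (incl₂ ∘L coord₁) + a₃ • (incl₂ ∘L coord₀))

theorem companion_apply (a₁ a₂ a₃ : ℝ) (v : Phase) :
    companion a₁ a₂ a₃ v = (v.2.1, v.2.2, -(a₁ • v.2.2 + a₂ • v.2.1 + a₃ • v.1)) := by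
  simp [companion]

theorem exists_companion_bound (R : ℝ) : ∃ C, ∀ a₁ a₂ a₃ : ℝ, |a₁| ≤ R → |a₂| ≤ R → |a₃| ≤ R →
    ‖companion a₁ a₂ a₃‖ ≤ C := by
  refine ⟨‖incl₀ ∘L coord₁ + incl₁ ∘L coord₂‖ + (R * ‖incl₂ ∘L coord₂‖ + R * ‖incl₂ ∘L coord₁‖ +
    R * ‖incl₂ ∘L coord₀‖), fun a₁ a₂ a₃ h1 h2 h3 => ?_⟩
  refine (norm_sub_le _ _).trans (add_le_add le_rfl ((norm_add_le _ _).trans (add_le_add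
    ((norm_add_le _ _).trans (add_le_add ?_ ?_)) ?_))) <;>
  · rw [norm_smul]
    exact mul_le_mul_of_nonneg_right (by assumption) (norm_nonneg _)

theorem exp_zero_smul_apply (T : Phase →L[ℝ] Phase) (v : Phase) :
    NormedSpace.exp ((0 : ℝ) • T) v = v := by
  rw [zero_smul ℝ T, NormedSpace.exp_zero]; rfl

theorem solvesODE_exp_companion (a₁ a₂ a₃ : ℝ) (v : Phase) :
    SolvesODE a₁ a₂ a₃ (fun t => (NormedSpace.exp (t • companion a₁ a₂ a₃) v).1)
      (fun t => (NormedSpace.exp (t • companion a₁ a₂ a₃) v).2.1)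
      (fun t => (NormedSpace.exp (t • companion a₁ a₂ a₃) v).2.2) := by
  have h : ∀ t : ℝ, HasDerivAt (fun t : ℝ => NormedSpace.exp (t • companion a₁ a₂ a₃) v)
      (companion a₁ a₂ a₃ (NormedSpace.exp (t • companion a₁ a₂ a₃) v)) t := fun t =>
    ((hasDerivAt_exp_smul_const' (companion a₁ a₂ a₃) t).clm_apply
      (hasDerivAt_const t v)).congr_deriv (by simp)
  simp only [companion_apply] at h
  exact ⟨fun t => coord₀.hasFDerivAt.comp_hasDerivAt t (h t),
    fun t => coord₁.hasFDerivAt.comp_hasDerivAt t (h t),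
    fun t => coord₂.hasFDerivAt.comp_hasDerivAt t (h t)⟩

end Companion

section Volterra

variable {α : Type*} [MeasurableSpace α] {μ : Measure α}

/-- Multiplication by a bounded real function on `L²`. -/
def lpMulReal {c : α → ℝ} (hc : Measurable c) {R : ℝ} (hR : ∀ x, |c x| ≤ R) :
    Lp ℂ 2 μ →L[ℝ] Lp ℂ 2 μ :=
  lpMul (M := fun x => c x • ContinuousLinearMap.id ℝ ℂ) (C := R)
    (hc.stronglyMeasurable.smul_const _).aestronglyMeasurable (fun x => by
      rw [norm_smul, ContinuousLinearMap.norm_id, mul_one]; exact hR x)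

theorem coeFn_lpMulReal {c : α → ℝ} (hc : Measurable c) {R : ℝ} (hR : ∀ x, |c x| ≤ R)
    (f : Lp ℂ 2 μ) : lpMulReal hc hR f =ᵐ[μ] fun x => c x • f x :=
  coeFn_lpMul _ _ f

/-- A third order linear equation with bounded multiplication operators as coefficients is solved
by the pointwise solutions. -/
theorem ae_solvesODE_of_hasDerivAt {a₁ a₂ a₃ : α → ℝ} (h₁ : Measurable a₁) (h₂ : Measurable a₂)
    (h₃ : Measurable a₃) {R : ℝ} (b₁ : ∀ x, |a₁ x| ≤ R) (b₂ : ∀ x, |a₂ x| ≤ R)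
    (b₃ : ∀ x, |a₃ x| ≤ R) {X X₁ X₂ : ℝ → Lp ℂ 2 μ} (c₀ : ContinuousOn X (Ici 0))
    (c₁ : ContinuousOn X₁ (Ici 0)) (c₂ : ContinuousOn X₂ (Ici 0))
    (d₀ : ∀ t > 0, HasDerivAt X (X₁ t) t) (d₁ : ∀ t > 0, HasDerivAt X₁ (X₂ t) t)
    (d₂ : ∀ t > 0, HasDerivAt X₂ (-(lpMulReal h₁ b₁ (X₂ t) + lpMulReal h₂ b₂ (X₁ t) +
      lpMulReal h₃ b₃ (X t))) t) {t : ℝ} (ht : 0 ≤ t) :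
    ∀ᵐ x ∂μ, ∃ y y₁ y₂ : ℝ → ℂ, SolvesODE (a₁ x) (a₂ x) (a₃ x) y y₁ y₂ ∧
      y 0 = X 0 x ∧ y₁ 0 = X₁ 0 x ∧ y₂ 0 = X₂ 0 x ∧ X t x = y t := by
  obtain ⟨C, hC⟩ := exists_companion_bound R
  have hM : AEStronglyMeasurable (fun x => companion (a₁ x) (a₂ x) (a₃ x)) μ := by
    refine StronglyMeasurable.aestronglyMeasurable ?_
    exact stronglyMeasurable_const.sub (((h₁.stronglyMeasurable.smul_const _).add
      (h₂.stronglyMeasurable.smul_const _)).add (h₃.stronglyMeasurable.smul_const _))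
  have hMC : ∀ x, ‖companion (a₁ x) (a₂ x) (a₃ x)‖ ≤ C := fun x => hC _ _ _ (b₁ x) (b₂ x) (b₃ x)
  set J₀ := incl₀.compLpL 2 μ with hJ₀
  set J₁ := incl₁.compLpL 2 μ with hJ₁
  set J₂ := incl₂.compLpL 2 μ with hJ₂
  have hJ : ∀ f g h : Lp ℂ 2 μ, ∀ᵐ x ∂μ, (J₀ f + J₁ g + J₂ h : Lp Phase 2 μ) x =
      (f x, g x, h x) := fun f g h => by
    filter_upwards [Lp.coeFn_add (J₀ f + J₁ g) (J₂ h), Lp.coeFn_add (J₀ f) (J₁ g),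
      incl₀.coeFn_compLpL f, incl₁.coeFn_compLpL g, incl₂.coeFn_compLpL h] with x e1 e2 e3 e4 e5
    rw [e1, Pi.add_apply, e2, Pi.add_apply, e3, e4, e5]
    simp
  -- The three unknowns form one vector in `L²` with values in the phase space; the third order
  -- equation becomes `V' = M V` with `M` the field of companion matrices.
  set V : ℝ → Lp Phase 2 μ := fun t => J₀ (X t) + J₁ (X₁ t) + J₂ (X₂ t) with hV
  have hVc : ContinuousOn V (Ici 0) :=
    ((J₀.continuous.comp_continuousOn c₀).add (J₁.continuous.comp_continuousOn c₁)).add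
      (J₂.continuous.comp_continuousOn c₂)
  have hVd : ∀ t > 0, HasDerivAt V (lpMul hM hMC (V t)) t := fun t ht => by
    refine (((J₀.hasFDerivAt.comp_hasDerivAt t (d₀ t ht)).add
      (J₁.hasFDerivAt.comp_hasDerivAt t (d₁ t ht))).add
      (J₂.hasFDerivAt.comp_hasDerivAt t (d₂ t ht))).congr_deriv ?_
    refine Lp.ext ?_
    filter_upwards [hJ (X₁ t) (X₂ t) (-(lpMulReal h₁ b₁ (X₂ t) + lpMulReal h₂ b₂ (X₁ t) +
      lpMulReal h₃ b₃ (X t))), hJ (X t) (X₁ t) (X₂ t), coeFn_lpMul hM hMC (V t),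
      Lp.coeFn_neg (lpMulReal h₁ b₁ (X₂ t) + lpMulReal h₂ b₂ (X₁ t) + lpMulReal h₃ b₃ (X t)),
      Lp.coeFn_add (lpMulReal h₁ b₁ (X₂ t) + lpMulReal h₂ b₂ (X₁ t)) (lpMulReal h₃ b₃ (X t)),
      Lp.coeFn_add (lpMulReal h₁ b₁ (X₂ t)) (lpMulReal h₂ b₂ (X₁ t)),
      coeFn_lpMulReal h₁ b₁ (X₂ t), coeFn_lpMulReal h₂ b₂ (X₁ t), coeFn_lpMulReal h₃ b₃ (X t)]
      with x e1 e2 e3 e4 e5 e6 e7 e8 e9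
    rw [e1, e3, e4, Pi.neg_apply, e5, Pi.add_apply, e6, Pi.add_apply, e7, e8, e9]
    simp only [hV]
    rw [e2, companion_apply]
  have key := eq_exp_smul_apply (lpMul hM hMC) hVc hVd ht
  filter_upwards [hJ (X t) (X₁ t) (X₂ t), hJ (X 0) (X₁ 0) (X₂ 0),
    coeFn_exp_lpMul hM hMC t (V 0)] with x e1 e2 e3
  refine ⟨_, _, _, solvesODE_exp_companion (a₁ x) (a₂ x) (a₃ x) (V 0 x), ?_, ?_, ?_, ?_⟩
  · simp only [exp_zero_smul_apply, hV]; rw [e2]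
  · simp only [exp_zero_smul_apply, hV]; rw [e2]
  · simp only [exp_zero_smul_apply, hV]; rw [e2]
  · rw [← e3, ← key]
    simp only [hV]
    rw [e1]

/-- The hypothesis `hvol` is the ODE integrated three times, with the initial values collected in
the polynomial in `t`. It asks for no time derivative of `Ψ`. Where the coefficients are bounded the
identity itself supplies the derivatives, since `Ψ` equals a polynomial minus bounded operators
applied to differentiable primitives. -/
theorem ae_solvesODE_of_volterra {a b c : α → ℝ} (ha : Measurable a) (hb : Measurable b)
    (hc : Measurable c) {Ψ I₁ I₂ I₃ : ℝ → Lp ℂ 2 μ} {f₀ f₁ f₂ : Lp ℂ 2 μ}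
    (c₁ : ContinuousOn I₁ (Ici 0)) (c₂ : ContinuousOn I₂ (Ici 0)) (c₃ : ContinuousOn I₃ (Ici 0))
    (z₁ : I₁ 0 = 0) (z₂ : I₂ 0 = 0) (z₃ : I₃ 0 = 0)
    (d₁ : ∀ t > 0, HasDerivAt I₁ (Ψ t) t) (d₂ : ∀ t > 0, HasDerivAt I₂ (I₁ t) t)
    (d₃ : ∀ t > 0, HasDerivAt I₃ (I₂ t) t)
    (hvol : ∀ t, 0 ≤ t → ∀ᵐ x ∂μ, Ψ t x + a x • I₁ t x + b x • I₂ t x + c x • I₃ t x =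
      f₀ x + t • (f₁ x + a x • f₀ x) + (t ^ 2 / 2) • (f₂ x + a x • f₁ x + b x • f₀ x))
    {t : ℝ} (ht : 0 ≤ t) :
    ∀ᵐ x ∂μ, ∃ y y₁ y₂ : ℝ → ℂ, SolvesODE (a x) (b x) (c x) y y₁ y₂ ∧
      y 0 = f₀ x ∧ y₁ 0 = f₁ x ∧ y₂ 0 = f₂ x ∧ Ψ t x = y t := by
  suffices H : ∀ N : ℕ, ∀ᵐ x ∂μ, (|a x| ≤ N ∧ |b x| ≤ N ∧ |c x| ≤ N) →
      ∃ y y₁ y₂ : ℝ → ℂ, SolvesODE (a x) (b x) (c x) y y₁ y₂ ∧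
      y 0 = f₀ x ∧ y₁ 0 = f₁ x ∧ y₂ 0 = f₂ x ∧ Ψ t x = y t by
    filter_upwards [ae_all_iff.2 H] with x hx
    obtain ⟨N, hN⟩ := exists_nat_ge (max |a x| (max |b x| |c x|))
    exact hx N ⟨(le_max_left _ _).trans hN, ((le_max_left _ _).trans (le_max_right _ _)).trans hN,
      ((le_max_right _ _).trans (le_max_right _ _)).trans hN⟩
  intro N
  -- These sets exhaust the whole space as `N` grows. Multiplication by the indicator of `S` is `P`;
  -- the truncated coefficients vanish off `S`, so their operators absorb `P`.
  set S : Set α := {x | |a x| ≤ N ∧ |b x| ≤ N ∧ |c x| ≤ N} with hS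
  have hSm : MeasurableSet S := by
    have : ∀ {f : α → ℝ}, Measurable f → MeasurableSet {x | |f x| ≤ N} := fun hf =>
      measurableSet_le (continuous_abs.measurable.comp hf) measurable_const
    exact (this ha).inter ((this hb).inter (this hc))
  have bd : ∀ {f : α → ℝ}, (∀ x ∈ S, |f x| ≤ N) → ∀ x, |S.indicator f x| ≤ (N : ℝ) + 1 :=
    fun hf x => by
      by_cases hx : x ∈ S
      · rw [indicator_of_mem hx]; linarith [hf x hx]
      · rw [indicator_of_notMem hx, abs_zero]; positivity
  have bp : ∀ x, |S.indicator (fun _ => (1 : ℝ)) x| ≤ (N : ℝ) + 1 := fun x => by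
    by_cases hx : x ∈ S
    · rw [indicator_of_mem hx, abs_one]; linarith [(Nat.cast_nonneg N : (0 : ℝ) ≤ N)]
    · rw [indicator_of_notMem hx, abs_zero]; positivity
  have ba := bd (f := a) fun x hx => hx.1
  have bb := bd (f := b) fun x hx => hx.2.1
  have bc := bd (f := c) fun x hx => hx.2.2
  have ma := ha.indicator hSm
  have mb := hb.indicator hSm
  have mc := hc.indicator hSm
  have mp : Measurable (S.indicator (fun _ => (1 : ℝ))) := measurable_const.indicator hSm
  have eA := fun f : Lp ℂ 2 μ => coeFn_lpMulReal ma ba f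
  have eB := fun f : Lp ℂ 2 μ => coeFn_lpMulReal mb bb f
  have eC := fun f : Lp ℂ 2 μ => coeFn_lpMulReal mc bc f
  have eP := fun f : Lp ℂ 2 μ => coeFn_lpMulReal mp bp f
  set A : Lp ℂ 2 μ →L[ℝ] Lp ℂ 2 μ := lpMulReal ma ba with hA
  set B : Lp ℂ 2 μ →L[ℝ] Lp ℂ 2 μ := lpMulReal mb bb with hB
  set D : Lp ℂ 2 μ →L[ℝ] Lp ℂ 2 μ := lpMulReal mc bc with hD
  set P : Lp ℂ 2 μ →L[ℝ] Lp ℂ 2 μ := lpMulReal mp bp with hP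
  have absorb : ∀ (T : Lp ℂ 2 μ →L[ℝ] Lp ℂ 2 μ) (f : α → ℝ),
      (∀ h, T h =ᵐ[μ] fun x => S.indicator f x • h x) → ∀ h, T (P h) = T h := fun T f hT h => by
    refine Lp.ext ?_
    filter_upwards [hT (P h), hT h, eP h] with x e1 e2 e3
    rw [e1, e2, e3]
    by_cases hx : x ∈ S <;> simp [hx]
  have aA := absorb A a eA
  have aB := absorb B b eB
  have aD := absorb D c eC
  -- `X` is `P Ψ` solved from the Volterra identity. Its derivative contains `A (Ψ t) = A (P (Ψ t))
  -- = A (X t)`, which is why `X₁` and `X₂` can again be written through quantities already known to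
  -- be differentiable.
  set X : ℝ → Lp ℂ 2 μ := fun t => (P f₀ + t • (P f₁ + A f₀) + (t ^ 2 / 2) • (P f₂ + A f₁ + B f₀))
    - (A (I₁ t) + B (I₂ t) + D (I₃ t)) with hX
  have hXP : ∀ t, 0 ≤ t → X t = P (Ψ t) := fun t ht => by
    have h1 : P f₀ + t • (P f₁ + A f₀) + (t ^ 2 / 2) • (P f₂ + A f₁ + B f₀) =
        P (Ψ t) + (A (I₁ t) + B (I₂ t) + D (I₃ t)) := by
      refine Lp.ext ?_
      filter_upwards [hvol t ht, eA f₀, eA f₁, eB f₀, eP f₀, eP f₁, eP f₂, eP (Ψ t), eA (I₁ t),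
        eB (I₂ t), eC (I₃ t),
        Lp.coeFn_add (P f₀ + t • (P f₁ + A f₀)) ((t ^ 2 / 2) • (P f₂ + A f₁ + B f₀)),
        Lp.coeFn_add (P f₀) (t • (P f₁ + A f₀)), Lp.coeFn_smul t (P f₁ + A f₀),
        Lp.coeFn_add (P f₁) (A f₀), Lp.coeFn_smul (t ^ 2 / 2) (P f₂ + A f₁ + B f₀),
        Lp.coeFn_add (P f₂ + A f₁) (B f₀), Lp.coeFn_add (P f₂) (A f₁),
        Lp.coeFn_add (P (Ψ t)) (A (I₁ t) + B (I₂ t) + D (I₃ t)),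
        Lp.coeFn_add (A (I₁ t) + B (I₂ t)) (D (I₃ t)), Lp.coeFn_add (A (I₁ t)) (B (I₂ t))]
        with x k0 k1 k2 k3 k4 k5 k6 k7 k8 k9 k10 k11 k12 k13 k14 k15 k16 k17 k18 k19 k20
      rw [k11, Pi.add_apply, k12, Pi.add_apply, k13, Pi.smul_apply, k14, Pi.add_apply, k15,
        Pi.smul_apply, k16, Pi.add_apply, k17, Pi.add_apply, k18, Pi.add_apply, k19, Pi.add_apply,
        k20, Pi.add_apply, k1, k2, k3, k4, k5, k6, k7, k8, k9, k10]
      by_cases hx : x ∈ S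
      · simp only [indicator_of_mem hx, one_smul]
        rw [← k0]; abel
      · simp [hx]
    simp only [hX]
    rw [h1]; abel
  set X₁ : ℝ → Lp ℂ 2 μ := fun t => ((P f₁ + A f₀) + t • (P f₂ + A f₁ + B f₀))
    - (A (X t) + B (I₁ t) + D (I₂ t)) with hX₁
  set X₂ : ℝ → Lp ℂ 2 μ := fun t => (P f₂ + A f₁ + B f₀)
    - (A (X₁ t) + B (X t) + D (I₁ t)) with hX₂
  have hcl : ∀ (T : Lp ℂ 2 μ →L[ℝ] Lp ℂ 2 μ) {I : ℝ → Lp ℂ 2 μ}, ContinuousOn I (Ici 0) →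
      ContinuousOn (fun t => T (I t)) (Ici 0) := fun T I hI => T.continuous.comp_continuousOn hI
  have hdl : ∀ (T : Lp ℂ 2 μ →L[ℝ] Lp ℂ 2 μ) {I : ℝ → Lp ℂ 2 μ} {I' : Lp ℂ 2 μ} {t : ℝ},
      HasDerivAt I I' t → HasDerivAt (fun t => T (I t)) (T I') t :=
    fun T I I' t hI => T.hasFDerivAt.comp_hasDerivAt t hI
  have cX : ContinuousOn X (Ici 0) :=
    ContinuousOn.sub (by fun_prop) (((hcl A c₁).add (hcl B c₂)).add (hcl D c₃))
  have cX₁ : ContinuousOn X₁ (Ici 0) :=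
    ContinuousOn.sub (by fun_prop) (((hcl A cX).add (hcl B c₁)).add (hcl D c₂))
  have cX₂ : ContinuousOn X₂ (Ici 0) :=
    ContinuousOn.sub (by fun_prop) (((hcl A cX₁).add (hcl B cX)).add (hcl D c₁))
  have sq : ∀ t : ℝ, HasDerivAt (fun t : ℝ => t ^ 2 / 2) t t := fun t =>
    (((hasDerivAt_id t).pow 2).div_const 2).congr_deriv (by simp)
  have dX : ∀ t > 0, HasDerivAt X (X₁ t) t := fun t ht => by
    refine ((((hasDerivAt_const t (P f₀)).add ((hasDerivAt_id t).smul_const (P f₁ + A f₀))).add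
      ((sq t).smul_const (P f₂ + A f₁ + B f₀))).sub
      (((hdl A (d₁ t ht)).add (hdl B (d₂ t ht))).add (hdl D (d₃ t ht)))).congr_deriv ?_
    simp only [hX₁]
    rw [hXP t ht.le, aA]
    simp
  have dX₁ : ∀ t > 0, HasDerivAt X₁ (X₂ t) t := fun t ht => by
    refine (((hasDerivAt_const t (P f₁ + A f₀)).add
      ((hasDerivAt_id t).smul_const (P f₂ + A f₁ + B f₀))).sub
      (((hdl A (dX t ht)).add (hdl B (d₁ t ht))).add (hdl D (d₂ t ht)))).congr_deriv ?_
    simp only [hX₂]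
    rw [hXP t ht.le, aB]
    simp
  have dX₂ : ∀ t > 0, HasDerivAt X₂ (-(A (X₂ t) + B (X₁ t) + D (X t))) t := fun t ht => by
    refine ((hasDerivAt_const t (P f₂ + A f₁ + B f₀)).sub
      (((hdl A (dX₁ t ht)).add (hdl B (dX t ht))).add (hdl D (d₁ t ht)))).congr_deriv ?_
    rw [hXP t ht.le, aD]
    simp
  have v₀ : X 0 = P f₀ := by simp [hX, z₁, z₂, z₃]
  have v₁ : X₁ 0 = P f₁ := by simp [hX₁, z₁, z₂, v₀, aA]
  have v₂ : X₂ 0 = P f₂ := by simp only [hX₂, z₁, v₀, v₁, aA, aB, map_zero]; abel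
  filter_upwards [ae_solvesODE_of_hasDerivAt ma mb mc ba bb bc cX cX₁ cX₂ dX dX₁ dX₂ ht, eP f₀, eP f₁,
    eP f₂, eP (Ψ t)] with x hx k0 k1 k2 k3 hxS
  obtain ⟨y, y₁, y₂, g1, g2, g3, g4, g5⟩ := hx
  have hxS' : x ∈ S := hxS
  rw [v₀, k0] at g2
  rw [v₁, k1] at g3
  rw [v₂, k2] at g4
  rw [hXP t ht, k3] at g5
  simp only [indicator_of_mem hxS', one_smul] at g1 g2 g3 g4 g5
  exact ⟨y, y₁, y₂, g1, g2, g3, g4, g5⟩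

end Volterra

/-! ### The distributional equation on the Fourier side -/

variable {n : ℕ}

/-- The angular frequency `2π|ξ|`. -/
def freq (ξ : Space n) : ℝ := 2 * Real.pi * ‖ξ‖

/-- Multiplication of Schwartz functions by the symbol of `-Δ`. -/
def mulFreqSq : 𝓢(Space n, ℂ) →L[ℂ] 𝓢(Space n, ℂ) :=
  SchwartzMap.smulLeftCLM ℂ (fun ξ : Space n => ((freq ξ ^ 2 : ℝ) : ℂ))

theorem hasTemperateGrowth_freq_sq :
    Function.HasTemperateGrowth (fun ξ : Space n => ((freq ξ ^ 2 : ℝ) : ℂ)) := by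
  have : (fun ξ : Space n => ((freq ξ ^ 2 : ℝ) : ℂ)) =
      fun ξ : Space n => ((2 * Real.pi) ^ 2 : ℂ) * Complex.ofReal (‖ξ‖ ^ 2) := by
    ext ξ; simp [freq]; ring
  rw [this]
  fun_prop

theorem mulFreqSq_apply (g : 𝓢(Space n, ℂ)) (ξ : Space n) :
    mulFreqSq g ξ = (freq ξ ^ 2 : ℝ) * g ξ :=
  SchwartzMap.smulLeftCLM_apply_apply hasTemperateGrowth_freq_sq g ξ

/-- Testing against `𝓕 g` instead of `g` makes every Laplacian a multiplication by `freq²` on the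
test function; the sign is that of the symbol of `Δ`. -/
theorem laplacian_apply_fourier (T : 𝓢'(Space n, ℂ)) (g : 𝓢(Space n, ℂ)) :
    (Δ T) (𝓕 g) = -T (𝓕 (mulFreqSq g)) := by
  rw [TemperedDistribution.laplacian_eq_fourierMultiplierCLM,
    TemperedDistribution.fourierMultiplierCLM_apply]
  have h : mulFreqSq g = ((2 * Real.pi) ^ 2 : ℂ) •
      SchwartzMap.smulLeftCLM ℂ (fun ξ : Space n => Complex.ofReal (‖ξ‖ ^ 2)) g := by
    ext ξ
    rw [mulFreqSq_apply, smul_apply,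
      SchwartzMap.smulLeftCLM_apply_apply (by fun_prop)]
    simp [freq]; ring
  have h2 : ∀ (c : ℝ) (S : 𝓢'(Space n, ℂ)) (φ : 𝓢(Space n, ℂ)), (c • S) φ = c • S φ :=
    fun _ _ _ => rfl
  rw [h, FourierTransform.fourier_smul, map_smul, h2, TemperedDistribution.fourierInv_apply,
    FourierTransform.fourierInv_fourier_eq, TemperedDistribution.smulLeftCLM_apply_apply,
    TemperedDistribution.fourier_apply, Complex.real_smul, smul_eq_mul]
  push_cast
  ring

/-- The pairing `f ↦ ∫ g f` of `L²` with a Schwartz function. -/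
def pairing (g : 𝓢(Space n, ℂ)) : L2 n →L[ℂ] ℂ :=
  PointwiseConvergenceCLM.evalCLM _ _ g ∘L Lp.toTemperedDistributionCLM ℂ volume 2

theorem pairing_eq_coe (g : 𝓢(Space n, ℂ)) (f : L2 n) : pairing g f = (f : 𝓢'(Space n, ℂ)) g := rfl

theorem pairing_apply (g : 𝓢(Space n, ℂ)) (f : L2 n) : pairing g f = ∫ ξ, g ξ * f ξ := by
  rw [pairing_eq_coe, Lp.toTemperedDistribution_apply]; rfl

theorem coe_apply_fourier (f : L2 n) (g : 𝓢(Space n, ℂ)) :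
    (f : 𝓢'(Space n, ℂ)) (𝓕 g) = pairing g (𝓕 f) := by
  rw [pairing_eq_coe, ← Lp.fourier_toTemperedDistribution_eq, TemperedDistribution.fourier_apply]

theorem ae_eq_of_pairing {f h : Space n → ℂ} (hf : LocallyIntegrable f volume)
    (hh : LocallyIntegrable h volume)
    (H : ∀ g : 𝓢(Space n, ℂ), ∫ ξ, g ξ * f ξ = ∫ ξ, g ξ * h ξ) : f =ᵐ[volume] h := by
  refine ae_eq_of_integral_contDiff_smul_eq hf hh fun g hg hgc => ?_
  have hg₁ : HasCompactSupport (Complex.ofRealCLM ∘ g) := hgc.comp_left rfl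
  have hg₂ : ContDiff ℝ (⊤ : ℕ∞) (Complex.ofRealCLM ∘ g) := by fun_prop
  exact H (hg₁.toSchwartzMap hg₂)

/-- `F` can be paired with `g`, with the result `z`. -/
def PairsTo (g : 𝓢(Space n, ℂ)) (F : Space n → ℂ) (z : ℂ) : Prop :=
  Integrable (fun ξ => g ξ * F ξ) ∧ ∫ ξ, g ξ * F ξ = z

theorem PairsTo.add {g : 𝓢(Space n, ℂ)} {F G : Space n → ℂ} {z w : ℂ} (hF : PairsTo g F z)
    (hG : PairsTo g G w) : PairsTo g (fun ξ => F ξ + G ξ) (z + w) := by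
  refine ⟨?_, ?_⟩
  · simpa only [mul_add] using! hF.1.add hG.1
  · simp only [mul_add]
    rw [integral_add hF.1 hG.1, hF.2, hG.2]

theorem PairsTo.smul {g : 𝓢(Space n, ℂ)} {F : Space n → ℂ} {z : ℂ} (c : ℝ) (hF : PairsTo g F z) :
    PairsTo g (fun ξ => c • F ξ) (c * z) := by
  have : ∀ ξ, g ξ * (c • F ξ) = (c : ℂ) * (g ξ * F ξ) := fun ξ => by
    rw [Complex.real_smul]; ring
  refine ⟨?_, ?_⟩
  · simp only [this]; exact hF.1.const_mul _
  · simp only [this]; rw [integral_const_mul, hF.2]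

theorem pairsTo_pairing (g : 𝓢(Space n, ℂ)) (f : L2 n) : PairsTo g f (pairing g f) := by
  refine ⟨?_, (pairing_apply g f).symm⟩
  have h : MemLp g 2 (volume : Measure (Space n)) := g.memLp 2 volume
  exact h.integrable_mul (Lp.memLp f)

/-- Multiplication by `freq²` may lead out of `L²`; moving the weight onto the Schwartz function
keeps the pairing integrable. -/
theorem PairsTo.freq_sq {g : 𝓢(Space n, ℂ)} {F : Space n → ℂ} {z : ℂ}
    (h : PairsTo (mulFreqSq g) F z) : PairsTo g (fun ξ => (freq ξ ^ 2) • F ξ) z := by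
  have : ∀ ξ, g ξ * ((freq ξ ^ 2) • F ξ) = mulFreqSq g ξ * F ξ := fun ξ => by
    rw [mulFreqSq_apply, Complex.real_smul]; ring
  unfold PairsTo
  simp only [this]
  exact h

theorem continuous_freq : Continuous (freq (n := n)) := by unfold freq; fun_prop

theorem locallyIntegrable_coeFn (f : L2 n) : LocallyIntegrable f volume :=
  (Lp.memLp f).locallyIntegrable (by norm_num)

theorem locallyIntegrable_smul {c : Space n → ℝ} (hc : Continuous c) {F : Space n → ℂ}
    (hF : LocallyIntegrable F volume) : LocallyIntegrable (fun ξ => c ξ • F ξ) volume :=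
  hF.continuous_smul hc

theorem exists_primitive {F : Type*} [NormedAddCommGroup F] [NormedSpace ℝ F] [CompleteSpace F]
    {f : ℝ → F} (hf : ContinuousOn f (Ici 0)) :
    ∃ I : ℝ → F, ContinuousOn I (Ici 0) ∧ I 0 = 0 ∧ ∀ t > 0, HasDerivAt I (f t) t := by
  -- The constant extension to negative times is continuous on the whole line, so the fundamental
  -- theorem of calculus applies at every point.
  have hc : Continuous (fun t => f (max t 0)) :=
    hf.comp_continuous (by fun_prop) fun t => mem_Ici.2 (le_max_right _ _)
  have hd : ∀ t, HasDerivAt (fun t => ∫ s in (0 : ℝ)..t, f (max s 0)) (f (max t 0)) t := fun t =>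
    intervalIntegral.integral_hasDerivAt_right (hc.intervalIntegrable _ _)
      (hc.stronglyMeasurableAtFilter _ _) hc.continuousAt
  refine ⟨fun t => ∫ s in (0 : ℝ)..t, f (max s 0),
    fun t _ => (hd t).continuousAt.continuousWithinAt, intervalIntegral.integral_same,
    fun t ht => ?_⟩
  have := hd t
  rwa [max_eq_left ht.le] at this

/-- The tested equation is integrated in time three times, each time by exhibiting a quantity with
zero derivative for `t > 0` that is continuous at `0`. The outcome involves only pairings of `L²`
functions with `g`, and as `g` is arbitrary it yields the Volterra identity almost everywhere. -/
theorem IsSolution.ae_solvesODE {b ν γ κ : ℝ} {ψ₀ ψ₁ ψ₂ : L2 n} {ψ : ℝ → L2 n}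
    (h : IsSolution b ν γ κ ψ₀ ψ₁ ψ₂ ψ) {δ e : ℝ} (hδ : δ = soundDiffusivity b ν γ κ)
    (he : e = κ * δ + κ * (γ - 1) * (b * ν - κ)) {t : ℝ} (ht : 0 ≤ t) :
    ∀ᵐ ξ : Space n, ∃ y y₁ y₂ : ℝ → ℂ,
      SolvesODE ((δ + κ) * freq ξ ^ 2) (freq ξ ^ 2 + e * freq ξ ^ 4) (κ * freq ξ ^ 4) y y₁ y₂ ∧
      y 0 = (𝓕 ψ₀ : L2 n) ξ ∧ y₁ 0 = (𝓕 ψ₁ : L2 n) ξ ∧ y₂ 0 = (𝓕 ψ₂ : L2 n) ξ ∧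
      (𝓕 (ψ t) : L2 n) ξ = y t := by
  obtain ⟨hψ, u, w, hu, hw, hψu, huw, heq, h0, h1, h2⟩ := h
  set Ψ : ℝ → L2 n := fun t => 𝓕 (ψ t) with hΨ
  have hΨc : ContinuousOn Ψ (Ici 0) :=
    (Lp.fourierTransformₗᵢ (Space n) ℂ).continuous.comp_continuousOn hψ
  obtain ⟨I₁, c₁, z₁, d₁⟩ := exists_primitive hΨc
  obtain ⟨I₂, c₂, z₂, d₂⟩ := exists_primitive c₁
  obtain ⟨I₃, c₃, z₃, d₃⟩ := exists_primitive c₂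
  have hpc : ∀ (g : 𝓢(Space n, ℂ)) {I : ℝ → L2 n}, ContinuousOn I (Ici 0) →
      ContinuousOn (fun t => pairing g (I t)) (Ici 0) := fun g I hI =>
    (pairing g).continuous.comp_continuousOn hI
  have hpd : ∀ (g : 𝓢(Space n, ℂ)) {I : ℝ → L2 n} {I' : L2 n} {t : ℝ}, HasDerivAt I I' t →
      HasDerivAt (fun t => pairing g (I t)) (pairing g I') t := fun g I I' t hI =>
    ((pairing g).restrictScalars ℝ).hasFDerivAt.comp_hasDerivAt t hI
  set R : 𝓢(Space n, ℂ) → 𝓢(Space n, ℂ) := fun g => mulFreqSq g with hR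
  have hY : ∀ (g : 𝓢(Space n, ℂ)), ∀ t > 0,
      HasDerivAt (fun s => pairing g (Ψ s)) (u t (𝓕 g)) t := fun g t ht => by
    simpa only [coe_apply_fourier] using hψu (𝓕 g) t ht
  have hU : ∀ (g : 𝓢(Space n, ℂ)), ∀ t > 0,
      HasDerivAt (fun s => u s (𝓕 g)) (w t (𝓕 g)) t := fun g t ht => huw (𝓕 g) t ht
  have hq : ∀ (g : 𝓢(Space n, ℂ)), ∀ t > 0,
      HasDerivAt (fun s => w s (𝓕 g) + pairing (R g) (Ψ s) + (δ : ℂ) * u s (𝓕 (R g)))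
        (-(κ * (w t (𝓕 (R g)) + pairing (R (R g)) (Ψ t) + (δ : ℂ) * u t (𝓕 (R (R g)))))
          - ((κ * (γ - 1) * (b * ν - κ) : ℝ) : ℂ) * u t (𝓕 (R (R g)))) t := fun g t ht => by
    obtain ⟨q', hq', e'⟩ := heq (𝓕 g) t ht
    have hqs : ∀ (g : 𝓢(Space n, ℂ)) (s : ℝ), (w s - Δ (ψ s : 𝓢'(Space n, ℂ)) -
        (soundDiffusivity b ν γ κ : ℂ) • Δ (u s)) (𝓕 g) =
        w s (𝓕 g) + pairing (R g) (Ψ s) + (δ : ℂ) * u s (𝓕 (R g)) := fun g s => by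
      change w s (𝓕 g) - (Δ (ψ s : 𝓢'(Space n, ℂ))) (𝓕 g) -
        (soundDiffusivity b ν γ κ : ℂ) * (Δ (u s)) (𝓕 g) = _
      rw [laplacian_apply_fourier, laplacian_apply_fourier, coe_apply_fourier, hδ]
      ring
    rw [laplacian_apply_fourier, laplacian_apply_fourier, laplacian_apply_fourier] at e'
    simp only [hqs] at hq'
    rw [hqs] at e'
    refine hq'.congr_deriv ?_
    linear_combination e'
  have hvol : ∀ t, 0 ≤ t → ∀ᵐ ξ : Space n, Ψ t ξ + ((δ + κ) * freq ξ ^ 2) • I₁ t ξ +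
      (freq ξ ^ 2 + e * freq ξ ^ 4) • I₂ t ξ + (κ * freq ξ ^ 4) • I₃ t ξ =
      (𝓕 ψ₀ : L2 n) ξ + t • ((𝓕 ψ₁ : L2 n) ξ + ((δ + κ) * freq ξ ^ 2) • (𝓕 ψ₀ : L2 n) ξ) +
      (t ^ 2 / 2) • ((𝓕 ψ₂ : L2 n) ξ + ((δ + κ) * freq ξ ^ 2) • (𝓕 ψ₁ : L2 n) ξ +
        (freq ξ ^ 2 + e * freq ξ ^ 4) • (𝓕 ψ₀ : L2 n) ξ) := by
    intro t ht
    have m := continuous_freq (n := n)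
    have l := locallyIntegrable_coeFn (n := n)
    refine ae_eq_of_pairing (((l _).add (locallyIntegrable_smul (by fun_prop) (l _))).add
      (locallyIntegrable_smul (by fun_prop) (l _)) |>.add (locallyIntegrable_smul (by fun_prop) (l _)))
      (((l _).add (((l _).add (locallyIntegrable_smul (by fun_prop) (l _))).smul t)).add
      ((((l _).add (locallyIntegrable_smul (by fun_prop) (l _))).add
        (locallyIntegrable_smul (by fun_prop) (l _))).smul (t ^ 2 / 2))) fun g => ?_
    have P := fun f : L2 n => pairsTo_pairing g f
    have P2 := fun f : L2 n => (pairsTo_pairing (R g) f).freq_sq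
    have P4 := fun f : L2 n => (pairsTo_pairing (R (R g)) f).freq_sq.freq_sq
    have lhs := (((P (Ψ t)).add ((P2 (I₁ t)).smul (δ + κ))).add ((P2 (I₂ t)).add
      ((P4 (I₂ t)).smul e))).add ((P4 (I₃ t)).smul κ)
    have rhs := ((P (𝓕 ψ₀)).add (((P (𝓕 ψ₁)).add ((P2 (𝓕 ψ₀)).smul (δ + κ))).smul t)).add
      ((((P (𝓕 ψ₂)).add ((P2 (𝓕 ψ₁)).smul (δ + κ))).add ((P2 (𝓕 ψ₀)).add
      ((P4 (𝓕 ψ₀)).smul e))).smul (t ^ 2 / 2))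
    have i₀ : Ψ 0 = 𝓕 ψ₀ := by simp only [hΨ, h0]
    set C₂ : ℂ := pairing g (𝓕 ψ₂) + (δ + κ : ℝ) * pairing (R g) (𝓕 ψ₁) + (pairing (R g) (𝓕 ψ₀)
      + e * pairing (R (R g)) (𝓕 ψ₀)) with hC₂
    set C₁ : ℂ := pairing g (𝓕 ψ₁) + (δ + κ : ℝ) * pairing (R g) (𝓕 ψ₀) with hC₁
    -- First integration. Only the combination `w - Δψ - δΔu` is known to be differentiable, so it
    -- stays together in the bracket; the choice of `e` cancels the terms with `Δ²u`.
    have s1 : ∀ s, 0 ≤ s → (w s (𝓕 g) + pairing (R g) (Ψ s) + (δ : ℂ) * u s (𝓕 (R g)))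
        + κ * u s (𝓕 (R g)) + e * pairing (R (R g)) (Ψ s) + κ * pairing (R (R g)) (I₁ s) = C₂ :=
        fun s hs => by
      have := eq_zero_value_of_hasDerivAt_zero
        (f := fun s => (w s (𝓕 g) + pairing (R g) (Ψ s) + (δ : ℂ) * u s (𝓕 (R g)))
          + κ * u s (𝓕 (R g)) + e * pairing (R (R g)) (Ψ s) + κ * pairing (R (R g)) (I₁ s))
        (((((hw _).add (hpc _ hΨc)).add ((hu _).const_mul _)).add ((hu _).const_mul _)).add
          ((hpc _ hΨc).const_mul _) |>.add ((hpc _ c₁).const_mul _))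
        (fun s hs => ((((hq g s hs).add ((hU (R g) s hs).const_mul (κ : ℂ))).add
          ((hY (R (R g)) s hs).const_mul (e : ℂ))).add
          ((hpd (R (R g)) (d₁ s hs)).const_mul (κ : ℂ))).congr_deriv (by
            rw [he]; push_cast; ring)) hs
      refine this.trans ?_
      simp only [h1, h2, i₀, z₁, coe_apply_fourier, map_zero]
      rw [hC₂]; push_cast; ring
    -- Second integration; `s1` supplies the derivative of the bracket as the constant `C₂`.
    have s2 : ∀ s, 0 ≤ s → u s (𝓕 g) + (δ + κ : ℝ) * pairing (R g) (Ψ s) + pairing (R g) (I₁ s)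
        + e * pairing (R (R g)) (I₁ s) + κ * pairing (R (R g)) (I₂ s) - s * C₂ = C₁ :=
        fun s hs => by
      have hid : ∀ s : ℝ, HasDerivAt (fun s : ℝ => (s : ℂ) * C₂) C₂ s := fun s =>
        (Complex.ofRealCLM.hasDerivAt.mul_const C₂).congr_deriv (by simp)
      have := eq_zero_value_of_hasDerivAt_zero
        (f := fun s => u s (𝓕 g) + (δ + κ : ℝ) * pairing (R g) (Ψ s) + pairing (R g) (I₁ s)
        + e * pairing (R (R g)) (I₁ s) + κ * pairing (R (R g)) (I₂ s) - s * C₂)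
        ((((((hu _).add ((hpc _ hΨc).const_mul _)).add (hpc _ c₁)).add ((hpc _ c₁).const_mul _)).add
          ((hpc _ c₂).const_mul _)).sub (fun s _ => (hid s).continuousAt.continuousWithinAt))
        (fun s hs => (((((((hU g s hs).add ((hY (R g) s hs).const_mul _)).add
          (hpd (R g) (d₁ s hs))).add ((hpd (R (R g)) (d₁ s hs)).const_mul _)).add
          ((hpd (R (R g)) (d₂ s hs)).const_mul _)).sub (hid s))).congr_deriv (by
            rw [← s1 s hs.le]; push_cast; ring)) hs
      refine this.trans ?_
      simp only [h1, i₀, z₁, z₂, coe_apply_fourier, map_zero]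
      rw [hC₁]; push_cast; ring
    -- Third integration: neither `u` nor `w` occurs any more.
    have s3 : ∀ s, 0 ≤ s → pairing g (Ψ s) + (δ + κ : ℝ) * pairing (R g) (I₁ s) +
        pairing (R g) (I₂ s) + e * pairing (R (R g)) (I₂ s) + κ * pairing (R (R g)) (I₃ s)
        - s * C₁ - ((s ^ 2 / 2 : ℝ) : ℂ) * C₂ = pairing g (𝓕 ψ₀) := fun s hs => by
      have hid : ∀ s : ℝ, HasDerivAt (fun s : ℝ => (s : ℂ) * C₁) C₁ s := fun s =>
        (Complex.ofRealCLM.hasDerivAt.mul_const C₁).congr_deriv (by simp)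
      have hsq : ∀ s : ℝ, HasDerivAt (fun s : ℝ => ((s ^ 2 / 2 : ℝ) : ℂ) * C₂) (s * C₂) s := fun s =>
        ((((hasDerivAt_id s).pow 2).div_const 2).ofReal_comp.mul_const C₂).congr_deriv (by simp)
      have := eq_zero_value_of_hasDerivAt_zero
        (f := fun s => pairing g (Ψ s) + (δ + κ : ℝ) * pairing (R g) (I₁ s) +
        pairing (R g) (I₂ s) + e * pairing (R (R g)) (I₂ s) + κ * pairing (R (R g)) (I₃ s)
        - s * C₁ - ((s ^ 2 / 2 : ℝ) : ℂ) * C₂)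
        (((((((hpc _ hΨc).add ((hpc _ c₁).const_mul _)).add (hpc _ c₂)).add
          ((hpc _ c₂).const_mul _)).add ((hpc _ c₃).const_mul _)).sub
          (fun s _ => (hid s).continuousAt.continuousWithinAt)).sub
          (fun s _ => (hsq s).continuousAt.continuousWithinAt))
        (fun s hs => ((((((((hY g s hs).add ((hpd (R g) (d₁ s hs)).const_mul _)).add
          (hpd (R g) (d₂ s hs))).add ((hpd (R (R g)) (d₂ s hs)).const_mul _)).add
          ((hpd (R (R g)) (d₃ s hs)).const_mul _)).sub (hid s)).sub (hsq s))).congr_deriv (by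
            rw [← s2 s hs.le]; push_cast; ring)) hs
      refine this.trans ?_
      simp only [i₀, z₁, z₂, z₃, map_zero]
      push_cast; ring
    have e1 : ∀ ξ (f : L2 n), (freq ξ ^ 2 + e * freq ξ ^ 4) • f ξ =
        freq ξ ^ 2 • f ξ + e • (freq ξ ^ 2 • freq ξ ^ 2 • f ξ) := fun ξ f => by
      rw [add_smul, smul_smul, smul_smul]; congr 2; ring
    have e2 : ∀ ξ (f : L2 n), (κ * freq ξ ^ 4) • f ξ = κ • (freq ξ ^ 2 • freq ξ ^ 2 • f ξ) :=
      fun ξ f => by rw [smul_smul, smul_smul]; congr 1; ring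
    have e3 : ∀ ξ (f : L2 n), ((δ + κ) * freq ξ ^ 2) • f ξ = (δ + κ) • (freq ξ ^ 2 • f ξ) :=
      fun ξ f => by rw [smul_smul]
    simp only [e1, e2, e3]
    refine lhs.2.trans (Eq.trans ?_ rhs.2.symm)
    linear_combination s3 t ht
  exact ae_solvesODE_of_volterra (by have := continuous_freq (n := n); fun_prop)
    (by have := continuous_freq (n := n); fun_prop) (by have := continuous_freq (n := n); fun_prop)
    c₁ c₂ c₃ z₁ z₂ z₃ d₁ d₂ d₃ hvol ht

/-! ### Bounded Fourier transforms and Gaussian weights -/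

theorem norm_le_one_add_mul (f : L2 n) (x : Space n) : ‖f x‖ ≤ (1 + ‖x‖) * ‖f x‖ :=
  le_mul_of_one_le_left (norm_nonneg _) (by linarith [norm_nonneg x])

theorem MemL11.integrable {f : L2 n} (hf : MemL11 f) : Integrable f volume :=
  Integrable.mono' hf (Lp.aestronglyMeasurable f)
    (Filter.Eventually.of_forall fun x => norm_le_one_add_mul f x)

theorem normL11_nonneg (f : L2 n) : 0 ≤ normL11 f :=
  integral_nonneg fun x => by positivity

/-- The `L²` Fourier transform of an integrable function is the Fourier integral. -/
theorem coeFn_fourier_of_integrable {f : L2 n} (hf : Integrable f volume) :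
    (𝓕 f : L2 n) =ᵐ[volume] 𝓕 (f : Space n → ℂ) := by
  have hF : Continuous (𝓕 (f : Space n → ℂ)) :=
    VectorFourier.fourierIntegral_continuous Real.continuous_fourierChar continuous_inner hf
  refine ae_eq_of_pairing (locallyIntegrable_coeFn _) hF.locallyIntegrable fun g => ?_
  rw [← pairing_apply, ← coe_apply_fourier, Lp.toTemperedDistribution_apply]
  have := VectorFourier.integral_fourierIntegral_smul_eq_flip (L := innerₗ (Space n))
      Real.continuous_fourierChar continuous_inner g.integrable (μ := volume) (ν := volume) hf
  simp only [flip_innerₗ] at this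
  exact this

theorem norm_fourier_le_normL11 {f : L2 n} (hf : MemL11 f) :
    ∀ᵐ ξ : Space n, ‖(𝓕 f : L2 n) ξ‖ ≤ normL11 f := by
  filter_upwards [coeFn_fourier_of_integrable hf.integrable] with ξ hξ
  rw [hξ]
  refine (VectorFourier.norm_fourierIntegral_le_integral_norm _ _ _ _ _).trans ?_
  exact integral_mono hf.integrable.norm hf fun x => norm_le_one_add_mul f x

/-- In polar coordinates the radial integrand is a Gaussian times `y^(n-1+2k)`, which is integrable
at the origin when `n + 2k > 0`. -/
theorem integrable_freq_rpow_mul_exp [Nontrivial (Space n)] {k c : ℝ} (hk : 0 < n + 2 * k)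
    (hn : 1 ≤ n) (hc : 0 < c) :
    Integrable (fun ξ : Space n => (freq ξ ^ k * Real.exp (-(c * freq ξ ^ 2))) ^ 2) volume := by
  have h := (integrable_fun_norm_addHaar (volume : Measure (Space n))
    (f := fun y => ((2 * Real.pi * y) ^ k * Real.exp (-(c * (2 * Real.pi * y) ^ 2))) ^ 2)).2 ?_
  · exact h
  have hb : 0 < 2 * c * (2 * Real.pi) ^ 2 := by positivity
  have h1 := ((integrable_rpow_mul_exp_neg_mul_sq hb
    (s := n - 1 + 2 * k) (by linarith)).const_mul (((2 * Real.pi) ^ k) ^ 2)).integrableOn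
    (s := Ioi 0)
  refine h1.congr_fun (fun y hy => ?_) measurableSet_Ioi
  have hy0 : 0 < y := hy
  have e1 : y ^ ((n : ℝ) - 1 + 2 * k) = y ^ (n - 1) * (y ^ k) ^ 2 := by
    rw [Real.rpow_add hy0, ← Real.rpow_natCast, ← Real.rpow_natCast, ← Real.rpow_mul hy0.le,
      Nat.cast_sub hn]
    push_cast
    ring_nf
  have e2 : Real.exp (-(2 * c * (2 * Real.pi) ^ 2) * y ^ 2) =
      Real.exp (-(c * (2 * Real.pi * y) ^ 2)) ^ 2 := by
    rw [sq (Real.exp _), ← Real.exp_add]; congr 1; ring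
  simp only [finrank_euclideanSpace, Fintype.card_fin, smul_eq_mul]
  rw [e1, e2, Real.mul_rpow (by positivity) hy0.le]
  ring

theorem norm_toLp_two {α : Type*} [MeasurableSpace α] {μ : Measure α} {f : α → ℝ}
    (hf : MemLp f 2 μ) : ‖hf.toLp f‖ = √(∫ x, f x ^ 2 ∂μ) := by
  rw [Lp.norm_toLp, hf.eLpNorm_eq_integral_rpow_norm (by norm_num) (by norm_num),
    ENNReal.toReal_ofReal (by positivity), Real.sqrt_eq_rpow]
  simp

/-- The decay of the Gaussian weights in `L²`. -/
theorem exists_gaussian_weight [Nontrivial (Space n)] {k c : ℝ} (hk : 0 < n + 2 * k)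
    (hn : 1 ≤ n) (hc : 0 < c) :
    ∃ N : ℝ, 0 ≤ N ∧ ∀ s : ℝ, 0 < s → ∃ H : Lp ℝ 2 (volume : Measure (Space n)),
      (H =ᵐ[volume] fun ξ => freq ξ ^ k * Real.exp (-(c * (freq ξ ^ 2 * s)))) ∧
      ‖H‖ = N * s ^ (-(k / 2) - (n : ℝ) / 4) := by
  set G : Space n → ℝ := fun ξ => (freq ξ ^ k * Real.exp (-(c * freq ξ ^ 2))) ^ 2 with hG
  have hGi : Integrable G volume := integrable_freq_rpow_mul_exp hk hn hc
  refine ⟨√(∫ ξ, G ξ), Real.sqrt_nonneg _, fun s hs => ?_⟩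
  have hf0 : ∀ ξ : Space n, 0 ≤ freq ξ := fun ξ => by unfold freq; positivity
  have hR : 0 < √s := Real.sqrt_pos.2 hs
  have hsc : ∀ ξ : Space n, freq (√s • ξ) = √s * freq ξ := fun ξ => by
    unfold freq; rw [norm_smul, Real.norm_of_nonneg hR.le]; ring
  set F : Space n → ℝ := fun ξ => freq ξ ^ k * Real.exp (-(c * (freq ξ ^ 2 * s))) with hF
  -- Scaling `ξ ↦ √s ξ` reduces to `s = 1`: the weight contributes `s^(-k)` and the Jacobian
  -- `s^(-n/2)`, and the square root of the product is the stated power.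
  have hFG : ∀ ξ, F ξ ^ 2 = s ^ (-k) * G (√s • ξ) := fun ξ => by
    simp only [hF, hG, hsc]
    rw [Real.mul_rpow hR.le (hf0 ξ), mul_pow √s, Real.sq_sqrt hs.le]
    have : s ^ (-k) * ((√s) ^ k) ^ 2 = 1 := by
      rw [Real.sqrt_eq_rpow, ← Real.rpow_mul hs.le, ← Real.rpow_natCast, ← Real.rpow_mul hs.le,
        ← Real.rpow_add hs]
      convert Real.rpow_zero s using 2
      push_cast; ring
    rw [mul_comm s]
    linear_combination (-(freq ξ ^ k * Real.exp (-(c * (freq ξ ^ 2 * s)))) ^ 2) * this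
  have hFi : Integrable (fun ξ => F ξ ^ 2) volume := by
    simp only [hFG]
    exact ((integrable_comp_smul_iff volume G hR.ne').2 hGi).const_mul _
  have hFm : Measurable F := by
    have := (continuous_freq (n := n)).measurable
    fun_prop
  have hFL : MemLp F 2 volume := (memLp_two_iff_integrable_sq hFm.aestronglyMeasurable).2 hFi
  refine ⟨hFL.toLp F, hFL.coeFn_toLp, ?_⟩
  rw [norm_toLp_two]
  simp only [hFG]
  rw [integral_const_mul, Measure.integral_comp_smul_of_nonneg _ _ _ (hR := hR.le), smul_eq_mul,
    finrank_euclideanSpace, Fintype.card_fin, ← mul_assoc, Real.sqrt_mul (by positivity), mul_comm]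
  congr 1
  have : s ^ (-k) * ((√s) ^ n)⁻¹ = (s ^ (-(k / 2) - (n : ℝ) / 4)) ^ 2 := by
    rw [Real.sqrt_eq_rpow, ← Real.rpow_natCast, ← Real.rpow_natCast, ← Real.rpow_mul hs.le,
      ← Real.rpow_mul hs.le, ← Real.rpow_neg hs.le, ← Real.rpow_add hs]
    congr 1
    push_cast; ring
  rw [this, Real.sqrt_sq (by positivity)]

theorem exists_exp_le_rpow {c : ℝ} (hc : 0 < c) (p : ℝ) :
    ∃ D : ℝ, 0 < D ∧ ∀ t, 0 ≤ t → Real.exp (-(c * t)) ≤ D * (1 + t) ^ (-p) := by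
  obtain ⟨m, hm⟩ := exists_nat_ge p
  -- One term of the exponential series at `c (1 + t)` dominates the power; the shift from `t` to `1
  -- + t` costs `exp c`.
  refine ⟨Real.exp c * m.factorial / c ^ m, by positivity, fun t ht => ?_⟩
  have h1 := Real.pow_div_factorial_le_exp (x := c * (1 + t)) (by positivity) m
  have h2 : (1 + t) ^ p ≤ (1 + t) ^ m := by
    rw [← Real.rpow_natCast]
    exact Real.rpow_le_rpow_of_exponent_le (by linarith) hm
  have h3 : Real.exp (c * (1 + t)) = Real.exp c * Real.exp (c * t) := by
    rw [← Real.exp_add]; congr 1; ring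
  rw [Real.rpow_neg (by linarith), ← div_eq_mul_inv, le_div_iff₀ (by positivity), Real.exp_neg,
    inv_mul_le_iff₀ (Real.exp_pos _)]
  refine h2.trans ?_
  rw [h3, div_le_iff₀ (by positivity), mul_pow] at h1
  rw [← mul_div_assoc, le_div_iff₀ (by positivity)]
  linarith

/-! ### Assembly of the L² estimate -/

theorem IsSolution.exists_fourier_bound {b ν γ κ : ℝ} (hb : 0 < b) (hν : 0 < ν) (hγ : 1 < γ)
    (hκ : 0 < κ) : ∃ C c r₁ : ℝ, 0 < C ∧ 0 < c ∧ ∀ (ψ₀ ψ₁ ψ₂ : L2 n) (ψ : ℝ → L2 n),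
      IsSolution b ν γ κ ψ₀ ψ₁ ψ₂ ψ → ∀ t, 0 ≤ t → ∀ᵐ ξ : Space n, 0 < freq ξ →
      (freq ξ ≤ r₁ → ‖(𝓕 (ψ t - J0 κ t ψ₀ - J1 (soundDiffusivity b ν γ κ) t ψ₁
        - J2 (soundDiffusivity b ν γ κ) κ t ψ₂) : L2 n) ξ‖ ≤
        C * Real.exp (-(c * (freq ξ ^ 2 * t))) * (freq ξ * ‖(𝓕 ψ₀ : L2 n) ξ‖
          + ‖(𝓕 ψ₁ : L2 n) ξ‖ + ‖(𝓕 ψ₂ : L2 n) ξ‖ / freq ξ)) ∧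
      (r₁ ≤ freq ξ → ‖(𝓕 (ψ t - J0 κ t ψ₀ - J1 (soundDiffusivity b ν γ κ) t ψ₁
        - J2 (soundDiffusivity b ν γ κ) κ t ψ₂) : L2 n) ξ‖ ≤
        C * Real.exp (-(c * t)) * (‖(𝓕 ψ₀ : L2 n) ξ‖ + ‖(𝓕 ψ₁ : L2 n) ξ‖
          + ‖(𝓕 ψ₂ : L2 n) ξ‖)) := by
  set δ := soundDiffusivity b ν γ κ with hδ
  have hδ0 : 0 < δ := by
    have : 0 < (γ - 1) * κ := mul_pos (by linarith) hκ
    rw [hδ, soundDiffusivity]; positivity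
  obtain ⟨e, he⟩ : ∃ e, e = κ * δ + κ * (γ - 1) * (b * ν - κ) := ⟨_, rfl⟩
  -- The terms with `κ²` cancel and leave `e = γκbν`, which is positive whatever the sign of `bν -
  -- κ`.
  have he0 : 0 < e := by
    have : e = γ * κ * (b * ν) := by rw [he, hδ, soundDiffusivity]; ring
    rw [this]
    have : 0 < γ := by linarith
    positivity
  obtain ⟨C, c, r₁, hC, hc, -, h⟩ := exists_frequency_bounds rfl he0 hδ0 hκ
  refine ⟨C, c, r₁, hC, hc, fun ψ₀ ψ₁ ψ₂ ψ hψ t ht => ?_⟩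
  have hlin : (𝓕 (ψ t - J0 κ t ψ₀ - J1 δ t ψ₁ - J2 δ κ t ψ₂) : L2 n) =
      𝓕 (ψ t) - 𝓕 (J0 κ t ψ₀) - 𝓕 (J1 δ t ψ₁) - 𝓕 (J2 δ κ t ψ₂) := by
    have := fun f g : L2 n => map_sub (Lp.fourierTransformₗᵢ (Space n) ℂ) f g
    change ∀ f g : L2 n, (𝓕 (f - g) : L2 n) = 𝓕 f - 𝓕 g at this
    rw [this, this, this]
  rw [hlin]
  filter_upwards [hψ.ae_solvesODE hδ he ht,
    fourier_radialMultiplier (measurable_symbolJ0 κ t) (fun r _ => abs_symbolJ0_le hκ.le ht r) ψ₀,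
    fourier_radialMultiplier (measurable_symbolJ1 δ t) (fun r _ => abs_symbolJ1_le hδ0.le ht r) ψ₁,
    fourier_radialMultiplier (measurable_symbolJ2 δ κ t)
      (fun r _ => abs_symbolJ2_le hδ0.le hκ.le ht r) ψ₂,
    Lp.coeFn_sub (𝓕 (ψ t) - 𝓕 (J0 κ t ψ₀) - 𝓕 (J1 δ t ψ₁) : L2 n) (𝓕 (J2 δ κ t ψ₂)),
    Lp.coeFn_sub (𝓕 (ψ t) - 𝓕 (J0 κ t ψ₀) : L2 n) (𝓕 (J1 δ t ψ₁)),
    Lp.coeFn_sub (𝓕 (ψ t) : L2 n) (𝓕 (J0 κ t ψ₀))] with ξ k0 k1 k2 k3 k4 k5 k6 hξ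
  obtain ⟨y, y₁, y₂, hy, e0, e1, e2, e3⟩ := k0
  rw [k4, Pi.sub_apply, k5, Pi.sub_apply, k6, Pi.sub_apply, J0, J1, J2, k1, k2, k3, e3, ← e0, ← e1,
    ← e2]
  exact h (freq ξ) hξ y y₁ y₂ hy t ht

/-- The pointwise norm of an `L²` function. -/
def absL2 (f : L2 n) : Lp ℝ 2 (volume : Measure (Space n)) := (Lp.memLp f).norm.toLp

theorem coeFn_absL2 (f : L2 n) : absL2 f =ᵐ[volume] fun ξ => ‖f ξ‖ :=
  (Lp.memLp f).norm.coeFn_toLp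

theorem norm_absL2 (f : L2 n) : ‖absL2 f‖ = ‖f‖ := by
  rw [absL2, Lp.norm_toLp, eLpNorm_norm, Lp.norm_def]

/-- One majorant for all frequencies: for `r ≤ r₁` passing from `t` to `1 + t` in the Gaussian costs
at most `exp(c r₁²)`, which avoids a singularity at `t = 0`. The bounded transforms `l` go with the
Gaussian weights, the `L²` functions `p` with the exponential factor. -/
theorem le_add_of_frequency_bounds {C c r₁ t r z p₀ p₁ p₂ l₀ l₁ l₂ K E : ℝ} (hC : 0 < C)
    (hc : 0 < c) (hr : 0 < r) (hK : K = C * Real.exp (c * r₁ ^ 2))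
    (hE : E = C * Real.exp (-(c * t)))
    (low : r ≤ r₁ → z ≤ C * Real.exp (-(c * (r ^ 2 * t))) * (r * p₀ + p₁ + p₂ / r))
    (high : r₁ ≤ r → z ≤ C * Real.exp (-(c * t)) * (p₀ + p₁ + p₂))
    (h₀ : 0 ≤ p₀) (h₁ : 0 ≤ p₁) (h₂ : 0 ≤ p₂) (h₀' : p₀ ≤ l₀) (h₁' : p₁ ≤ l₁) (h₂' : p₂ ≤ l₂) :
    z ≤ (K * l₀ * (r ^ (1 : ℝ) * Real.exp (-(c * (r ^ 2 * (1 + t)))))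
        + K * l₁ * (r ^ (0 : ℝ) * Real.exp (-(c * (r ^ 2 * (1 + t)))))
        + K * l₂ * (r ^ (-1 : ℝ) * Real.exp (-(c * (r ^ 2 * (1 + t))))))
        + E * (p₀ + p₁ + p₂) := by
  have l₀0 := h₀.trans h₀'
  have l₁0 := h₁.trans h₁'
  have l₂0 := h₂.trans h₂'
  have hK0 : 0 < K := by rw [hK]; positivity
  have hE0 : 0 < E := by rw [hE]; positivity
  rcases le_total r r₁ with hle | hle
  · refine (low hle).trans (le_add_of_le_of_nonneg ?_ (by positivity))
    rw [Real.rpow_one, Real.rpow_zero, Real.rpow_neg_one]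
    have hg : C * Real.exp (-(c * (r ^ 2 * t))) ≤ K * Real.exp (-(c * (r ^ 2 * (1 + t)))) := by
      rw [hK, mul_assoc, ← Real.exp_add]
      have := mul_le_mul_of_nonneg_left (pow_le_pow_left₀ hr.le hle 2) hc.le
      exact mul_le_mul_of_nonneg_left (Real.exp_le_exp.2 (by linarith)) hC.le
    have hb : r * p₀ + p₁ + p₂ / r ≤ r * l₀ + l₁ + l₂ / r := by gcongr
    refine (mul_le_mul hg hb (by positivity) (by positivity)).trans (le_of_eq ?_)
    ring
  · refine (high hle).trans ?_
    rw [← hE]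
    exact le_add_of_nonneg_left (by positivity)

theorem add_mul_le_of_decay {K S D E a₀ N a l m : ℝ} (hK : 0 ≤ K) (hD : 0 ≤ D)
    (hE : E ≤ D * a₀) (hN : 0 ≤ N) (hNS : N ≤ S) (ha : 0 ≤ a) (haa : a₀ ≤ a) (hl : 0 ≤ l)
    (hm : 0 ≤ m) : K * l * (N * a) + E * m ≤ (K * S + D) * (a * (m + l)) := by
  have hS := hN.trans hNS
  have e1 : K * l * (N * a) ≤ K * l * (S * a) := by gcongr
  have e2 : E * m ≤ D * a * m := mul_le_mul_of_nonneg_right (hE.trans (by gcongr)) hm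
  have e3 : 0 ≤ K * S * a * m := by positivity
  have e4 : 0 ≤ D * a * l := by positivity
  linarith

end Blackstock

end

theorem mainTheorem2 (n : ℕ) (hn : 3 ≤ n) (b ν γ κ : ℝ) (hb : 0 < b) (hν : 0 < ν)
    (hγ : 1 < γ) (hγ' : γ ≤ 5 / 3) (hκ : 0 < κ) :
    ∃ C : ℝ, 0 < C ∧ ∀ (ψ₀ ψ₁ ψ₂ : Blackstock.L2 n),
      Blackstock.MemL11 ψ₀ → Blackstock.MemL11 ψ₁ → Blackstock.MemL11 ψ₂ →
      ∀ ψ : ℝ → Blackstock.L2 n, Blackstock.IsSolution b ν γ κ ψ₀ ψ₁ ψ₂ ψ →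
      ∀ t : ℝ, 0 ≤ t →
        ‖ψ t - Blackstock.J0 κ t ψ₀
            - Blackstock.J1 (Blackstock.soundDiffusivity b ν γ κ) t ψ₁
            - Blackstock.J2 (Blackstock.soundDiffusivity b ν γ κ) κ t ψ₂‖ ≤
          C * ((1 + t) ^ (-(1 / 2 : ℝ) - (n : ℝ) / 4) * Blackstock.normL2L11 ψ₀
            + (1 + t) ^ (-((n : ℝ) / 4)) * Blackstock.normL2L11 ψ₁
            + (1 + t) ^ ((1 / 2 : ℝ) - (n : ℝ) / 4) * Blackstock.normL2L11 ψ₂) := by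
  open Blackstock in
  have hn3 : (3 : ℝ) ≤ n := by exact_mod_cast hn
  have hn1 : 1 ≤ n := by omega
  have : Nonempty (Fin n) := ⟨⟨0, by omega⟩⟩
  have : Nontrivial (Space n) := inferInstance
  obtain ⟨C, c, r₁, hC, hc, hmain⟩ := IsSolution.exists_fourier_bound (n := n) hb hν hγ hκ
  obtain ⟨N₀, hN₀, w₀⟩ := exists_gaussian_weight (n := n) (k := 1) (by linarith) hn1 hc
  obtain ⟨N₁, hN₁, w₁⟩ := exists_gaussian_weight (n := n) (k := 0) (by linarith) hn1 hc
  -- The weight `r⁻¹` belongs to `ψ₂`; its square is integrable at the origin since `n - 2 > 0`.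
  obtain ⟨N₂, hN₂, w₂⟩ := exists_gaussian_weight (n := n) (k := -1) (by linarith) hn1 hc
  -- The exponential is compared with the fastest of the three rates, so that it fits below each of
  -- them.
  obtain ⟨D, hD, hexp⟩ := exists_exp_le_rpow hc (1 / 2 + (n : ℝ) / 4)
  obtain ⟨K, hK⟩ : ∃ K, K = C * Real.exp (c * r₁ ^ 2) := ⟨_, rfl⟩
  have hK0 : 0 < K := by rw [hK]; positivity
  refine ⟨K * (N₀ + N₁ + N₂) + C * D, by positivity, fun ψ₀ ψ₁ ψ₂ h₀ h₁ h₂ ψ hψ t ht => ?_⟩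
  have hs : 0 < 1 + t := by linarith
  obtain ⟨H₀, H₀c, H₀n⟩ := w₀ (1 + t) hs
  obtain ⟨H₁, H₁c, H₁n⟩ := w₁ (1 + t) hs
  obtain ⟨H₂, H₂c, H₂n⟩ := w₂ (1 + t) hs
  obtain ⟨l₀, hl₀⟩ : ∃ l, l = normL11 ψ₀ := ⟨_, rfl⟩
  obtain ⟨l₁, hl₁⟩ : ∃ l, l = normL11 ψ₁ := ⟨_, rfl⟩
  obtain ⟨l₂, hl₂⟩ : ∃ l, l = normL11 ψ₂ := ⟨_, rfl⟩
  have l₀0 : 0 ≤ l₀ := hl₀ ▸ normL11_nonneg ψ₀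
  have l₁0 : 0 ≤ l₁ := hl₁ ▸ normL11_nonneg ψ₁
  have l₂0 : 0 ≤ l₂ := hl₂ ▸ normL11_nonneg ψ₂
  obtain ⟨E, hE⟩ : ∃ E, E = C * Real.exp (-(c * t)) := ⟨_, rfl⟩
  have hE0 : 0 < E := by rw [hE]; positivity
  rw [← Lp.norm_fourier_eq]
  set Z : L2 n := 𝓕 (ψ t - J0 κ t ψ₀ - J1 (soundDiffusivity b ν γ κ) t ψ₁
    - J2 (soundDiffusivity b ν γ κ) κ t ψ₂) with hZ
  set G₁ := (K * l₀) • H₀ + (K * l₁) • H₁ + (K * l₂) • H₂ with hG₁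
  set A := absL2 (𝓕 ψ₀ : L2 n) + absL2 (𝓕 ψ₁ : L2 n) + absL2 (𝓕 ψ₂ : L2 n) with hA
  -- The majorant is itself an element of `L²`, so its norm splits by the triangle inequality. The
  -- null set `ξ = 0` is discarded because of the weight `r⁻¹`.
  have hdom : ‖Z‖ ≤ ‖G₁ + E • A‖ := by
    refine Lp.norm_le_norm_of_ae_le ?_
    have hne : ∀ᵐ ξ : Space n, ξ ≠ 0 := by
      rw [ae_iff]; simp
    filter_upwards [hne, hmain ψ₀ ψ₁ ψ₂ ψ hψ t ht, norm_fourier_le_normL11 h₀,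
      norm_fourier_le_normL11 h₁, norm_fourier_le_normL11 h₂, H₀c, H₁c, H₂c,
      Lp.coeFn_add G₁ (E • A), Lp.coeFn_smul E A, Lp.coeFn_add ((K * l₀) • H₀ + (K * l₁) • H₁)
        ((K * l₂) • H₂), Lp.coeFn_add ((K * l₀) • H₀) ((K * l₁) • H₁), Lp.coeFn_smul (K * l₀) H₀,
      Lp.coeFn_smul (K * l₁) H₁, Lp.coeFn_smul (K * l₂) H₂,
      Lp.coeFn_add (absL2 (𝓕 ψ₀ : L2 n) + absL2 (𝓕 ψ₁ : L2 n)) (absL2 (𝓕 ψ₂ : L2 n)),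
      Lp.coeFn_add (absL2 (𝓕 ψ₀ : L2 n)) (absL2 (𝓕 ψ₁ : L2 n)), coeFn_absL2 (𝓕 ψ₀ : L2 n),
      coeFn_absL2 (𝓕 ψ₁ : L2 n), coeFn_absL2 (𝓕 ψ₂ : L2 n)]
      with ξ k0 k1 k2 k3 k4 k5 k6 k7 k8 k9 k10 k11 k12 k13 k14 k15 k16 k17 k18 k19
    have hr : 0 < freq ξ := by
      have := norm_pos_iff.2 k0
      unfold freq; positivity
    have hval : (G₁ + E • A : Lp ℝ 2 (volume : Measure (Space n))) ξ =
        (K * l₀ * (freq ξ ^ (1 : ℝ) * Real.exp (-(c * (freq ξ ^ 2 * (1 + t)))))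
        + K * l₁ * (freq ξ ^ (0 : ℝ) * Real.exp (-(c * (freq ξ ^ 2 * (1 + t)))))
        + K * l₂ * (freq ξ ^ (-1 : ℝ) * Real.exp (-(c * (freq ξ ^ 2 * (1 + t))))))
        + E * (‖(𝓕 ψ₀ : L2 n) ξ‖ + ‖(𝓕 ψ₁ : L2 n) ξ‖ + ‖(𝓕 ψ₂ : L2 n) ξ‖) := by
      rw [k8, Pi.add_apply, k9, Pi.smul_apply, k10, Pi.add_apply, k11, Pi.add_apply, k12, k13, k14,
        Pi.smul_apply, Pi.smul_apply, Pi.smul_apply, k15, Pi.add_apply, k16, Pi.add_apply, k5, k6,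
        k7, k17, k18, k19]
      simp only [smul_eq_mul]
    rw [hval]
    obtain ⟨low, high⟩ := k1 hr
    exact (le_add_of_frequency_bounds hC hc hr hK hE low high (norm_nonneg _) (norm_nonneg _)
      (norm_nonneg _) (hl₀ ▸ k2) (hl₁ ▸ k3) (hl₂ ▸ k4)).trans (Real.le_norm_self _)
  have nE : E ≤ C * D * (1 + t) ^ (-(1 / 2 : ℝ) - (n : ℝ) / 4) := by
    rw [hE, mul_assoc, show -(1 / 2 : ℝ) - (n : ℝ) / 4 = -(1 / 2 + (n : ℝ) / 4) by ring]
    exact mul_le_mul_of_nonneg_left (hexp t ht) hC.le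
  have nG : ‖G₁‖ ≤ K * l₀ * ‖H₀‖ + K * l₁ * ‖H₁‖ + K * l₂ * ‖H₂‖ := by
    refine (norm_add_le _ _).trans (add_le_add ((norm_add_le _ _).trans (add_le_add ?_ ?_)) ?_) <;>
    · rw [norm_smul, Real.norm_of_nonneg (by positivity)]
  have nA : ‖A‖ ≤ ‖ψ₀‖ + ‖ψ₁‖ + ‖ψ₂‖ := by
    refine (norm_add_le _ _).trans (add_le_add ((norm_add_le _ _).trans (add_le_add ?_ ?_)) ?_) <;>
    · rw [norm_absL2, Lp.norm_fourier_eq]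
  have nEA : ‖E • A‖ ≤ E * (‖ψ₀‖ + ‖ψ₁‖ + ‖ψ₂‖) := by
    rw [norm_smul, Real.norm_of_nonneg hE0.le]
    exact mul_le_mul_of_nonneg_left nA hE0.le
  refine (hdom.trans ((norm_add_le _ _).trans (add_le_add nG nEA))).trans ?_
  rw [H₀n, H₁n, H₂n, show -((1 : ℝ) / 2) - (n : ℝ) / 4 = -(1 / 2 : ℝ) - (n : ℝ) / 4 by ring,
    show -((0 : ℝ) / 2) - (n : ℝ) / 4 = -((n : ℝ) / 4) by ring,
    show -((-1 : ℝ) / 2) - (n : ℝ) / 4 = (1 / 2 : ℝ) - (n : ℝ) / 4 by ring]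
  have mono01 : (1 + t) ^ (-(1 / 2 : ℝ) - (n : ℝ) / 4) ≤ (1 + t) ^ (-((n : ℝ) / 4)) :=
    Real.rpow_le_rpow_of_exponent_le (by linarith) (by linarith)
  have mono02 : (1 + t) ^ (-(1 / 2 : ℝ) - (n : ℝ) / 4) ≤ (1 + t) ^ ((1 / 2 : ℝ) - (n : ℝ) / 4) :=
    Real.rpow_le_rpow_of_exponent_le (by linarith) (by linarith)
  have p₀ : 0 < (1 + t) ^ (-(1 / 2 : ℝ) - (n : ℝ) / 4) := by positivity
  have p₁ : 0 < (1 + t) ^ (-((n : ℝ) / 4)) := by positivity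
  have p₂ : 0 < (1 + t) ^ ((1 / 2 : ℝ) - (n : ℝ) / 4) := by positivity
  simp only [normL2L11, ← hl₀, ← hl₁, ← hl₂]
  have q₀ := add_mul_le_of_decay hK0.le (by positivity) nE hN₀
    (by linarith : N₀ ≤ N₀ + N₁ + N₂) p₀.le le_rfl l₀0 (norm_nonneg ψ₀)
  have q₁ := add_mul_le_of_decay hK0.le (by positivity) nE hN₁
    (by linarith : N₁ ≤ N₀ + N₁ + N₂) p₁.le mono01 l₁0 (norm_nonneg ψ₁)
  have q₂ := add_mul_le_of_decay hK0.le (by positivity) nE hN₂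
    (by linarith : N₂ ≤ N₀ + N₁ + N₂) p₂.le mono02 l₂0 (norm_nonneg ψ₂)
  linarith only [q₀, q₁, q₂]
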